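/- **Definitions.** For $A\in\mathbb R^{m\times n}$ let $\Pi_A$ be the orthogonal projection onto $\operatorname{im}A$ and $\operatorname{nnz}(A)$ the number of non-zero entries of $A$. An LSA instance is a triple $(A,c,\epsilon)$ with $A\in\mathbb R^{m\times n}$, $A\ne 0$, $\operatorname{nnz}(A)\ge\max(m,n)$, $c\in\mathbb R^m$, $0<\epsilon\le 1$; a solution of it is an $x\in\mathbb R^n$ with $\|Ax-\Pi_Ac\|_2\le\epsilon\|\Pi_Ac\|_2$. Its sparse parameter complexity is $$\mathcal S(A,c,\epsilon)=\Bigl(\operatorname{nnz}(A),\ \max\bigl(\|A\|_{\max},\|c\|_{\max},\tfrac1{\min_+(A)},\tfrac1{\min_+(c)}\bigr),\ \kappa(A),\ \epsilon^{-1}\Bigr),$$ where $\|\cdot\|_{\max}$ is the largest absolute value of an entry, $\min_+$ is the smallest absolute value of a non-zero entry (the term $1/\min_+(c)$ is omitted if $c=0$), and $\kappa(A)=\sigma_{\max}(A)/\sigma_{\min}(A)$ is the ratio of the largest to the smallest non-zero singular value. $\mathcal G_{z,2}$ is the class of all integer matrices with at least one non-zero entry in every row and every column, in which every row sums to zero and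 the positive entries of every row sum to a power of $2$. $\mathcal{MC}_2$ (2-commodity incidence matrices) is the class of all real matrices with $2N$ columns, for some $N$, grouped into consecutive pairs that correspond to variables $(u_1,v_1),\dots,(u_N,v_N)$, in which every row is the coefficient vector of $w(u_i-u_j)$, $w(v_i-v_j)$ or $w\bigl(u_i-v_i-(u_j-v_j)\bigr)$ for some $i\neq j$ and $w\in\mathbb R$, depending on the row. Let $f:\mathbb R_{>0}^4\to\mathbb R_{>0}^4$ be non-decreasing in every variable. Algorithms are programs of a real RAM (unit-cost $+,-,\times,/,\sqrt{\ }$ and comparisons on reals, integer arithmetic, indexed memory access, no rounding); a matrix is given by its dimensions and the list of its non-zero entries sorted by rows. We write $\mathcal G_{z,2}\le_f\mathcal{MC}_2$ (efficient $f$-reducibility) if there are two algorithms $\mathcal A_{1\to2}$, $\mathcal A_{1\leftarrow2}$ such that for every LSA instance $(M^1,c^1,\epsilon_1)$ with $M^1\in\mathcal G_{z,2}$, with $\mathcal S(M^1,c^1,\epsilon_1)=(s,U,K,\epsilon_1^{-1})$: * $\mathcal A_{1\to2}(M^1,c^1,\epsilon_1)$ returns, in time $O(s\log(sU))$, an LSA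 instance $(M^2,c^2,\epsilon_2)$ with $M^2\in\mathcal{MC}_2$ and $\mathcal S(M^2,c^2,\epsilon_2)\le f(\mathcal S(M^1,c^1,\epsilon_1))$ coordinatewise; * for every solution $x^2$ of $(M^2,c^2,\epsilon_2)$, $\mathcal A_{1\leftarrow2}(M^1,M^2,x^2)$ returns, in time $O(s)$, a solution of $(M^1,c^1,\epsilon_1)$. **Lemma.** There is a function $f$ as above with $$f(s,U,K,\epsilon^{-1})=\Bigl(O(s\log(sU)),\ O\bigl(s^{3/2}U\log^{1/2}(sU)\bigr),\ O\bigl(Ks^4U^2\log^2(sU)\bigr),\ O\bigl(sU^2\epsilon^{-1}\bigr)\Bigr)$$ uniformly for $s\ge2$ and $U,K,\epsilon^{-1}\ge1$, such that $\mathcal G_{z,2}\le_f\mathcal{MC}_2$. All implied constants are absolute. -/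

import Mathlib

/-! ### A real RAM

The machine has finitely many (per program) integer arrays and real arrays, all with random
access.  It performs exact arithmetic on reals at unit cost, but it has no rounding operation:
no information flows from reals to integers except through comparisons.  Programs are given in
structured form; a program is a fixed finite object whose constants are rational. -/

namespace RealRAM

/-- Memory: `int a i` and `real a i` are the `i`-th cells of the `a`-th integer and real array. -/
structure State where
  int : ℕ → ℤ → ℤ
  real : ℕ → ℤ → ℝ

/-- Integer expressions. -/
inductive IExpr where
  | const (z : ℤ)
  | get (a : ℕ) (i : IExpr)
  | add (e₁ e₂ : IExpr)
  | sub (e₁ e₂ : IExpr)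
  | mul (e₁ e₂ : IExpr)

/-- Real expressions. -/
inductive RExpr where
  | const (q : ℚ)
  | ofInt (e : IExpr)
  | get (a : ℕ) (i : IExpr)
  | add (e₁ e₂ : RExpr)
  | sub (e₁ e₂ : RExpr)
  | mul (e₁ e₂ : RExpr)
  | div (e₁ e₂ : RExpr)
  | sqrt (e : RExpr)

/-- Tests. -/
inductive BExpr where
  | ilt (e₁ e₂ : IExpr)
  | ieq (e₁ e₂ : IExpr)
  | rlt (e₁ e₂ : RExpr)
  | req (e₁ e₂ : RExpr)
  | not (b : BExpr)
  | and (b₁ b₂ : BExpr)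

/-- Programs. -/
inductive Stmt where
  | skip
  | setInt (a : ℕ) (i : IExpr) (e : IExpr)
  | setReal (a : ℕ) (i : IExpr) (e : RExpr)
  | seq (p q : Stmt)
  | cond (b : BExpr) (p q : Stmt)
  | loop (b : BExpr) (p : Stmt)

def IExpr.eval (σ : State) : IExpr → ℤ
  | .const z => z
  | .get a i => σ.int a (i.eval σ)
  | .add e₁ e₂ => e₁.eval σ + e₂.eval σ
  | .sub e₁ e₂ => e₁.eval σ - e₂.eval σ
  | .mul e₁ e₂ => e₁.eval σ * e₂.eval σ

noncomputable def RExpr.eval (σ : State) : RExpr → ℝ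
  | .const q => (q : ℝ)
  | .ofInt e => (e.eval σ : ℝ)
  | .get a i => σ.real a (i.eval σ)
  | .add e₁ e₂ => e₁.eval σ + e₂.eval σ
  | .sub e₁ e₂ => e₁.eval σ - e₂.eval σ
  | .mul e₁ e₂ => e₁.eval σ * e₂.eval σ
  | .div e₁ e₂ => e₁.eval σ / e₂.eval σ
  | .sqrt e => Real.sqrt (e.eval σ)

def BExpr.eval (σ : State) : BExpr → Prop
  | .ilt e₁ e₂ => e₁.eval σ < e₂.eval σ
  | .ieq e₁ e₂ => e₁.eval σ = e₂.eval σ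
  | .rlt e₁ e₂ => e₁.eval σ < e₂.eval σ
  | .req e₁ e₂ => e₁.eval σ = e₂.eval σ
  | .not b => ¬ b.eval σ
  | .and b₁ b₂ => b₁.eval σ ∧ b₂.eval σ

/-- Number of elementary operations in the evaluation of an integer expression. -/
def IExpr.cost : IExpr → ℕ
  | .const _ => 1
  | .get _ i => i.cost + 1
  | .add e₁ e₂ => e₁.cost + e₂.cost + 1
  | .sub e₁ e₂ => e₁.cost + e₂.cost + 1
  | .mul e₁ e₂ => e₁.cost + e₂.cost + 1

/-- Number of elementary operations in the evaluation of a real expression. -/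
def RExpr.cost : RExpr → ℕ
  | .const _ => 1
  | .ofInt e => e.cost + 1
  | .get _ i => i.cost + 1
  | .add e₁ e₂ => e₁.cost + e₂.cost + 1
  | .sub e₁ e₂ => e₁.cost + e₂.cost + 1
  | .mul e₁ e₂ => e₁.cost + e₂.cost + 1
  | .div e₁ e₂ => e₁.cost + e₂.cost + 1
  | .sqrt e => e.cost + 1

/-- Number of elementary operations in the evaluation of a test. -/
def BExpr.cost : BExpr → ℕ
  | .ilt e₁ e₂ => e₁.cost + e₂.cost + 1
  | .ieq e₁ e₂ => e₁.cost + e₂.cost + 1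
  | .rlt e₁ e₂ => e₁.cost + e₂.cost + 1
  | .req e₁ e₂ => e₁.cost + e₂.cost + 1
  | .not b => b.cost + 1
  | .and b₁ b₂ => b₁.cost + b₂.cost + 1

def State.setInt (σ : State) (a : ℕ) (i : ℤ) (z : ℤ) : State :=
  { σ with int := Function.update σ.int a (Function.update (σ.int a) i z) }

def State.setReal (σ : State) (a : ℕ) (i : ℤ) (r : ℝ) : State :=
  { σ with real := Function.update σ.real a (Function.update (σ.real a) i r) }

/-- `Exec p σ t σ'`: started in memory `σ`, the program `p` halts after `t` steps in
memory `σ'`. -/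
inductive Exec : Stmt → State → ℕ → State → Prop
  | skip (σ : State) : Exec .skip σ 1 σ
  | setInt (σ : State) (a : ℕ) (i e : IExpr) :
      Exec (.setInt a i e) σ (i.cost + e.cost + 1) (σ.setInt a (i.eval σ) (e.eval σ))
  | setReal (σ : State) (a : ℕ) (i : IExpr) (e : RExpr) :
      Exec (.setReal a i e) σ (i.cost + e.cost + 1) (σ.setReal a (i.eval σ) (e.eval σ))
  | seq {p q : Stmt} {σ σ' σ'' : State} {t t' : ℕ} :
      Exec p σ t σ' → Exec q σ' t' σ'' → Exec (.seq p q) σ (t + t') σ''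
  | cond_true {b : BExpr} {p q : Stmt} {σ σ' : State} {t : ℕ} :
      b.eval σ → Exec p σ t σ' → Exec (.cond b p q) σ (b.cost + t) σ'
  | cond_false {b : BExpr} {p q : Stmt} {σ σ' : State} {t : ℕ} :
      ¬ b.eval σ → Exec q σ t σ' → Exec (.cond b p q) σ (b.cost + t) σ'
  | loop_true {b : BExpr} {p : Stmt} {σ σ' σ'' : State} {t t' : ℕ} :
      b.eval σ → Exec p σ t σ' → Exec (.loop b p) σ' t' σ'' →
        Exec (.loop b p) σ (b.cost + t + t') σ''
  | loop_false {b : BExpr} {p : Stmt} {σ : State} :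
      ¬ b.eval σ → Exec (.loop b p) σ b.cost σ

end RealRAM

namespace LinSys

open RealRAM

/-! ### Linear systems, approximate solutions, complexity parameters -/

/-- A class of real matrices (of all sizes). -/
abbrev MatrixClass : Type := ∀ m n : ℕ, Set (Matrix (Fin m) (Fin n) ℝ)

/-- The orthogonal projection of `c` onto the image of `A`. -/
noncomputable def imProj {m n : ℕ} (A : Matrix (Fin m) (Fin n) ℝ)
    (c : EuclideanSpace ℝ (Fin m)) : EuclideanSpace ℝ (Fin m) :=
  (LinearMap.range (Matrix.toEuclideanLin A)).starProjection c

/-- `x` is a solution of the linear system approximation instance `(A, c, ε)`. -/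
def IsLSASolution {m n : ℕ} (A : Matrix (Fin m) (Fin n) ℝ) (c : EuclideanSpace ℝ (Fin m))
    (ε : ℝ) (x : EuclideanSpace ℝ (Fin n)) : Prop :=
  ‖Matrix.toEuclideanLin A x - imProj A c‖ ≤ ε * ‖imProj A c‖

/-- Number of non-zero entries. -/
noncomputable def nnz {m n : ℕ} (A : Matrix (Fin m) (Fin n) ℝ) : ℕ :=
  Nat.card {p : Fin m × Fin n // A p.1 p.2 ≠ 0}

/-- Largest absolute value of a family of reals (`0` if the family is empty). -/
noncomputable def maxAbs {ι : Type} (a : ι → ℝ) : ℝ := ⨆ i, |a i|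

/-- Smallest absolute value of a non-zero member of a family of reals.  If there is no non-zero
member the value is `0`, so that `1 / minNonzero a = 0` does not contribute to a maximum. -/
noncomputable def minNonzero {ι : Type} (a : ι → ℝ) : ℝ := sInf {r | ∃ i, a i ≠ 0 ∧ r = |a i|}

/-- Largest singular value. -/
noncomputable def sigmaMax {m n : ℕ} (A : Matrix (Fin m) (Fin n) ℝ) : ℝ :=
  sSup {r | ∃ x : EuclideanSpace ℝ (Fin n), x ≠ 0 ∧ r = ‖Matrix.toEuclideanLin A x‖ / ‖x‖}

/-- Smallest non-zero singular value of a non-zero matrix. -/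
noncomputable def sigmaMin {m n : ℕ} (A : Matrix (Fin m) (Fin n) ℝ) : ℝ :=
  sInf {r | ∃ x : EuclideanSpace ℝ (Fin n), x ≠ 0 ∧
    x ∈ (LinearMap.ker (Matrix.toEuclideanLin A))ᗮ ∧ r = ‖Matrix.toEuclideanLin A x‖ / ‖x‖}

/-- The non-zero condition number of a non-zero matrix. -/
noncomputable def condNumber {m n : ℕ} (A : Matrix (Fin m) (Fin n) ℝ) : ℝ :=
  sigmaMax A / sigmaMin A

/-- Quadruples of parameters, ordered coordinatewise. -/
abbrev Params : Type := ℝ × ℝ × ℝ × ℝ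

/-- The sparse parameter complexity of an instance. -/
noncomputable def sparseComplexity {m n : ℕ} (A : Matrix (Fin m) (Fin n) ℝ)
    (c : EuclideanSpace ℝ (Fin m)) (ε : ℝ) : Params :=
  ((nnz A : ℝ),
    max (max (maxAbs fun p : Fin m × Fin n => A p.1 p.2) (maxAbs fun i => c i))
      (max (1 / minNonzero fun p : Fin m × Fin n => A p.1 p.2) (1 / minNonzero fun i => c i)),
    condNumber A,
    ε⁻¹)

/-- The conditions under which the sparse parameter complexity of `(A, c, ε)` is defined. -/
def Admissible {m n : ℕ} (A : Matrix (Fin m) (Fin n) ℝ) (ε : ℝ) : Prop :=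
  A ≠ 0 ∧ max m n ≤ nnz A ∧ 0 < ε ∧ ε ≤ 1

/-! ### Instances in the memory of the machine -/

/-- The memory holds `A` in sparse form in integer arrays `b`, `b + 1`, `b + 2` and real
array `b`: both dimensions, the number of non-zero entries, and a list of all non-zero entries
(row, column, value), without repetition, sorted by rows. -/
def EncodesMatrix {m n : ℕ} (σ : State) (b : ℕ) (A : Matrix (Fin m) (Fin n) ℝ) : Prop :=
  σ.int b 0 = m ∧ σ.int b 1 = n ∧ σ.int b 2 = nnz A ∧
    ∃ e : Fin (nnz A) ≃ {p : Fin m × Fin n // A p.1 p.2 ≠ 0},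
      (Monotone fun k => (e k).1.1) ∧
      ∀ k : Fin (nnz A),
        σ.int (b + 1) ((k : ℕ) : ℤ) = (((e k).1.1 : ℕ) : ℤ) ∧
        σ.int (b + 2) ((k : ℕ) : ℤ) = (((e k).1.2 : ℕ) : ℤ) ∧
        σ.real b ((k : ℕ) : ℤ) = A (e k).1.1 (e k).1.2

/-- The real array `b` starts with the entries of `x`. -/
def EncodesVector {n : ℕ} (σ : State) (b : ℕ) (x : EuclideanSpace ℝ (Fin n)) : Prop :=
  ∀ i : Fin n, σ.real b ((i : ℕ) : ℤ) = x i

/-- The memory holds the instance `(A, c, ε)`. -/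
def EncodesInstance {m n : ℕ} (σ : State) (b : ℕ) (A : Matrix (Fin m) (Fin n) ℝ)
    (c : EuclideanSpace ℝ (Fin m)) (ε : ℝ) : Prop :=
  EncodesMatrix σ b A ∧ EncodesVector σ (b + 1) c ∧ σ.real (b + 2) 0 = ε

/-! ### Efficient reducibility -/

/-- Quadruples of positive reals. -/
def posParams : Set Params := {p | 0 < p.1 ∧ 0 < p.2.1 ∧ 0 < p.2.2.1 ∧ 0 < p.2.2.2}

/-- `M₁` is efficiently `f`-reducible to `M₂`: there are two programs, `P` mapping an instance
`(A₁, c₁, ε₁)` with `A₁ ∈ M₁` to an instance `(A₂, c₂, ε₂)` with `A₂ ∈ M₂`, and `Q` mapping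
`(A₁, A₂, x₂)`, where `x₂` is any solution of `(A₂, c₂, ε₂)`, to a solution of `(A₁, c₁, ε₁)`.
The complexity parameters grow at most by `f`, which is positive and increasing in every
coordinate.  `P` takes at most `O(T)` steps, `T` a function of the parameters of the given
instance, and `Q` takes `O(nnz A₁)` steps.  Memory cells that do not hold the input are
arbitrary at the start. -/
def EfficientlyReducible (M₁ M₂ : MatrixClass) (f : Params → Params) (T : Params → ℝ) : Prop :=
  Set.MapsTo f posParams posParams ∧ MonotoneOn f posParams ∧
  ∃ (P Q : Stmt) (C : ℝ),
    ∀ (m₁ n₁ : ℕ) (A₁ : Matrix (Fin m₁) (Fin n₁) ℝ) (c₁ : EuclideanSpace ℝ (Fin m₁)) (ε₁ : ℝ),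
      A₁ ∈ M₁ m₁ n₁ → Admissible A₁ ε₁ →
      ∀ σ : State, EncodesInstance σ 0 A₁ c₁ ε₁ →
        ∃ (σ' : State) (t : ℕ), Exec P σ t σ' ∧
          (t : ℝ) ≤ C * T (sparseComplexity A₁ c₁ ε₁) ∧
          ∃ (m₂ n₂ : ℕ) (A₂ : Matrix (Fin m₂) (Fin n₂) ℝ) (c₂ : EuclideanSpace ℝ (Fin m₂))
            (ε₂ : ℝ),
            EncodesInstance σ' 3 A₂ c₂ ε₂ ∧ A₂ ∈ M₂ m₂ n₂ ∧ Admissible A₂ ε₂ ∧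
            sparseComplexity A₂ c₂ ε₂ ≤ f (sparseComplexity A₁ c₁ ε₁) ∧
            ∀ x₂ : EuclideanSpace ℝ (Fin n₂), IsLSASolution A₂ c₂ ε₂ x₂ →
              ∀ τ : State, EncodesMatrix τ 0 A₁ → EncodesMatrix τ 3 A₂ → EncodesVector τ 6 x₂ →
                ∃ (τ' : State) (u : ℕ) (x₁ : EuclideanSpace ℝ (Fin n₁)), Exec Q τ u τ' ∧
                  (u : ℝ) ≤ C * nnz A₁ ∧ EncodesVector τ' 7 x₁ ∧ IsLSASolution A₁ c₁ ε₁ x₁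

/-! ### The two matrix classes -/

/-- Integer matrices with a non-zero entry in every row and every column, in which every row
sums to zero and the positive entries of every row sum to a power of two. -/
def zeroSumPowerTwo : MatrixClass := fun m n =>
  {A | ∃ Z : Matrix (Fin m) (Fin n) ℤ, A = Z.map (fun z : ℤ => (z : ℝ)) ∧
    (∀ i, ∃ j, Z i j ≠ 0) ∧ (∀ j, ∃ i, Z i j ≠ 0) ∧
    (∀ i, ∑ j, Z i j = 0) ∧
    ∀ i, ∃ k : ℕ, ∑ j with 0 < Z i j, Z i j = 2 ^ k}

/-- 2-commodity incidence matrices.  There are `N` blocks of two variables each; block `i`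
consists of the columns `2 * i` and `2 * i + 1`.  Every row is `S` on block `i` and `-S` on
block `j`, for some `i ≠ j`, where `S` is `w` times `(1, 0)`, `(0, 1)` or `(1, -1)`. -/
def twoCommodity : MatrixClass := fun m n =>
  {B | ∃ N : ℕ, n = 2 * N ∧
    ∀ r : Fin m, ∃ (i j : ℕ) (w : ℝ) (S : Fin 2 → ℝ), i < N ∧ j < N ∧ i ≠ j ∧
      (S = w • ![1, 0] ∨ S = w • ![0, 1] ∨ S = w • ![1, -1]) ∧
      ∀ q : Fin n, B r q =
        (if (q : ℕ) / 2 = i then S (Fin.ofNat 2 q) else 0) -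
          (if (q : ℕ) / 2 = j then S (Fin.ofNat 2 q) else 0)}

end LinSys

/-!
Seven 2-commodity equations in four fresh blocks force `u_T - u_{T'} = u_a - u_b`, where `T'` is one
of the fresh blocks.  With such gadgets every row of the given matrix evaluates the binary expansion
of its integer entries by Horner's scheme: starting from `u_0 - u_0`, its accumulator `u_0 - u_T` is
doubled for every binary digit (`a = 0` and `b = T`), and the variables of the entries with digit
`±1` are added to it or subtracted from it, relative to `u_0`, which makes no difference for rows
that sum to zero.  One last equation per row reads off the accumulator.

Let an equation carry the place value of its digit as multiplier and the row as tag.  Then the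
equations with tag `i` add up to row `i`, and conversely all residuals of the equations that add up
to `A x` are attained by an extension of `x` of controlled norm.  When the `N_i` equations with tag
`i` are weighted by `√N_i` and the right-hand side `c_i` is divided by `√N_i` on each of them, the
right-hand side is transformed by an isometric embedding whose adjoint takes the new system to the
given one.  So solutions restrict to solutions with the same precision, and the extension bounds
`σ_min` of the new system from below.
-/

namespace RealRAM

/-! ### Program logic -/

/-- Total correctness with a step bound: started in `σ`, the program `p` halts after at most `T`
steps in a memory that satisfies `Q`. -/
def Runs (p : Stmt) (σ : State) (T : ℕ) (Q : State → Prop) : Prop :=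
  ∃ σ' t, Exec p σ t σ' ∧ t ≤ T ∧ Q σ'

theorem Runs.mono {p : Stmt} {σ : State} {T T' : ℕ} {Q Q' : State → Prop} (h : Runs p σ T Q)
    (hT : T ≤ T') (hQ : ∀ σ', Q σ' → Q' σ') : Runs p σ T' Q' := by
  obtain ⟨σ', t, hexec, ht, hσ'⟩ := h
  exact ⟨σ', t, hexec, ht.trans hT, hQ _ hσ'⟩

theorem Runs.seq {p q : Stmt} {σ : State} {T T' : ℕ} {Q Q' : State → Prop} (h : Runs p σ T Q)
    (h' : ∀ σ', Q σ' → Runs q σ' T' Q') : Runs (.seq p q) σ (T + T') Q' := by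
  obtain ⟨σ', t, hexec, ht, hσ'⟩ := h
  obtain ⟨σ'', t', hexec', ht', hσ''⟩ := h' σ' hσ'
  exact ⟨σ'', t + t', .seq hexec hexec', add_le_add ht ht', hσ''⟩

/-- The index of the invariant `I` bounds the number of remaining iterations. -/
theorem Runs.loop {b : BExpr} {p : Stmt} (I : ℕ → State → Prop) {T : ℕ}
    (hp : ∀ n σ, I n σ → b.eval σ → Runs p σ T fun σ' => ∃ n' < n, I n' σ')
    {n : ℕ} {σ : State} (hσ : I n σ) :
    Runs (.loop b p) σ (n * (T + b.cost) + b.cost) fun σ' => ∃ n', I n' σ' ∧ ¬ b.eval σ' := by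
  induction n using Nat.strong_induction_on generalizing σ with
  | _ n ih =>
    by_cases hb : b.eval σ
    · obtain ⟨σ', t, hexec, ht, n', hn', hσ'⟩ := hp n σ hσ hb
      obtain ⟨σ'', t', hexec', ht', hσ''⟩ := ih n' hn' hσ'
      have hfuel : (n' + 1) * (T + b.cost) ≤ n * (T + b.cost) := Nat.mul_le_mul_right _ hn'
      rw [add_mul, one_mul] at hfuel
      exact ⟨σ'', b.cost + t + t', .loop_true hb hexec hexec', by omega, hσ''⟩
    · exact ⟨σ, b.cost, .loop_false hb, by omega, n, hσ, hb⟩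

/-- The index of the invariant `I` is the number of completed iterations. -/
theorem Runs.loop_count {b : BExpr} {p : Stmt} (I : ℕ → State → Prop) {n T : ℕ}
    (hb : ∀ k σ, I k σ → (b.eval σ ↔ k < n))
    (hp : ∀ k < n, ∀ σ, I k σ → Runs p σ T (I (k + 1))) {σ : State} (hσ : I 0 σ) :
    Runs (.loop b p) σ (n * (T + b.cost) + b.cost) (I n) := by
  refine (Runs.loop (fun j τ => ∃ k, k + j = n ∧ I k τ) ?_ ⟨0, Nat.zero_add n, hσ⟩).mono le_rfl ?_
  · rintro j τ ⟨k, hkj, hτ⟩ hbτ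
    have hk := (hb k τ hτ).1 hbτ
    exact (hp k hk τ hτ).mono le_rfl fun τ' hτ' => ⟨j - 1, by omega, k + 1, by omega, hτ'⟩
  · rintro τ ⟨j, ⟨k, hkj, hτ⟩, hbτ⟩
    have hk := mt (hb k τ hτ).2 hbτ
    obtain rfl : k = n := by omega
    exact hτ

/-- Programs without loops. -/
def Stmt.LoopFree : Stmt → Prop
  | .skip => True
  | .setInt _ _ _ => True
  | .setReal _ _ _ => True
  | .seq p q => p.LoopFree ∧ q.LoopFree
  | .cond _ p q => p.LoopFree ∧ q.LoopFree
  | .loop _ _ => False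

/-- An upper bound for the number of steps of a loop-free program (junk value `0` on loops). -/
def Stmt.maxCost : Stmt → ℕ
  | .skip => 1
  | .setInt _ i e => i.cost + e.cost + 1
  | .setReal _ i e => i.cost + e.cost + 1
  | .seq p q => p.maxCost + q.maxCost
  | .cond b p q => b.cost + (p.maxCost + q.maxCost)
  | .loop _ _ => 0

/-- A bound for the number of steps of at most `n` iterations of a loop-free program. -/
def loopCost (n : ℕ) (b : BExpr) (p : Stmt) : ℕ := n * (p.maxCost + b.cost) + b.cost

open Classical in
/-- The final memory of a loop-free program; loops are skipped. -/
noncomputable def Stmt.run : Stmt → State → State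
  | .skip, σ => σ
  | .setInt a i e, σ => σ.setInt a (i.eval σ) (e.eval σ)
  | .setReal a i e, σ => σ.setReal a (i.eval σ) (e.eval σ)
  | .seq p q, σ => q.run (p.run σ)
  | .cond b p q, σ => if b.eval σ then p.run σ else q.run σ
  | .loop _ _, σ => σ

theorem Stmt.LoopFree.exists_exec {p : Stmt} (h : p.LoopFree) (σ : State) :
    ∃ t ≤ p.maxCost, Exec p σ t (p.run σ) := by
  induction p generalizing σ with
  | skip => exact ⟨1, le_rfl, .skip σ⟩
  | setInt a i e => exact ⟨_, le_rfl, .setInt σ a i e⟩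
  | setReal a i e => exact ⟨_, le_rfl, .setReal σ a i e⟩
  | seq p q ihp ihq =>
    obtain ⟨t, ht, hexec⟩ := ihp h.1 σ
    obtain ⟨t', ht', hexec'⟩ := ihq h.2 (p.run σ)
    exact ⟨_, add_le_add ht ht', .seq hexec hexec'⟩
  | cond b p q ihp ihq =>
    by_cases hb : b.eval σ
    · obtain ⟨t, ht, hexec⟩ := ihp h.1 σ
      refine ⟨b.cost + t, by simp only [Stmt.maxCost]; omega, ?_⟩
      simpa only [Stmt.run, if_pos hb] using Exec.cond_true hb hexec
    · obtain ⟨t, ht, hexec⟩ := ihq h.2 σ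
      refine ⟨b.cost + t, by simp only [Stmt.maxCost]; omega, ?_⟩
      simpa only [Stmt.run, if_neg hb] using Exec.cond_false hb hexec
  | loop b p => exact h.elim

theorem Stmt.LoopFree.runs {p : Stmt} (h : p.LoopFree) {σ : State} {Q : State → Prop}
    (hQ : Q (p.run σ)) : Runs p σ p.maxCost Q := by
  obtain ⟨t, ht, hexec⟩ := h.exists_exec σ
  exact ⟨_, t, hexec, ht, hQ⟩

/-- The integer arrays that a program may change. -/
def Stmt.intWrites : Stmt → List ℕ
  | .skip => []
  | .setInt a _ _ => [a]
  | .setReal _ _ _ => []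
  | .seq p q => p.intWrites ++ q.intWrites
  | .cond _ p q => p.intWrites ++ q.intWrites
  | .loop _ p => p.intWrites

/-- The real arrays that a program may change. -/
def Stmt.realWrites : Stmt → List ℕ
  | .skip => []
  | .setInt _ _ _ => []
  | .setReal a _ _ => [a]
  | .seq p q => p.realWrites ++ q.realWrites
  | .cond _ p q => p.realWrites ++ q.realWrites
  | .loop _ p => p.realWrites

theorem Stmt.run_int_of_notMem {p : Stmt} {a : ℕ} (ha : a ∉ p.intWrites) (σ : State) :
    (p.run σ).int a = σ.int a := by
  induction p generalizing σ with
  | skip | loop | setReal => rfl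
  | setInt a' i e => exact Function.update_of_ne (List.mem_singleton.not.1 ha) _ _
  | seq p q ihp ihq =>
    obtain ⟨hp, hq⟩ := not_or.1 (List.mem_append.not.1 ha)
    exact (ihq hq _).trans (ihp hp σ)
  | cond b p q ihp ihq =>
    obtain ⟨hp, hq⟩ := not_or.1 (List.mem_append.not.1 ha)
    rw [Stmt.run]
    split_ifs
    exacts [ihp hp σ, ihq hq σ]

theorem Stmt.run_real_of_notMem {p : Stmt} {a : ℕ} (ha : a ∉ p.realWrites) (σ : State) :
    (p.run σ).real a = σ.real a := by
  induction p generalizing σ with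
  | skip | loop | setInt => rfl
  | setReal a' i e => exact Function.update_of_ne (List.mem_singleton.not.1 ha) _ _
  | seq p q ihp ihq =>
    obtain ⟨hp, hq⟩ := not_or.1 (List.mem_append.not.1 ha)
    exact (ihq hq _).trans (ihp hp σ)
  | cond b p q ihp ihq =>
    obtain ⟨hp, hq⟩ := not_or.1 (List.mem_append.not.1 ha)
    rw [Stmt.run]
    split_ifs
    exacts [ihp hp σ, ihq hq σ]

theorem State.setInt_int (σ : State) (a : ℕ) (i z : ℤ) (a' : ℕ) (i' : ℤ) :
    (σ.setInt a i z).int a' i' = if a' = a ∧ i' = i then z else σ.int a' i' := by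
  by_cases ha : a' = a <;> simp [State.setInt, Function.update_apply, ha]

theorem State.setInt_real (σ : State) (a : ℕ) (i z : ℤ) : (σ.setInt a i z).real = σ.real := rfl

theorem State.setReal_int (σ : State) (a : ℕ) (i : ℤ) (r : ℝ) :
    (σ.setReal a i r).int = σ.int := rfl

theorem State.setReal_real (σ : State) (a : ℕ) (i : ℤ) (r : ℝ) (a' : ℕ) (i' : ℤ) :
    (σ.setReal a i r).real a' i' = if a' = a ∧ i' = i then r else σ.real a' i' := by
  by_cases ha : a' = a <;> simp [State.setReal, Function.update_apply, ha]

end RealRAM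

namespace LinSys

open RealRAM

/-! ### Singular values and transfer of approximate solutions -/

section SingularValues

variable {m n : ℕ} (A : Matrix (Fin m) (Fin n) ℝ)

theorem toEuclideanLin_apply_coord (x : EuclideanSpace ℝ (Fin n)) (i : Fin m) :
    Matrix.toEuclideanLin A x i = ∑ j, A i j * x j := by
  simp [Matrix.toLpLin_apply, Matrix.mulVec, dotProduct]

theorem bddAbove_norm_ratio :
    BddAbove {r | ∃ x : EuclideanSpace ℝ (Fin n), x ≠ 0 ∧
      r = ‖Matrix.toEuclideanLin A x‖ / ‖x‖} := by
  refine ⟨‖(Matrix.toEuclideanLin A).toContinuousLinearMap‖, ?_⟩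
  rintro r ⟨x, -, rfl⟩
  exact (Matrix.toEuclideanLin A).toContinuousLinearMap.ratio_le_opNorm x

theorem norm_apply_le_sigmaMax_mul (x : EuclideanSpace ℝ (Fin n)) :
    ‖Matrix.toEuclideanLin A x‖ ≤ sigmaMax A * ‖x‖ := by
  rcases eq_or_ne x 0 with rfl | hx
  · simp
  · rw [← div_le_iff₀ (norm_pos_iff.2 hx)]
    exact le_csSup (bddAbove_norm_ratio A) ⟨x, hx, rfl⟩

theorem sigmaMax_le {M : ℝ} (hM : 0 ≤ M) (h : ∀ x, ‖Matrix.toEuclideanLin A x‖ ≤ M * ‖x‖) :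
    sigmaMax A ≤ M := by
  refine Real.sSup_le ?_ hM
  rintro r ⟨x, hx, rfl⟩
  rw [div_le_iff₀ (norm_pos_iff.2 hx)]
  exact h x

theorem abs_apply_le_sigmaMax (i : Fin m) (j : Fin n) : |A i j| ≤ sigmaMax A := by
  have hcoord : Matrix.toEuclideanLin A (EuclideanSpace.single j 1) i = A i j := by
    simp [Matrix.toLpLin_apply]
  calc |A i j| ≤ ‖Matrix.toEuclideanLin A (EuclideanSpace.single j 1)‖ := by
        rw [← hcoord, ← Real.norm_eq_abs]
        exact PiLp.norm_apply_le _ i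
    _ ≤ sigmaMax A * ‖EuclideanSpace.single j (1 : ℝ)‖ := norm_apply_le_sigmaMax_mul A _
    _ = sigmaMax A := by simp

theorem sigmaMax_le_of_sum_sq_le {M : ℝ} (hM : 0 ≤ M) (h : ∑ i, ∑ j, A i j ^ 2 ≤ M ^ 2) :
    sigmaMax A ≤ M := by
  refine sigmaMax_le A hM fun x => le_of_sq_le_sq ?_ (by positivity)
  rw [mul_pow, EuclideanSpace.real_norm_sq_eq, EuclideanSpace.real_norm_sq_eq]
  calc ∑ i, (Matrix.toEuclideanLin A x i) ^ 2
      ≤ ∑ i, (∑ j, A i j ^ 2) * ∑ j, x j ^ 2 := by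
        gcongr with i
        rw [toEuclideanLin_apply_coord]
        exact Finset.sum_mul_sq_le_sq_mul_sq _ _ _
    _ = (∑ i, ∑ j, A i j ^ 2) * ∑ j, x j ^ 2 := by rw [Finset.sum_mul]
    _ ≤ M ^ 2 * ∑ j, x j ^ 2 := by gcongr

theorem sigmaMin_mul_norm_le {x : EuclideanSpace ℝ (Fin n)}
    (hx : x ∈ (LinearMap.ker (Matrix.toEuclideanLin A))ᗮ) :
    sigmaMin A * ‖x‖ ≤ ‖Matrix.toEuclideanLin A x‖ := by
  rcases eq_or_ne x 0 with rfl | h0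
  · simp
  · rw [← le_div_iff₀ (norm_pos_iff.2 h0)]
    refine csInf_le ⟨0, ?_⟩ ⟨x, h0, hx, rfl⟩
    rintro r ⟨y, -, -, rfl⟩
    positivity

theorem exists_mem_ker_orthogonal_apply_eq (x : EuclideanSpace ℝ (Fin n)) :
    ∃ y ∈ (LinearMap.ker (Matrix.toEuclideanLin A))ᗮ,
      Matrix.toEuclideanLin A y = Matrix.toEuclideanLin A x := by
  refine ⟨(LinearMap.ker (Matrix.toEuclideanLin A))ᗮ.starProjection x,
    Submodule.starProjection_apply_mem _ _, ?_⟩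
  have h := Submodule.sub_starProjection_mem_orthogonal
    (K := (LinearMap.ker (Matrix.toEuclideanLin A))ᗮ) x
  rw [Submodule.orthogonal_orthogonal, LinearMap.mem_ker, map_sub, sub_eq_zero] at h
  exact h.symm

variable {A}

theorem exists_mem_ker_orthogonal_ne_zero (hA : A ≠ 0) :
    ∃ x ∈ (LinearMap.ker (Matrix.toEuclideanLin A))ᗮ, x ≠ 0 := by
  obtain ⟨x, hx⟩ : ∃ x, Matrix.toEuclideanLin A x ≠ 0 := by
    by_contra! hc
    exact hA ((map_eq_zero_iff _ Matrix.toEuclideanLin.injective).1 (LinearMap.ext hc))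
  obtain ⟨y, hy, hyx⟩ := exists_mem_ker_orthogonal_apply_eq A x
  refine ⟨y, hy, ?_⟩
  rintro rfl
  exact hx (by rw [← hyx, map_zero])

theorem le_sigmaMin (hA : A ≠ 0) {δ : ℝ}
    (h : ∀ x ∈ (LinearMap.ker (Matrix.toEuclideanLin A))ᗮ,
      δ * ‖x‖ ≤ ‖Matrix.toEuclideanLin A x‖) : δ ≤ sigmaMin A := by
  obtain ⟨x, hx, hx0⟩ := exists_mem_ker_orthogonal_ne_zero hA
  refine le_csInf ⟨_, x, hx0, hx, rfl⟩ ?_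
  rintro r ⟨y, hy0, hy, rfl⟩
  rw [le_div_iff₀ (norm_pos_iff.2 hy0)]
  exact h y hy

theorem sigmaMin_pos (hA : A ≠ 0) : 0 < sigmaMin A := by
  have hker : LinearMap.ker ((Matrix.toEuclideanLin A).domRestrict
      (LinearMap.ker (Matrix.toEuclideanLin A))ᗮ) = ⊥ := by
    rw [LinearMap.ker_eq_bot']
    exact fun x hx => Subtype.ext <| inner_self_eq_zero.1 <|
      Submodule.inner_right_of_mem_orthogonal (LinearMap.mem_ker.2 hx) x.2
  obtain ⟨K, hK, hL⟩ := LinearMap.exists_antilipschitzWith _ hker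
  have hK' : (0 : ℝ) < K := hK
  refine (inv_pos.2 hK').trans_le (le_sigmaMin hA fun x hx => ?_)
  rw [inv_mul_le_iff₀ hK']
  simpa [dist_eq_norm] using hL.le_mul_dist ⟨x, hx⟩ 0

theorem inv_sigmaMin_le (hA : A ≠ 0) {G : ℝ} (h : ∀ x ∈ (LinearMap.ker (Matrix.toEuclideanLin A))ᗮ,
      ‖x‖ ≤ G * ‖Matrix.toEuclideanLin A x‖) : (sigmaMin A)⁻¹ ≤ G := by
  have hG : 0 < G := by
    obtain ⟨x, hx, hx0⟩ := exists_mem_ker_orthogonal_ne_zero hA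
    exact pos_of_mul_pos_left ((norm_pos_iff.2 hx0).trans_le (h x hx)) (norm_nonneg _)
  rw [inv_le_comm₀ (sigmaMin_pos hA) hG]
  refine le_sigmaMin hA fun x hx => ?_
  rw [inv_mul_le_iff₀ hG]
  exact h x hx

theorem sigmaMin_le_sigmaMax (hA : A ≠ 0) : sigmaMin A ≤ sigmaMax A := by
  obtain ⟨x, hx, hx0⟩ := exists_mem_ker_orthogonal_ne_zero hA
  exact le_of_mul_le_mul_right
    ((sigmaMin_mul_norm_le A hx).trans (norm_apply_le_sigmaMax_mul A x)) (norm_pos_iff.2 hx0)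

theorem norm_le_of_mem_ker_orthogonal {x y : EuclideanSpace ℝ (Fin n)}
    (hx : x ∈ (LinearMap.ker (Matrix.toEuclideanLin A))ᗮ)
    (hxy : Matrix.toEuclideanLin A y = Matrix.toEuclideanLin A x) : ‖x‖ ≤ ‖y‖ := by
  have horth : inner ℝ x (y - x) = 0 := by
    refine Submodule.inner_left_of_mem_orthogonal ?_ hx
    rw [LinearMap.mem_ker, map_sub, hxy, sub_self]
  have hpyth := norm_add_sq_eq_norm_sq_add_norm_sq_real horth
  rw [add_sub_cancel] at hpyth
  nlinarith [norm_nonneg y, mul_self_nonneg ‖y - x‖]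

end SingularValues

section Lift

open ContinuousLinearMap (adjoint)

section Adjoint

variable {E F : Type*} [NormedAddCommGroup E] [InnerProductSpace ℝ E] [CompleteSpace E]
  [NormedAddCommGroup F] [InnerProductSpace ℝ F] [CompleteSpace F] (Λ : E →ₗᵢ[ℝ] F)

theorem norm_adjoint_linearIsometry_le (y : F) : ‖adjoint Λ.toContinuousLinearMap y‖ ≤ ‖y‖ := by
  refine ((adjoint Λ.toContinuousLinearMap).le_of_opNorm_le ?_ y).trans_eq (one_mul _)
  rw [LinearIsometryEquiv.norm_map]
  exact Λ.norm_toContinuousLinearMap_le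

theorem adjoint_linearIsometry_apply_self (x : E) : adjoint Λ.toContinuousLinearMap (Λ x) = x := by
  have h := (ContinuousLinearMap.norm_map_iff_adjoint_comp_self Λ.toContinuousLinearMap).1
    Λ.norm_map
  exact congrArg (· x) h

end Adjoint

variable {m n m' n' : ℕ}

/-- The system `B` refines the system `A`: `Λ` embeds the right-hand sides of `A` isometrically
into those of `B` so that its adjoint takes the left-hand sides of `B` back to those of `A`, `π`
extracts the variables of `A` from those of `B`, and every `x` can be extended to the variables
of `B`, with any compatible prescribed left-hand sides `b`, at a cost controlled by `g₁` and
`g₂`. -/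
structure IsLift (A : Matrix (Fin m) (Fin n) ℝ) (B : Matrix (Fin m') (Fin n') ℝ)
    (Λ : EuclideanSpace ℝ (Fin m) →ₗᵢ[ℝ] EuclideanSpace ℝ (Fin m'))
    (π : EuclideanSpace ℝ (Fin n') → EuclideanSpace ℝ (Fin n)) (g₁ g₂ : ℝ) : Prop where
  adjoint_apply : ∀ z, adjoint Λ.toContinuousLinearMap (Matrix.toEuclideanLin B z) =
    Matrix.toEuclideanLin A (π z)
  exists_preimage : ∀ x b, adjoint Λ.toContinuousLinearMap b = Matrix.toEuclideanLin A x →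
    ∃ z, Matrix.toEuclideanLin B z = b ∧ ‖z‖ ≤ g₁ * ‖x‖ + g₂ * ‖b‖

namespace IsLift

variable {A : Matrix (Fin m) (Fin n) ℝ} {B : Matrix (Fin m') (Fin n') ℝ}
  {Λ : EuclideanSpace ℝ (Fin m) →ₗᵢ[ℝ] EuclideanSpace ℝ (Fin m')}
  {π : EuclideanSpace ℝ (Fin n') → EuclideanSpace ℝ (Fin n)} {g₁ g₂ : ℝ}

theorem imProj_map (h : IsLift A B Λ π g₁ g₂) (c : EuclideanSpace ℝ (Fin m)) :
    imProj B (Λ c) = Λ (imProj A c) := by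
  refine Submodule.eq_starProjection_of_mem_of_inner_eq_zero
    (K := LinearMap.range (Matrix.toEuclideanLin B)) ?_ ?_
  · obtain ⟨x, hx⟩ : imProj A c ∈ LinearMap.range (Matrix.toEuclideanLin A) :=
      Submodule.starProjection_apply_mem _ _
    obtain ⟨z, hz, -⟩ := h.exists_preimage x (Λ (imProj A c))
      (by rw [adjoint_linearIsometry_apply_self, hx])
    exact ⟨z, hz⟩
  · rintro _ ⟨z, rfl⟩
    rw [← map_sub, ← Λ.coe_toContinuousLinearMap, ← ContinuousLinearMap.adjoint_inner_right,
      h.adjoint_apply]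
    exact Submodule.starProjection_inner_eq_zero _ _ ⟨_, rfl⟩

theorem isLSASolution (h : IsLift A B Λ π g₁ g₂) {c : EuclideanSpace ℝ (Fin m)} {ε : ℝ}
    {z : EuclideanSpace ℝ (Fin n')} (hz : IsLSASolution B (Λ c) ε z) :
    IsLSASolution A c ε (π z) := by
  unfold IsLSASolution at *
  rw [h.imProj_map, Λ.norm_map] at hz
  refine le_trans ?_ hz
  have := norm_adjoint_linearIsometry_le Λ (Matrix.toEuclideanLin B z - Λ (imProj A c))
  rwa [map_sub, adjoint_linearIsometry_apply_self, h.adjoint_apply] at this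

theorem inv_sigmaMin_le (h : IsLift A B Λ π g₁ g₂) (hA : A ≠ 0) (hB : B ≠ 0) (hg₁ : 0 ≤ g₁) :
    (sigmaMin B)⁻¹ ≤ g₁ * (sigmaMin A)⁻¹ + g₂ := by
  refine LinSys.inv_sigmaMin_le hB fun z hz => ?_
  set b := Matrix.toEuclideanLin B z with hb
  obtain ⟨x, hx, hxz⟩ := exists_mem_ker_orthogonal_apply_eq A (π z)
  rw [← h.adjoint_apply z, ← hb] at hxz
  obtain ⟨y, hy, hy_norm⟩ := h.exists_preimage x b hxz.symm
  have hx_norm : ‖x‖ ≤ (sigmaMin A)⁻¹ * ‖b‖ := by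
    rw [le_inv_mul_iff₀ (sigmaMin_pos hA)]
    refine (sigmaMin_mul_norm_le A hx).trans ?_
    rw [hxz]
    exact norm_adjoint_linearIsometry_le Λ b
  calc ‖z‖ ≤ ‖y‖ := norm_le_of_mem_ker_orthogonal hz hy
    _ ≤ g₁ * ‖x‖ + g₂ * ‖b‖ := hy_norm
    _ ≤ g₁ * ((sigmaMin A)⁻¹ * ‖b‖) + g₂ * ‖b‖ := by gcongr
    _ = (g₁ * (sigmaMin A)⁻¹ + g₂) * ‖b‖ := by ring

end IsLift

end Lift

section FiberEmbedding

variable {ι κ : Type*} [Fintype ι] [DecidableEq κ] {t : ι → κ}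

theorem card_fiber_pos (ht : Function.Surjective t) (k : κ) :
    0 < Finset.card {i | t i = k} := by
  obtain ⟨i, hi⟩ := ht k
  exact Finset.card_pos.2 ⟨i, by simpa using hi⟩

variable [Fintype κ]

/-- The isometric embedding that spreads every coordinate evenly over its fibre under `t`. -/
noncomputable def fiberEmbedding (t : ι → κ) (ht : Function.Surjective t) :
    EuclideanSpace ℝ κ →ₗᵢ[ℝ] EuclideanSpace ℝ ι where
  toFun c := WithLp.toLp 2 fun i => c (t i) / √(Finset.card {i' | t i' = t i})
  map_add' b c := by ext i; simp [add_div]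
  map_smul' a c := by ext i; simp [mul_div_assoc]
  norm_map' c := by
    rw [← sq_eq_sq₀ (norm_nonneg _) (norm_nonneg _), EuclideanSpace.real_norm_sq_eq,
      EuclideanSpace.real_norm_sq_eq, ← Finset.sum_fiberwise _ t]
    refine Finset.sum_congr rfl fun k _ => ?_
    have hk : (0 : ℝ) < Finset.card {i | t i = k} := by exact_mod_cast card_fiber_pos ht k
    calc ∑ i with t i = k, (c (t i) / √(Finset.card {i' | t i' = t i})) ^ 2
        = ∑ i with t i = k, c k ^ 2 / Finset.card {i' | t i' = k} := by
          refine Finset.sum_congr rfl fun i hi => ?_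
          rw [(Finset.mem_filter.1 hi).2, div_pow, Real.sq_sqrt hk.le]
      _ = c k ^ 2 := by
          rw [Finset.sum_const, nsmul_eq_mul, mul_div_cancel₀ _ hk.ne']

theorem fiberEmbedding_apply (ht : Function.Surjective t) (c : EuclideanSpace ℝ κ) (i : ι) :
    fiberEmbedding t ht c i = c (t i) / √(Finset.card {i' | t i' = t i}) :=
  rfl

theorem adjoint_fiberEmbedding_apply (ht : Function.Surjective t) (b : EuclideanSpace ℝ ι) (k : κ) :
    ContinuousLinearMap.adjoint (fiberEmbedding t ht).toContinuousLinearMap b k =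
      ∑ i with t i = k, b i / √(Finset.card {i' | t i' = k}) := by
  have h := ContinuousLinearMap.adjoint_inner_right (fiberEmbedding t ht).toContinuousLinearMap
    (EuclideanSpace.single k 1) b
  rw [EuclideanSpace.inner_single_left, map_one, one_mul] at h
  rw [h, LinearIsometry.coe_toContinuousLinearMap, PiLp.inner_apply, Finset.sum_filter]
  refine Finset.sum_congr rfl fun i _ => ?_
  rw [fiberEmbedding_apply]
  split_ifs with hi
  · simp [hi, div_eq_mul_inv]
  · simp [hi]

end FiberEmbedding

/-! ### Systems of 2-commodity equations -/

/-- The three kinds of 2-commodity equations: between the first variables of two blocks, between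
their second variables, or between the differences of the two variables. -/
inductive Kind where
  | fst
  | snd
  | diff

/-- Coefficient of the first variable of a block in an equation of the given kind. -/
def Kind.c₀ : Kind → ℝ
  | .fst => 1
  | .snd => 0
  | .diff => 1

/-- Coefficient of the second variable of a block in an equation of the given kind. -/
def Kind.c₁ : Kind → ℝ
  | .fst => 0
  | .snd => 1
  | .diff => -1

/-- A 2-commodity equation between the blocks `i` and `j`.  It carries a multiplier `mu` and the
index `tag` of the equation of the given system that it helps to represent. -/
structure Eqn where
  kind : Kind
  i : ℕ
  j : ℕ
  mu : ℝ
  tag : ℕ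

/-- The left-hand side of an equation (without the multiplier) at `z`, where block `b` consists of
the variables `z (2 * b)` and `z (2 * b + 1)`. -/
def Eqn.resid (z : ℕ → ℝ) (e : Eqn) : ℝ :=
  e.kind.c₀ * (z (2 * e.i) - z (2 * e.j)) + e.kind.c₁ * (z (2 * e.i + 1) - z (2 * e.j + 1))

/-- An equation between distinct blocks below `nb` with a multiplier in `[1, M]` and a tag
below `m`. -/
structure Eqn.WellFormed (m nb : ℕ) (M : ℝ) (e : Eqn) : Prop where
  ne : e.i ≠ e.j
  i_lt : e.i < nb
  j_lt : e.j < nb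
  one_le_mu : 1 ≤ e.mu
  mu_le : e.mu ≤ M
  tag_lt : e.tag < m

namespace Eqn.WellFormed

variable {m nb : ℕ} {M : ℝ} {e : Eqn}

theorem mu_nonneg (h : e.WellFormed m nb M) : 0 ≤ e.mu := zero_le_one.trans h.one_le_mu

theorem mono {nb' : ℕ} (h : e.WellFormed m nb M) (hnb : nb ≤ nb') : e.WellFormed m nb' M :=
  { h with i_lt := h.i_lt.trans_le hnb, j_lt := h.j_lt.trans_le hnb }

theorem resid_congr (h : e.WellFormed m nb M) {z z' : ℕ → ℝ} (hz : ∀ q < 2 * nb, z' q = z q) :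
    e.resid z' = e.resid z := by
  have hi := h.i_lt
  have hj := h.j_lt
  simp only [Eqn.resid]
  rw [hz (2 * e.i) (by omega), hz (2 * e.j) (by omega), hz (2 * e.i + 1) (by omega),
    hz (2 * e.j + 1) (by omega)]

end Eqn.WellFormed

/-- The values of the first variables of all blocks. -/
def firstVars (z : ℕ → ℝ) : ℕ → ℝ := fun b => z (2 * b)

section TagSum

/-- Sum of `mu * ρ` over the pairs `(e, ρ)` of an equation with tag `t` and a prescribed
residual `ρ`. -/
noncomputable def tagSum (L : List (Eqn × ℝ)) (t : ℕ) : ℝ :=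
  (L.map fun p => if p.1.tag = t then p.1.mu * p.2 else 0).sum

/-- Sum of `mu * |ρ|` over the pairs `(e, ρ)` of an equation with tag `t` and a prescribed
residual `ρ`. -/
noncomputable def tagNorm (L : List (Eqn × ℝ)) (t : ℕ) : ℝ :=
  tagSum (L.map fun p => (p.1, |p.2|)) t

/-- The equations of `l`, each with its residual at `z`. -/
def withResid (l : List Eqn) (z : ℕ → ℝ) : List (Eqn × ℝ) := l.map fun e => (e, e.resid z)

variable {L : List (Eqn × ℝ)} {t : ℕ}

theorem withResid_append (l l' : List Eqn) (z : ℕ → ℝ) :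
    withResid (l ++ l') z = withResid l z ++ withResid l' z :=
  List.map_append

theorem withResid_map_fst {z : ℕ → ℝ} (h : ∀ p ∈ L, p.1.resid z = p.2) :
    withResid (L.map Prod.fst) z = L := by
  have hid : ∀ p ∈ L, (p.1, p.1.resid z) = id p := fun p hp => by rw [h p hp, id]
  rw [withResid, List.map_map]
  exact (List.map_congr_left hid).trans (List.map_id L)

theorem tagSum_append (L L' : List (Eqn × ℝ)) (t : ℕ) :
    tagSum (L ++ L') t = tagSum L t + tagSum L' t := by
  simp [tagSum]

theorem tagNorm_append (L L' : List (Eqn × ℝ)) (t : ℕ) :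
    tagNorm (L ++ L') t = tagNorm L t + tagNorm L' t := by
  simp [tagNorm, tagSum_append]

theorem tagSum_eq_zero (h : ∀ p ∈ L, p.1.tag ≠ t) : tagSum L t = 0 := by
  refine List.sum_eq_zero fun r hr => ?_
  obtain ⟨p, hp, rfl⟩ := List.mem_map.1 hr
  exact if_neg (h p hp)

theorem tagSum_eq_of_nodup (h : (L.map fun p => p.1.tag).Nodup) {p : Eqn × ℝ} (hp : p ∈ L) :
    tagSum L p.1.tag = p.1.mu * p.2 := by
  induction L with
  | nil => simp at hp
  | cons q L ih =>
    rw [List.map_cons, List.nodup_cons] at h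
    rw [← List.singleton_append, tagSum_append]
    rcases List.mem_cons.1 hp with rfl | hpL
    · rw [tagSum_eq_zero (L := L) fun r hr hrt => h.1 (List.mem_map.2 ⟨r, hr, hrt⟩)]
      simp [tagSum]
    · rw [ih h.2 hpL, tagSum_eq_zero, zero_add]
      simp only [List.mem_singleton, forall_eq]
      exact fun hqt => h.1 (List.mem_map.2 ⟨p, hpL, hqt.symm⟩)

variable (hL : ∀ p ∈ L, 0 ≤ p.1.mu)
include hL

theorem tagNorm_nonneg : 0 ≤ tagNorm L t := by
  refine List.sum_nonneg ?_
  simp only [List.mem_map]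
  rintro _ ⟨_, ⟨p, hp, rfl⟩, rfl⟩
  split_ifs
  exacts [mul_nonneg (hL p hp) (abs_nonneg _), le_rfl]

theorem mul_abs_le_tagNorm {p : Eqn × ℝ} (hp : p ∈ L) : p.1.mu * |p.2| ≤ tagNorm L p.1.tag := by
  refine List.single_le_sum ?_ _ ?_
  · simp only [List.mem_map]
    rintro _ ⟨_, ⟨q, hq, rfl⟩, rfl⟩
    split_ifs
    exacts [mul_nonneg (hL q hq) (abs_nonneg _), le_rfl]
  · exact List.mem_map.2 ⟨_, List.mem_map_of_mem hp, if_pos rfl⟩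

theorem abs_tagSum_le_tagNorm : |tagSum L t| ≤ tagNorm L t := by
  induction L with
  | nil => simp [tagNorm, tagSum]
  | cons p L ih =>
    rw [← List.singleton_append, tagSum_append, tagNorm_append]
    refine (abs_add_le _ _).trans (add_le_add ?_ (ih fun q hq => hL q (List.mem_cons_of_mem _ hq)))
    by_cases ht : p.1.tag = t
    · simp [tagNorm, tagSum, ht, abs_mul, abs_of_nonneg (hL p List.mem_cons_self)]
    · simp [tagNorm, tagSum, ht]

end TagSum

section Gadget

/-- The equations that force `u_T - u_{T'} = u_a - u_b`, where `T'` is the last of the four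
fresh blocks `nb, …, nb + 3`. -/
def gadget (T a b nb : ℕ) (mu : ℝ) (tag : ℕ) : List Eqn :=
  [⟨.fst, a, nb, mu, tag⟩, ⟨.fst, nb + 1, b, mu, tag⟩, ⟨.diff, nb, nb + 1, mu, tag⟩,
    ⟨.fst, nb + 2, T, mu, tag⟩, ⟨.snd, nb, nb + 2, mu, tag⟩, ⟨.snd, nb + 3, nb + 1, mu, tag⟩,
    ⟨.diff, nb + 3, nb + 2, mu, tag⟩]

variable {T a b nb m : ℕ} {mu M : ℝ} {tag : ℕ}

theorem mu_eq_and_tag_eq_of_mem_gadget {e : Eqn} (he : e ∈ gadget T a b nb mu tag) :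
    e.mu = mu ∧ e.tag = tag := by
  simp only [gadget, List.mem_cons, List.not_mem_nil, or_false] at he
  rcases he with rfl | rfl | rfl | rfl | rfl | rfl | rfl <;> exact ⟨rfl, rfl⟩

theorem wellFormed_of_mem_gadget (hT : T < nb) (ha : a < nb) (hb : b < nb) (hmu : 1 ≤ mu)
    (hM : mu ≤ M) (htag : tag < m) {e : Eqn} (he : e ∈ gadget T a b nb mu tag) :
    e.WellFormed m (nb + 4) M := by
  simp only [gadget, List.mem_cons, List.not_mem_nil, or_false] at he
  rcases he with rfl | rfl | rfl | rfl | rfl | rfl | rfl <;>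
    exact ⟨by simp only; omega, by simp only; omega, by simp only; omega, hmu, hM, htag⟩

theorem tagSum_gadget (T a b nb : ℕ) (mu : ℝ) (tag : ℕ) (z : ℕ → ℝ) :
    tagSum (withResid (gadget T a b nb mu tag) z) tag =
      mu * (z (2 * a) - z (2 * b) - z (2 * T) + z (2 * (nb + 3))) := by
  simp only [tagSum, withResid, gadget, Eqn.resid, Kind.c₀, Kind.c₁, List.map_cons, List.map_nil,
    List.sum_cons, List.sum_nil, if_true]
  ring

theorem tagSum_gadget_of_ne {t : ℕ} (h : t ≠ tag) (z : ℕ → ℝ) :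
    tagSum (withResid (gadget T a b nb mu tag) z) t = 0 := by
  refine tagSum_eq_zero fun p hp => ?_
  obtain ⟨e, he, rfl⟩ := List.mem_map.1 hp
  exact (mu_eq_and_tag_eq_of_mem_gadget he).2 ▸ h.symm

theorem exists_gadget_solution {L : List (Eqn × ℝ)} (hL : L.map Prod.fst = gadget T a b nb mu tag)
    (hT : T < nb) (ha : a < nb) (hb : b < nb) {z : ℕ → ℝ} {H : ℝ} (hzT : |z (2 * T)| ≤ H)
    (hza : |z (2 * a)| ≤ H) (hzb : |z (2 * b)| ≤ H) (hρ : ∀ p ∈ L, |p.2| ≤ H)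
    (hz : ∀ q < 2 * nb, |z q| ≤ 10 * H) :
    ∃ z' : ℕ → ℝ, (∀ q < 2 * nb, z' q = z q) ∧ (∀ p ∈ L, p.1.resid z' = p.2) ∧
      ∀ q < 2 * (nb + 4), |z' q| ≤ 10 * H := by
  simp only [gadget, List.map_eq_cons_iff, List.map_eq_nil_iff] at hL
  obtain ⟨⟨_, r₀⟩, _, rfl, rfl, ⟨_, r₁⟩, _, rfl, rfl, ⟨_, r₂⟩, _, rfl, rfl, ⟨_, r₃⟩, _, rfl, rfl,
    ⟨_, r₄⟩, _, rfl, rfl, ⟨_, r₅⟩, _, rfl, rfl, ⟨_, r₆⟩, _, rfl, rfl, rfl⟩ := hL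
  -- The second variable of the block `nb + 1` is free; with it set to zero, the equations
  -- determine the other fresh variables.
  let uX := z (2 * a) - r₀
  let uY := z (2 * b) + r₁
  let vX := uX - uY - r₂
  let uR := z (2 * T) + r₃
  let vR := vX - r₄
  let z' : ℕ → ℝ := fun q => if q < 2 * nb then z q else
    match q - 2 * nb with
    | 0 => uX | 1 => vX | 2 => uY | 3 => 0 | 4 => uR | 5 => vR | 6 => r₆ + r₅ + uR - vR | _ => r₅
  have hold : ∀ q < 2 * nb, z' q = z q := fun q hq => if_pos hq
  have hfresh : ∀ c, z' (2 * nb + c) = match c with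
      | 0 => uX | 1 => vX | 2 => uY | 3 => 0 | 4 => uR | 5 => vR | 6 => r₆ + r₅ + uR - vR
      | _ => r₅ := fun c => by simp [z']
  simp only [List.mem_cons, List.not_mem_nil, or_false, forall_eq_or_imp, forall_eq] at hρ ⊢
  refine ⟨z', hold, ?_, fun q hq => ?_⟩
  · simp only [Eqn.resid, Kind.c₀, Kind.c₁, mul_add, add_assoc, Nat.reduceMul, Nat.reduceAdd,
      hfresh, hold (2 * a) (by omega), hold (2 * b) (by omega), hold (2 * T) (by omega)]
    have hfresh₀ := hfresh 0
    simp only [add_zero] at hfresh₀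
    rw [hfresh₀]
    refine ⟨?_, ?_, ?_, ?_, ?_, ?_, ?_⟩ <;> simp only [uX, uY, vX, uR, vR] <;> ring
  · by_cases hq' : q < 2 * nb
    · rw [hold q hq']
      exact hz q hq'
    · obtain ⟨c, rfl⟩ := Nat.exists_eq_add_of_le (not_lt.1 hq')
      have hc : c < 8 := by omega
      simp only [abs_le] at hρ hzT hza hzb ⊢
      rw [hfresh]
      interval_cases c <;> simp only [uX, uY, vX, uR, vR] <;> constructor <;> linarith

end Gadget

/-- A sparse integer matrix with `m` rows and `n` columns, as a list of `s` entries. -/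
structure SparseMatrix where
  m : ℕ
  n : ℕ
  s : ℕ
  row : ℕ → ℕ
  col : ℕ → ℕ
  ent : ℕ → ℤ
  n_pos : 0 < n
  row_lt : ∀ k < s, row k < m
  col_lt : ∀ k < s, col k < n

namespace SparseMatrix

variable (d : SparseMatrix)

/-- The value at `x` of row `i` when the entries are replaced by `w`.  The variable `x 0` is
subtracted from every variable, which changes nothing for rows that sum to zero. -/
noncomputable def rowSum (w : ℕ → ℤ) (i : ℕ) (x : ℕ → ℝ) : ℝ :=
  ∑ k ∈ Finset.range d.s, if d.row k = i then (w k : ℝ) * (x (d.col k) - x 0) else 0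

/-- Sum of the absolute values of all entries. -/
noncomputable def total : ℝ := ∑ k ∈ Finset.range d.s, |(d.ent k : ℝ)|

theorem total_nonneg : 0 ≤ d.total := Finset.sum_nonneg fun _ _ => abs_nonneg _

theorem rowSum_congr {w : ℕ → ℤ} {i : ℕ} {x y : ℕ → ℝ} (h : ∀ j < d.n, x j = y j) :
    d.rowSum w i x = d.rowSum w i y := by
  refine Finset.sum_congr rfl fun k hk => ?_
  rw [h _ (d.col_lt k (Finset.mem_range.1 hk)), h 0 d.n_pos]

theorem abs_rowSum_le {w : ℕ → ℤ} {x : ℕ → ℝ} {ξ : ℝ} (hw : ∀ k < d.s, |w k| ≤ |d.ent k|)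
    (hx : ∀ j < d.n, |x j| ≤ ξ) (i : ℕ) : |d.rowSum w i x| ≤ d.total * (2 * ξ) := by
  have hξ : 0 ≤ ξ := (abs_nonneg _).trans (hx 0 d.n_pos)
  rw [rowSum, total, Finset.sum_mul]
  refine (Finset.abs_sum_le_sum_abs _ _).trans (Finset.sum_le_sum fun k hk => ?_)
  rw [Finset.mem_range] at hk
  split_ifs
  · have hdiff : |x (d.col k) - x 0| ≤ 2 * ξ := by
      linarith [abs_sub (x (d.col k)) (x 0), hx _ (d.col_lt k hk), hx 0 d.n_pos]
    have hent : |(w k : ℝ)| ≤ |(d.ent k : ℝ)| := by exact_mod_cast hw k hk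
    rw [abs_mul]
    gcongr
  · rw [abs_zero]
    positivity

theorem rowSum_sub (w w' : ℕ → ℤ) (i : ℕ) (x : ℕ → ℝ) :
    d.rowSum (fun k => w k - w' k) i x = d.rowSum w i x - d.rowSum w' i x := by
  unfold rowSum
  rw [← Finset.sum_sub_distrib]
  refine Finset.sum_congr rfl fun k _ => ?_
  split_ifs
  · push_cast; ring
  · ring

theorem rowSum_update_of_ne (w : ℕ → ℤ) {i k : ℕ} (v : ℤ) (x : ℕ → ℝ) (h : d.row k ≠ i) :
    d.rowSum (Function.update w k v) i x = d.rowSum w i x := by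
  refine Finset.sum_congr rfl fun k' _ => ?_
  rcases eq_or_ne k' k with rfl | hk
  · simp only [h, if_false]
  · rw [Function.update_of_ne hk]

theorem rowSum_update_row (w : ℕ → ℤ) {k : ℕ} (v : ℤ) (x : ℕ → ℝ) (h : k < d.s) :
    d.rowSum (Function.update w k (w k + v)) (d.row k) x =
      d.rowSum w (d.row k) x + v * (x (d.col k) - x 0) := by
  have hmem := Finset.mem_range.2 h
  have hrest : ∀ k' ∈ (Finset.range d.s).erase k, Function.update w k (w k + v) k' = w k' :=
    fun k' hk' => Function.update_of_ne (Finset.ne_of_mem_erase hk') _ _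
  unfold rowSum
  rw [← Finset.add_sum_erase _ _ hmem, ← Finset.add_sum_erase (Finset.range d.s)
    (fun k' => if d.row k' = d.row k then (w k' : ℝ) * (x (d.col k') - x 0) else 0) hmem,
    Finset.sum_congr rfl fun k' hk' => by rw [hrest k' hk']]
  simp only [Function.update_self, if_true]
  push_cast
  ring

/-- Bound for the values of the variables `x` and of the accumulators, in terms of a bound `ξ` of
`x` and a bound `β` of the prescribed residuals. -/
noncomputable def accBound (ξ β : ℝ) : ℝ := ξ * (1 + 2 * d.total) + β

/-- The values `x` of the given variables are bounded by `ξ`, and the prescribed residuals `L`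
by `β`. -/
structure Bounded (x : ℕ → ℝ) (L : List (Eqn × ℝ)) (ξ β : ℝ) : Prop where
  abs_le : ∀ j < d.n, |x j| ≤ ξ
  tagNorm_le : ∀ i < d.m, tagNorm L i ≤ β
  nonneg : 0 ≤ β

/-- The assignment `z` of the variables in `nb` blocks extends the assignment `x` of the given
variables, meets the prescribed residuals `L`, and is bounded by `B`. -/
structure IsExtension (nb : ℕ) (L : List (Eqn × ℝ)) (x : ℕ → ℝ) (B : ℝ) (z : ℕ → ℝ) : Prop where
  extends_given : ∀ j < d.n, z (2 * j) = x j
  resid_eq : ∀ p ∈ L, p.1.resid z = p.2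
  abs_le : ∀ q < 2 * nb, |z q| ≤ B

namespace Bounded

variable {d} {x : ℕ → ℝ} {L L' : List (Eqn × ℝ)} {ξ β : ℝ}

theorem given_nonneg (h : d.Bounded x L ξ β) : 0 ≤ ξ := (abs_nonneg _).trans (h.abs_le 0 d.n_pos)

theorem given_le_accBound (h : d.Bounded x L ξ β) : ξ ≤ d.accBound ξ β := by
  have := mul_nonneg h.given_nonneg d.total_nonneg
  rw [accBound]
  linarith [h.nonneg]

theorem le_accBound (h : d.Bounded x L ξ β) : β ≤ d.accBound ξ β := by
  have := mul_nonneg h.given_nonneg d.total_nonneg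
  rw [accBound]
  linarith [h.given_nonneg]

theorem of_append (h : d.Bounded x (L ++ L') ξ β) (hL' : ∀ p ∈ L', 0 ≤ p.1.mu) :
    d.Bounded x L ξ β :=
  { h with
    tagNorm_le := fun i hi => by
      have := h.tagNorm_le i hi
      rw [tagNorm_append] at this
      linarith [tagNorm_nonneg hL' (t := i)] }

theorem abs_le_of_mem (h : d.Bounded x L ξ β) (hL : ∀ p ∈ L, p.1.tag < d.m ∧ 1 ≤ p.1.mu)
    {p : Eqn × ℝ} (hp : p ∈ L) : |p.2| ≤ β :=
  calc |p.2| ≤ p.1.mu * |p.2| := le_mul_of_one_le_left (abs_nonneg _) (hL p hp).2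
    _ ≤ tagNorm L p.1.tag := mul_abs_le_tagNorm (fun q hq => by linarith [(hL q hq).2]) hp
    _ ≤ β := h.tagNorm_le _ (hL p hp).1

end Bounded

end SparseMatrix

/-! ### The construction of the system -/

/-- A state of the construction: the equations produced so far, the number of blocks they use, and
the block of the current accumulator of every row. -/
structure Construction where
  eqns : List Eqn
  blocks : ℕ
  acc : ℕ → ℕ

namespace Construction

/-- The construction before the first gadget, with a block for each of the `n` variables
and all accumulators in block 0. -/
def initial (n : ℕ) : Construction := ⟨[], n, fun _ => 0⟩

/-- Adds `u_b - u_a` to the accumulator of row `i`, by equations with multiplier `mu`. -/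
noncomputable def addGadget (S : Construction) (i a b : ℕ) (mu : ℝ) : Construction where
  eqns := S.eqns ++ gadget (S.acc i) a b S.blocks mu i
  blocks := S.blocks + 4
  acc := Function.update S.acc i (S.blocks + 3)

/-- The invariant of the construction: row `i` has accumulated `u_0 - u_{acc i}`, which is still to
be multiplied by `P i`, and `rem k` is the part of entry `k` that has not been processed. -/
structure Invariant (d : SparseMatrix) (M : ℝ) (S : Construction) (P rem : ℕ → ℤ) : Prop where
  n_le : d.n ≤ S.blocks
  acc_lt : ∀ i < d.m, S.acc i < S.blocks
  one_le : ∀ i < d.m, 1 ≤ P i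
  wellFormed : ∀ e ∈ S.eqns, e.WellFormed d.m S.blocks M
  rem_mem : ∀ k < d.s, rem k ∈ Set.uIcc 0 (d.ent k)
  rowSum_eq : ∀ z, ∀ i < d.m, tagSum (withResid S.eqns z) i + P i * (z 0 - z (2 * S.acc i)) +
    d.rowSum rem i (firstVars z) = d.rowSum d.ent i (firstVars z)
  exists_extension : ∀ L x ξ β, L.map Prod.fst = S.eqns → d.Bounded x L ξ β →
    ∃ z, d.IsExtension S.blocks L x (10 * d.accBound ξ β) z

variable {d : SparseMatrix} {M : ℝ} {S : Construction} {P rem : ℕ → ℤ}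

theorem Invariant.initial (M : ℝ) {P : ℕ → ℤ} (hP : ∀ i < d.m, 1 ≤ P i) :
    (initial d.n).Invariant d M P d.ent where
  n_le := le_rfl
  acc_lt _ _ := d.n_pos
  one_le := hP
  wellFormed := by simp [Construction.initial]
  rem_mem _ _ := Set.right_mem_uIcc
  rowSum_eq z i _ := by simp [Construction.initial, withResid, tagSum]
  exists_extension L x ξ β hL h := by
    obtain rfl := List.map_eq_nil_iff.1 hL
    refine ⟨fun q => if q % 2 = 0 then x (q / 2) else 0, fun j _ => by simp, by simp,
      fun q (hq : q < 2 * d.n) => ?_⟩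
    have hbound := h.given_le_accBound
    have hξ := h.given_nonneg
    split_ifs
    · linarith [h.abs_le (q / 2) (by omega)]
    · rw [abs_zero]
      linarith

theorem Invariant.abs_acc_le (h : S.Invariant d M P rem) {L : List (Eqn × ℝ)}
    (hL : L.map Prod.fst = S.eqns) {x z : ℕ → ℝ} {ξ β B : ℝ} (hb : d.Bounded x L ξ β)
    (hz : d.IsExtension S.blocks L x B z) {i : ℕ} (hi : i < d.m) :
    |z (2 * S.acc i)| ≤ d.accBound ξ β := by
  have hgiven : ∀ j < d.n, |firstVars z j| ≤ ξ := fun j hj => by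
    rw [firstVars, hz.extends_given j hj]
    exact hb.abs_le j hj
  have hmu : ∀ p ∈ L, 0 ≤ p.1.mu := fun p hp =>
    (h.wellFormed p.1 (hL ▸ List.mem_map_of_mem hp)).mu_nonneg
  have htag : |tagSum L i| ≤ β := (abs_tagSum_le_tagNorm hmu).trans (hb.tagNorm_le i hi)
  have hrow : |d.rowSum (fun k => d.ent k - rem k) i (firstVars z)| ≤ d.total * (2 * ξ) := by
    refine d.abs_rowSum_le (fun k hk => ?_) hgiven i
    have := Set.abs_sub_right_of_mem_uIcc (h.rem_mem k hk)
    rwa [sub_zero] at this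
  have hrem := h.rowSum_eq z i hi
  rw [← hL, withResid_map_fst hz.resid_eq] at hrem
  have hprod : (P i : ℝ) * (z 0 - z (2 * S.acc i)) =
      d.rowSum (fun k => d.ent k - rem k) i (firstVars z) - tagSum L i := by
    rw [d.rowSum_sub]
    linarith
  have hdiff : |z 0 - z (2 * S.acc i)| ≤ d.total * (2 * ξ) + β := by
    have hP : (1 : ℝ) ≤ P i := by exact_mod_cast h.one_le i hi
    calc |z 0 - z (2 * S.acc i)| ≤ P i * |z 0 - z (2 * S.acc i)| :=
          le_mul_of_one_le_left (abs_nonneg _) hP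
      _ = |d.rowSum (fun k => d.ent k - rem k) i (firstVars z) - tagSum L i| := by
          rw [← hprod, abs_mul, abs_of_nonneg (zero_le_one.trans hP)]
      _ ≤ d.total * (2 * ξ) + β := (abs_sub _ _).trans (add_le_add hrow htag)
  have hzero : |z 0| ≤ ξ := hgiven 0 d.n_pos
  rw [SparseMatrix.accBound]
  linarith [abs_sub_abs_le_abs_sub (z (2 * S.acc i)) (z 0), abs_sub_comm (z (2 * S.acc i)) (z 0)]

section AddGadget

variable {i a b : ℕ} {p : ℤ} {rem' : ℕ → ℤ}

theorem Invariant.exists_extension_addGadget (h : S.Invariant d M P rem) (hi : i < d.m)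
    (ha : a < d.n ∨ a = S.acc i) (hb : b < d.n ∨ b = S.acc i) {mu : ℝ} (hmu : 1 ≤ mu)
    {L : List (Eqn × ℝ)} (hL : L.map Prod.fst = (S.addGadget i a b mu).eqns) {x : ℕ → ℝ} {ξ β : ℝ}
    (hbd : d.Bounded x L ξ β) :
    ∃ z, d.IsExtension (S.addGadget i a b mu).blocks L x (10 * d.accBound ξ β) z := by
  obtain ⟨L₁, L₂, rfl, hL₁, hL₂⟩ := List.map_eq_append_iff.1 hL
  have hmem₁ : ∀ p ∈ L₁, p.1.WellFormed d.m S.blocks M := fun p hp =>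
    h.wellFormed p.1 (hL₁ ▸ List.mem_map_of_mem hp)
  have hmem₂ : ∀ p ∈ L₂, p.1.tag < d.m ∧ 1 ≤ p.1.mu := fun p hp => by
    obtain ⟨hmu', htag⟩ := mu_eq_and_tag_eq_of_mem_gadget (hL₂ ▸ List.mem_map_of_mem hp)
    exact ⟨htag ▸ hi, hmu' ▸ hmu⟩
  have hbd₁ := hbd.of_append fun p hp => zero_le_one.trans (hmem₂ p hp).2
  have hbd₂ : d.Bounded x L₂ ξ β :=
    { hbd with
      tagNorm_le := fun i' hi' => by
        have := hbd.tagNorm_le i' hi'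
        rw [tagNorm_append] at this
        linarith [tagNorm_nonneg (t := i') fun p hp => (hmem₁ p hp).mu_nonneg] }
  obtain ⟨z, hz⟩ := h.exists_extension L₁ x ξ β hL₁ hbd₁
  have hacc := h.abs_acc_le hL₁ hbd₁ hz hi
  have hend : ∀ c, c < d.n ∨ c = S.acc i → c < S.blocks ∧ |z (2 * c)| ≤ d.accBound ξ β := by
    rintro c (hc | rfl)
    · rw [hz.extends_given c hc]
      exact ⟨hc.trans_le h.n_le, (hbd.abs_le c hc).trans hbd.given_le_accBound⟩
    · exact ⟨h.acc_lt i hi, hacc⟩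
  obtain ⟨z', hold, hresid, habs⟩ := exists_gadget_solution hL₂ (h.acc_lt i hi) (hend a ha).1
    (hend b hb).1 hacc (hend a ha).2 (hend b hb).2
    (fun p hp => (hbd₂.abs_le_of_mem hmem₂ hp).trans hbd.le_accBound) hz.abs_le
  refine ⟨z', fun j hj => ?_, fun p hp => ?_, habs⟩
  · rw [hold _ (by have := h.n_le; omega), hz.extends_given j hj]
  · rcases List.mem_append.1 hp with hp | hp
    · rw [(hmem₁ p hp).resid_congr hold, hz.resid_eq p hp]
    · exact hresid p hp

theorem Invariant.addGadget (h : S.Invariant d M P rem) (hi : i < d.m)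
    (ha : a < d.n ∨ a = S.acc i) (hb : b < d.n ∨ b = S.acc i) (hp : 1 ≤ p) (hpM : (p : ℝ) ≤ M)
    (hrem : ∀ k < d.s, rem' k ∈ Set.uIcc 0 (d.ent k))
    (hrow_ne : ∀ x, ∀ i' ≠ i, d.rowSum rem' i' x = d.rowSum rem i' x)
    (hrow : ∀ z, (p : ℝ) * (z 0 - z (2 * S.acc i) + (z (2 * a) - z (2 * b))) +
        d.rowSum rem' i (firstVars z) =
      P i * (z 0 - z (2 * S.acc i)) + d.rowSum rem i (firstVars z)) :
    (S.addGadget i a b p).Invariant d M (Function.update P i p) rem' where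
  n_le := h.n_le.trans (Nat.le_add_right _ 4)
  acc_lt i' hi' := by
    have := h.acc_lt i' hi'
    rcases eq_or_ne i' i with rfl | hne
    · simp [Construction.addGadget]
    · simp only [Construction.addGadget, Function.update_of_ne hne]
      omega
  one_le i' hi' := by
    rcases eq_or_ne i' i with rfl | hne
    · rwa [Function.update_self]
    · rw [Function.update_of_ne hne]
      exact h.one_le i' hi'
  wellFormed e he := by
    have hend : ∀ c, c < d.n ∨ c = S.acc i → c < S.blocks := by
      rintro c (hc | rfl)
      exacts [hc.trans_le h.n_le, h.acc_lt i hi]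
    rcases List.mem_append.1 he with he | he
    · exact (h.wellFormed e he).mono (Nat.le_add_right _ 4)
    · exact wellFormed_of_mem_gadget (h.acc_lt i hi) (hend a ha) (hend b hb)
        (by exact_mod_cast hp) hpM hi he
  rem_mem := hrem
  rowSum_eq z i' hi' := by
    simp only [Construction.addGadget, withResid_append, tagSum_append]
    rcases eq_or_ne i' i with rfl | hne
    · rw [tagSum_gadget, Function.update_self, Function.update_self]
      linarith [h.rowSum_eq z i' hi', hrow z]
    · rw [tagSum_gadget_of_ne hne, Function.update_of_ne hne, Function.update_of_ne hne,
        hrow_ne _ i' hne]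
      linarith [h.rowSum_eq z i' hi']
  exists_extension _ _ _ _ hL hbd :=
    h.exists_extension_addGadget hi ha hb (by exact_mod_cast hp) hL hbd

theorem Invariant.double (h : S.Invariant d M P rem) (hi : i < d.m) (hp : 1 ≤ p)
    (hpM : (p : ℝ) ≤ M) (hP : P i = 2 * p) :
    (S.addGadget i 0 (S.acc i) p).Invariant d M (Function.update P i p) rem := by
  refine h.addGadget hi (Or.inl d.n_pos) (Or.inr rfl) hp hpM h.rem_mem (fun _ _ _ => rfl)
    fun z => ?_
  rw [hP]
  push_cast
  ring

theorem Invariant.addEntry (h : S.Invariant d M P rem) {k : ℕ} (hk : k < d.s)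
    (hpM : (P (d.row k) : ℝ) ≤ M) {τ : ℤ}
    (hτ : (τ = 1 ∧ a = d.col k ∧ b = 0 ∧ P (d.row k) ≤ rem k) ∨
      (τ = -1 ∧ a = 0 ∧ b = d.col k ∧ P (d.row k) ≤ -rem k) ∨ (τ = 0 ∧ a = 0 ∧ b = 0)) :
    (S.addGadget (d.row k) a b (P (d.row k))).Invariant d M P
      (Function.update rem k (rem k + -τ * P (d.row k))) := by
  have hr := d.row_lt k hk
  have hn := d.n_pos
  have hcol := d.col_lt k hk
  have hP := h.one_le _ hr
  have key := h.addGadget (p := P (d.row k))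
    (rem' := Function.update rem k (rem k + -τ * P (d.row k))) hr
    (Or.inl (a := a < d.n) (by omega)) (Or.inl (a := b < d.n) (by omega)) hP hpM
    (fun k' hk' => ?_) (fun x i' hi' => d.rowSum_update_of_ne _ _ _ hi'.symm) fun z => ?_
  · rwa [Function.update_eq_self] at key
  · have hmem := h.rem_mem k' hk'
    rcases eq_or_ne k' k with rfl | hne
    · rw [Function.update_self]
      rw [Set.mem_uIcc] at hmem ⊢
      rcases hτ with ⟨rfl, -, -, hle⟩ | ⟨rfl, -, -, hle⟩ | ⟨rfl, -⟩ <;> omega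
    · rwa [Function.update_of_ne hne]
  · rw [d.rowSum_update_row _ _ _ hk]
    rcases hτ with ⟨rfl, rfl, rfl, -⟩ | ⟨rfl, rfl, rfl, -⟩ | ⟨rfl, rfl, rfl⟩ <;>
      simp only [firstVars] <;> push_cast <;> ring

end AddGadget

/-- The equations that read off the accumulators of the rows before `i`. -/
def finalEqns (acc : ℕ → ℕ) (i : ℕ) : List Eqn :=
  (List.range i).map fun t => ⟨.fst, 0, acc t, 1, t⟩

theorem finalEqns_succ (acc : ℕ → ℕ) (i : ℕ) :
    finalEqns acc (i + 1) = finalEqns acc i ++ [⟨.fst, 0, acc i, 1, i⟩] := by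
  simp [finalEqns, List.range_succ]

theorem length_finalEqns (acc : ℕ → ℕ) (i : ℕ) : (finalEqns acc i).length = i := by
  simp [finalEqns]

theorem tagSum_eq_of_map_fst_eq_finalEqns {L : List (Eqn × ℝ)} {acc : ℕ → ℕ} {m : ℕ}
    (hL : L.map Prod.fst = finalEqns acc m) {p : Eqn × ℝ} (hp : p ∈ L) :
    tagSum L p.1.tag = p.1.mu * p.2 := by
  refine tagSum_eq_of_nodup ?_ hp
  have htags : L.map (fun p => p.1.tag) = (finalEqns acc m).map Eqn.tag := by
    rw [← hL, List.map_map]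
    rfl
  rw [htags, finalEqns, List.map_map]
  exact (List.map_id (List.range m)).symm ▸ List.nodup_range

theorem tagSum_withResid_finalEqns (acc : ℕ → ℕ) {m i : ℕ} (hi : i < m) (z : ℕ → ℝ) :
    tagSum (withResid (finalEqns acc m) z) i = z 0 - z (2 * acc i) := by
  have hmem : (⟨.fst, 0, acc i, 1, i⟩ : Eqn) ∈ finalEqns acc m :=
    List.mem_map.2 ⟨i, List.mem_range.2 hi, rfl⟩
  have hfst : (withResid (finalEqns acc m) z).map Prod.fst = finalEqns acc m := by
    simp [withResid, Function.comp_def]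
  have := tagSum_eq_of_map_fst_eq_finalEqns hfst (List.mem_map_of_mem hmem)
  simpa [Eqn.resid, Kind.c₀, Kind.c₁] using this

/-- A finished system with `nb` blocks and equations `l` that represents `d`: the equations with
tag `i` add up to row `i`, and conversely residuals that are consistent with `x` are attained by an
extension of `x`. -/
structure Represents (d : SparseMatrix) (M : ℝ) (l : List Eqn) (nb : ℕ) : Prop where
  wellFormed : ∀ e ∈ l, e.WellFormed d.m nb M
  exists_tag : ∀ i < d.m, ∃ e ∈ l, e.tag = i
  tagSum_eq : ∀ z, ∀ i < d.m, tagSum (withResid l z) i = d.rowSum d.ent i (firstVars z)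
  exists_extension : ∀ L x ξ β, L.map Prod.fst = l → d.Bounded x L ξ β →
    (∀ i < d.m, tagSum L i = d.rowSum d.ent i x) →
    ∃ z, d.IsExtension nb L x (10 * d.accBound ξ β) z

section Completion

variable (h : S.Invariant d M P rem) (hP : ∀ i < d.m, P i = 1) (hrem : ∀ k < d.s, rem k = 0)
include h hP hrem

theorem Invariant.tagSum_add_eq (z : ℕ → ℝ) {i : ℕ} (hi : i < d.m) :
    tagSum (withResid S.eqns z) i + (z 0 - z (2 * S.acc i)) =
      d.rowSum d.ent i (firstVars z) := by
  have hzero : d.rowSum rem i (firstVars z) = 0 := Finset.sum_eq_zero fun k hk => by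
    rw [hrem k (Finset.mem_range.1 hk), Int.cast_zero, zero_mul, ite_self]
  simpa [hzero, hP i hi] using h.rowSum_eq z i hi

theorem Invariant.exists_extension_finalEqns {L : List (Eqn × ℝ)}
    (hL : L.map Prod.fst = S.eqns ++ finalEqns S.acc d.m) {x : ℕ → ℝ} {ξ β : ℝ}
    (hbd : d.Bounded x L ξ β) (hsum : ∀ i < d.m, tagSum L i = d.rowSum d.ent i x) :
    ∃ z, d.IsExtension S.blocks L x (10 * d.accBound ξ β) z := by
  obtain ⟨L₁, L₂, rfl, hL₁, hL₂⟩ := List.map_eq_append_iff.1 hL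
  have hform : ∀ p ∈ L₂, ∃ i < d.m, (⟨.fst, 0, S.acc i, 1, i⟩ : Eqn) = p.1 := fun p hp => by
    have hmem : p.1 ∈ finalEqns S.acc d.m := hL₂ ▸ List.mem_map_of_mem hp
    simpa [finalEqns] using hmem
  obtain ⟨z, hz⟩ := h.exists_extension L₁ x ξ β hL₁ <| hbd.of_append fun p hp => by
    obtain ⟨i, -, hp⟩ := hform p hp
    exact hp ▸ zero_le_one
  refine ⟨z, { hz with resid_eq := fun p hp => ?_ }⟩
  rcases List.mem_append.1 hp with hp | hp
  · exact hz.resid_eq p hp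
  · obtain ⟨i, hi, hpi⟩ := hform p hp
    have hsum_i := hsum i hi
    have hlast := tagSum_eq_of_map_fst_eq_finalEqns hL₂ hp
    have htotal := h.tagSum_add_eq hP hrem z hi
    rw [← hpi] at hlast ⊢
    rw [tagSum_append, hlast] at hsum_i
    rw [← hL₁, withResid_map_fst hz.resid_eq, d.rowSum_congr (x := firstVars z) hz.extends_given]
      at htotal
    simp only [Eqn.resid, Kind.c₀, Kind.c₁, mul_zero]
    linarith

theorem Invariant.represents (hacc : ∀ i < d.m, S.acc i ≠ 0) (hM : 1 ≤ M) :
    Represents d M (S.eqns ++ finalEqns S.acc d.m) S.blocks where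
  wellFormed e he := by
    rcases List.mem_append.1 he with he | he
    · exact h.wellFormed e he
    · simp only [finalEqns, List.mem_map, List.mem_range] at he
      obtain ⟨i, hi, rfl⟩ := he
      exact ⟨(hacc i hi).symm, d.n_pos.trans_le h.n_le, h.acc_lt i hi, le_rfl, hM, hi⟩
  exists_tag i hi := ⟨⟨.fst, 0, S.acc i, 1, i⟩, List.mem_append_right _
    (List.mem_map.2 ⟨i, List.mem_range.2 hi, rfl⟩), rfl⟩
  tagSum_eq z i hi := by
    rw [withResid_append, tagSum_append, tagSum_withResid_finalEqns S.acc hi,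
      h.tagSum_add_eq hP hrem z hi]
  exists_extension _ _ _ _ hL hbd hsum := h.exists_extension_finalEqns hP hrem hL hbd hsum

end Completion

end Construction

/-! ### Writing equations to the output -/

/-- The non-zero coefficients in a block `i`, by column, of an equation with multiplier `w`. -/
def Kind.cols (i : ℕ) (w : ℝ) : Kind → List (ℕ × ℝ)
  | .fst => [(2 * i, w)]
  | .snd => [(2 * i + 1, w)]
  | .diff => [(2 * i, w), (2 * i + 1, -w)]

/-- The non-zero coefficients of an equation, multiplier included, by column. -/
def Eqn.cols (e : Eqn) : List (ℕ × ℝ) := e.kind.cols e.i e.mu ++ e.kind.cols e.j (-e.mu)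

/-- The non-zero coefficients of a system, as a list of triples (row, column, value). -/
def entries (l : List Eqn) : List (ℕ × ℕ × ℝ) :=
  l.zipIdx.flatMap fun p => p.1.cols.map (p.2, ·)

theorem entries_concat (l : List Eqn) (e : Eqn) :
    entries (l ++ [e]) = entries l ++ e.cols.map (l.length, ·) := by
  simp [entries, List.zipIdx_append]

/-- The memory holds the list `E` of triples in the arrays for the entries of the output matrix. -/
structure HoldsEntries (σ : State) (E : List (ℕ × ℕ × ℝ)) : Prop where
  length : σ.int 3 2 = E.length
  get : ∀ (t : ℕ) (h : t < E.length), σ.int 4 t = E[t].1 ∧ σ.int 5 t = E[t].2.1 ∧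
    σ.real 3 t = E[t].2.2

/-- The memory holds the system `l` in the output arrays, the tags of its equations in integer
array 6 and the number of equations with each tag in integer array 7. -/
structure HoldsSystem (σ : State) (m : ℕ) (l : List Eqn) : Prop where
  length : σ.int 3 0 = l.length
  entries : HoldsEntries σ (entries l)
  tag : ∀ (r : ℕ) (h : r < l.length), σ.int 6 r = l[r].tag
  count : ∀ i < m, σ.int 7 (i : ℕ) = l.countP fun e => e.tag = i

theorem HoldsSystem.congr {σ σ' : State} {m : ℕ} {l : List Eqn} (h : HoldsSystem σ m l)
    (hint : ∀ a, 3 ≤ a → a ≤ 7 → σ'.int a = σ.int a) (hreal : σ'.real 3 = σ.real 3) :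
    HoldsSystem σ' m l where
  length := by rw [hint 3 (by omega) (by omega), h.length]
  entries := by
    refine ⟨by rw [hint 3 (by omega) (by omega), h.entries.length], fun t ht => ?_⟩
    rw [hint 4 (by omega) (by omega), hint 5 (by omega) (by omega), hreal]
    exact h.entries.get t ht
  tag r hr := by rw [hint 6 (by omega) (by omega), h.tag r hr]
  count i hi := by rw [hint 7 (by omega) (by omega), h.count i hi]

/-- `σ'` agrees with `σ` outside of the entries of the output matrix and their number. -/
structure SameOffEntries (σ σ' : State) : Prop where
  int : ∀ a ≠ 4, a ≠ 5 → ∀ x, (a ≠ 3 ∨ x ≠ 2) → σ'.int a x = σ.int a x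
  real : ∀ a ≠ 3, σ'.real a = σ.real a

/-- `σ'` agrees with `σ` outside of the output matrix and its tags. -/
structure SameOffSystem (σ σ' : State) : Prop where
  int : ∀ a, a < 3 ∨ 7 < a → σ'.int a = σ.int a
  real : ∀ a ≠ 3, σ'.real a = σ.real a

theorem SameOffEntries.trans {σ σ' σ'' : State} (h : SameOffEntries σ σ')
    (h' : SameOffEntries σ' σ'') : SameOffEntries σ σ'' :=
  ⟨fun a h₄ h₅ x hx => (h'.int a h₄ h₅ x hx).trans (h.int a h₄ h₅ x hx),
    fun a ha => (h'.real a ha).trans (h.real a ha)⟩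

theorem SameOffSystem.trans {σ σ' σ'' : State} (h : SameOffSystem σ σ')
    (h' : SameOffSystem σ' σ'') : SameOffSystem σ σ'' :=
  ⟨fun a ha => (h'.int a ha).trans (h.int a ha), fun a ha => (h'.real a ha).trans (h.real a ha)⟩

/-- The number in register `c`.  The registers are the cells of integer array 8:
0–3 hold the new blocks of a gadget, 4 and 5 its blocks `a` and `b`, 6 its block `T`, 7 the row of
the given matrix that is being processed, 8 the number of blocks, 9 the number of remaining binary
digits, and 10 a loop counter. -/
def reg (c : ℤ) : IExpr := .get 8 (.const c)

/-- The multiplier of the equations that are being written, in cell 0 of real array 6. -/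
def mult : RExpr := .get 6 (.const 0)

infixr:60 " ;; " => Stmt.seq

/-- Append an entry with column `p.1` and value `p.2` to the last row of the output. -/
def push (p : IExpr × RExpr) : Stmt :=
  .setInt 4 (.get 3 (.const 2)) (.get 3 (.const 0)) ;;
  .setInt 5 (.get 3 (.const 2)) p.1 ;;
  .setReal 3 (.get 3 (.const 2)) p.2 ;;
  .setInt 3 (.const 2) (.add (.get 3 (.const 2)) (.const 1))

/-- The expressions `p` have the values `q`, also after entries have been appended to the
output. -/
def EvaluatesTo (σ : State) (p : IExpr × RExpr) (q : ℕ × ℝ) : Prop :=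
  ∀ τ, SameOffEntries σ τ → p.1.eval τ = q.1 ∧ p.2.eval τ = q.2

theorem sameOffEntries_run_push (σ : State) (p : IExpr × RExpr) :
    SameOffEntries σ ((push p).run σ) where
  int a h₄ h₅ x hx := by
    have hne : ¬(a = 3 ∧ x = 2) := by tauto
    simp [push, Stmt.run, IExpr.eval, State.setInt_int, State.setReal_int, h₄, h₅, hne]
  real a ha := by
    ext x
    simp [push, Stmt.run, State.setReal_real, State.setInt_real, ha]

theorem holdsEntries_run_push {σ : State} {E : List (ℕ × ℕ × ℝ)} (h : HoldsEntries σ E) {r : ℕ}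
    (hr : σ.int 3 0 = r) {p : IExpr × RExpr} {q : ℕ × ℝ} (hp : EvaluatesTo σ p q) :
    HoldsEntries ((push p).run σ) (E ++ [(r, q)]) := by
  have hcol (z z') : p.1.eval (σ.setInt 4 z z') = q.1 := by
    refine (hp (σ.setInt 4 z z') ⟨fun a h₄ _ x _ => ?_, fun _ _ => rfl⟩).1
    simp [State.setInt_int, h₄]
  have hval (z z' y y') : p.2.eval ((σ.setInt 4 z z').setInt 5 y y') = q.2 := by
    refine (hp ((σ.setInt 4 z z').setInt 5 y y') ⟨fun a h₄ h₅ x _ => ?_, fun _ _ => rfl⟩).2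
    simp [State.setInt_int, h₄, h₅]
  have hlength := h.length
  constructor
  · simp [push, Stmt.run, IExpr.eval, State.setInt_int, State.setReal_int, hlength]
  · intro t ht
    rw [List.length_append, List.length_singleton] at ht
    simp only [push, Stmt.run, IExpr.eval, State.setInt_int, State.setReal_int, State.setReal_real,
      State.setInt_real, hcol, hval, hlength, hr]
    rcases Nat.lt_succ_iff_lt_or_eq.1 ht with ht | rfl
    · have hne : (t : ℤ) ≠ E.length := by omega
      rw [List.getElem_append_left ht]
      simpa [hne] using h.get t ht
    · simp

def pushAll : List (IExpr × RExpr) → Stmt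
  | [] => .skip
  | p :: P => push p ;; pushAll P

theorem pushAll_loopFree (P : List (IExpr × RExpr)) : (pushAll P).LoopFree := by
  induction P with
  | nil => trivial
  | cons p P ih => simp [pushAll, push, Stmt.LoopFree, ih]

theorem run_pushAll {P : List (IExpr × RExpr)} {Q : List (ℕ × ℝ)} {σ : State}
    {E : List (ℕ × ℕ × ℝ)} {r : ℕ} (hPQ : List.Forall₂ (EvaluatesTo σ) P Q)
    (h : HoldsEntries σ E) (hr : σ.int 3 0 = r) :
    HoldsEntries ((pushAll P).run σ) (E ++ Q.map (r, ·)) ∧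
      SameOffEntries σ ((pushAll P).run σ) := by
  induction P generalizing σ E Q with
  | nil =>
    obtain rfl := List.forall₂_nil_left_iff.1 hPQ
    exact ⟨by simpa [pushAll, Stmt.run] using h, fun _ _ _ _ _ => rfl, fun _ _ => rfl⟩
  | cons p P ih =>
    obtain ⟨q, Q', hpq, hPQ', rfl⟩ := List.forall₂_cons_left_iff.1 hPQ
    have hsame := sameOffEntries_run_push σ p
    obtain ⟨hE, hsame'⟩ := ih (hPQ'.imp fun _ _ h τ hτ => h τ (hsame.trans hτ))
      (holdsEntries_run_push h hr hpq)
      (by rw [hsame.int 3 (by omega) (by omega) 0 (by omega), hr])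
    exact ⟨by simpa [pushAll, Stmt.run] using hE, hsame.trans hsame'⟩

/-- The non-zero coefficients of an equation in the block in register `c`, by column; `v` and `v'`
evaluate to the multiplier of the equation and its negative. -/
def Kind.colExprs (c : ℤ) (v v' : RExpr) : Kind → List (IExpr × RExpr)
  | .fst => [(.mul (.const 2) (reg c), v)]
  | .snd => [(.add (.mul (.const 2) (reg c)) (.const 1), v)]
  | .diff => [(.mul (.const 2) (reg c), v), (.add (.mul (.const 2) (reg c)) (.const 1), v')]

theorem Kind.forall₂_evaluatesTo_cols {σ : State} {c : ℤ} {i : ℕ} (hi : σ.int 8 c = i)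
    {v v' : RExpr} {w : ℝ} (hv : ∀ τ, SameOffEntries σ τ → v.eval τ = w)
    (hv' : ∀ τ, SameOffEntries σ τ → v'.eval τ = -w) (k : Kind) :
    List.Forall₂ (EvaluatesTo σ) (k.colExprs c v v') (k.cols i w) := by
  have hreg (τ) (hτ : SameOffEntries σ τ) : (reg c).eval τ = i :=
    (hτ.int 8 (by omega) (by omega) c (by omega)).trans hi
  cases k
  all_goals simp +contextual [Kind.colExprs, Kind.cols, EvaluatesTo, IExpr.eval, hreg, hv, hv']

/-- Update the tags and the number of rows after the entries of an equation, whose tag is in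
register 7, have been written. -/
def closeRow : Stmt :=
  .setInt 6 (.get 3 (.const 0)) (reg 7) ;;
  .setInt 7 (reg 7) (.add (.get 7 (reg 7)) (.const 1)) ;;
  .setInt 3 (.const 0) (.add (.get 3 (.const 0)) (.const 1))

/-- Append an equation between the blocks in the registers `c` and `c'` to the output. -/
def emit (k : Kind) (c c' : ℤ) : Stmt :=
  pushAll (k.colExprs c mult (.sub (.const 0) mult) ++
    k.colExprs c' (.sub (.const 0) mult) mult) ;;
  closeRow

theorem emit_loopFree (k : Kind) (c c' : ℤ) : (emit k c c').LoopFree := by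
  simp [emit, closeRow, Stmt.LoopFree, pushAll_loopFree]

theorem SameOffEntries.sameOffSystem_run_closeRow {σ τ : State} (h : SameOffEntries σ τ) :
    SameOffSystem σ (closeRow.run τ) where
  int a ha := by
    have h₃ : a ≠ 3 := by omega
    have h₆ : a ≠ 6 := by omega
    have h₇ : a ≠ 7 := by omega
    ext x
    simp only [closeRow, Stmt.run, State.setInt_int, h₃, h₆, h₇, false_and, if_false]
    exact h.int a (by omega) (by omega) x (by omega)
  real a ha := by simpa only [closeRow, Stmt.run, State.setInt_real] using h.real a ha

theorem HoldsSystem.run_closeRow {σ τ : State} {m : ℕ} {l : List Eqn} (h : HoldsSystem σ m l)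
    (hτ : SameOffEntries σ τ) {e : Eqn} (he : σ.int 8 7 = e.tag)
    (hE : HoldsEntries τ (LinSys.entries (l ++ [e]))) :
    HoldsSystem (closeRow.run τ) m (l ++ [e]) := by
  have hrow : τ.int 3 0 = l.length := (hτ.int 3 (by simp) (by simp) 0 (by simp)).trans h.length
  have htag : τ.int 8 7 = e.tag := (hτ.int 8 (by simp) (by simp) 7 (by simp)).trans he
  refine ⟨?_, ⟨?_, ?_⟩, ?_, ?_⟩
  · simp [closeRow, Stmt.run, IExpr.eval, reg, State.setInt_int, hrow]
  · simpa [closeRow, Stmt.run, IExpr.eval, reg, State.setInt_int] using hE.length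
  · simpa [closeRow, Stmt.run, IExpr.eval, reg, State.setInt_int, State.setInt_real] using hE.get
  · intro r hr
    rw [List.length_append, List.length_singleton] at hr
    simp only [closeRow, Stmt.run, IExpr.eval, reg, State.setInt_int, hrow, htag]
    rcases Nat.lt_succ_iff_lt_or_eq.1 hr with hr | rfl
    · have hne : (r : ℤ) ≠ l.length := by omega
      simp [List.getElem_append_left hr, ← h.tag r hr, hne, hτ.int 6]
    · simp
  · intro i hi
    have hcount : τ.int 7 i = l.countP fun e => e.tag = i :=
      (hτ.int 7 (by simp) (by simp) i (by simp)).trans (h.count i hi)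
    simp only [closeRow, Stmt.run, IExpr.eval, reg, State.setInt_int, hrow, htag,
      List.countP_append, List.countP_singleton]
    by_cases hie : e.tag = i
    · simp [hie, hcount]
    · have hne : (i : ℤ) ≠ e.tag := by omega
      simp [hie, hne, hcount]

theorem run_emit {σ : State} {m : ℕ} {l : List Eqn} (h : HoldsSystem σ m l) (k : Kind)
    {c c' : ℤ} {i j tag : ℕ} {mu : ℝ} (hi : σ.int 8 c = i) (hj : σ.int 8 c' = j)
    (htag : σ.int 8 7 = tag) (hmu : mult.eval σ = mu) :
    HoldsSystem ((emit k c c').run σ) m (l ++ [⟨k, i, j, mu, tag⟩]) ∧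
      SameOffSystem σ ((emit k c c').run σ) := by
  have hmult (τ) (hτ : SameOffEntries σ τ) : mult.eval τ = mu := by
    rw [← hmu]
    exact congrFun (hτ.real 6 (by simp)) 0
  have hnegMult (τ) (hτ : SameOffEntries σ τ) : (RExpr.sub (.const 0) mult).eval τ = -mu := by
    simp [RExpr.eval, hmult τ hτ]
  obtain ⟨hE, hsame⟩ := run_pushAll (List.rel_append (k.forall₂_evaluatesTo_cols hi hmult hnegMult)
    (k.forall₂_evaluatesTo_cols hj hnegMult fun τ hτ => (hmult τ hτ).trans (neg_neg mu).symm))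
    h.entries h.length
  exact ⟨h.run_closeRow hsame htag (by rwa [entries_concat]), hsame.sameOffSystem_run_closeRow⟩

def emitAll : List (Kind × ℤ × ℤ) → Stmt
  | [] => .skip
  | p :: P => emit p.1 p.2.1 p.2.2 ;; emitAll P

theorem emitAll_loopFree (P : List (Kind × ℤ × ℤ)) : (emitAll P).LoopFree := by
  induction P with
  | nil => trivial
  | cons p P ih => exact ⟨emit_loopFree _ _ _, ih⟩

theorem run_emitAll {σ : State} {m : ℕ} {l : List Eqn} (h : HoldsSystem σ m l)
    {P : List (Kind × ℤ × ℤ)} {block : ℤ → ℕ}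
    (hblock : ∀ p ∈ P, σ.int 8 p.2.1 = block p.2.1 ∧ σ.int 8 p.2.2 = block p.2.2)
    {tag : ℕ} {mu : ℝ} (htag : σ.int 8 7 = tag) (hmu : mult.eval σ = mu) :
    HoldsSystem ((emitAll P).run σ) m
        (l ++ P.map fun p => ⟨p.1, block p.2.1, block p.2.2, mu, tag⟩) ∧
      SameOffSystem σ ((emitAll P).run σ) := by
  induction P generalizing σ l with
  | nil => exact ⟨by simpa [emitAll, Stmt.run] using h, fun _ _ => rfl, fun _ _ => rfl⟩
  | cons p P ih =>
    obtain ⟨hp, hP⟩ := List.forall_mem_cons.1 hblock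
    obtain ⟨h', hsame⟩ := run_emit h p.1 hp.1 hp.2 htag hmu
    have hregs : ((emit p.1 p.2.1 p.2.2).run σ).int 8 = σ.int 8 := hsame.int 8 (by simp)
    obtain ⟨h'', hsame'⟩ := ih h' (by simpa only [hregs] using hP) (by rw [hregs, htag])
      (by rw [← hmu]; exact congrFun (hsame.real 6 (by simp)) 0)
    exact ⟨by simpa [emitAll, Stmt.run] using h'', hsame.trans hsame'⟩

/-! ### Writing gadgets to the output -/

/-- The memory holds the state `S` of the construction: its equations in the output arrays, its
number of blocks in register 8 and its accumulators in integer array 9. -/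
structure HoldsWork (σ : State) (m : ℕ) (S : Construction) : Prop where
  system : HoldsSystem σ m S.eqns
  blocks : σ.int 8 8 = S.blocks
  acc : ∀ i < m, σ.int 9 (i : ℕ) = S.acc i

theorem HoldsWork.congr {σ σ' : State} {m : ℕ} {S : Construction} (h : HoldsWork σ m S)
    (hint : ∀ a, 3 ≤ a → a ≠ 8 → σ'.int a = σ.int a) (hblocks : σ'.int 8 8 = σ.int 8 8)
    (hreal : σ'.real 3 = σ.real 3) : HoldsWork σ' m S where
  system := h.system.congr (fun a h₃ _ => hint a h₃ (by omega)) hreal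
  blocks := by rw [hblocks, h.blocks]
  acc i hi := by rw [hint 9 (by omega) (by omega), h.acc i hi]

/-- Load the new blocks and the accumulator of a gadget into the registers. -/
def loadBlocks : Stmt :=
  .setInt 8 (.const 0) (reg 8) ;;
  .setInt 8 (.const 1) (.add (reg 8) (.const 1)) ;;
  .setInt 8 (.const 2) (.add (reg 8) (.const 2)) ;;
  .setInt 8 (.const 3) (.add (reg 8) (.const 3)) ;;
  .setInt 8 (.const 6) (.get 9 (reg 7))

/-- Update the accumulator and the number of blocks after a gadget. -/
def storeBlocks : Stmt :=
  .setInt 9 (reg 7) (reg 3) ;;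
  .setInt 8 (.const 8) (.add (reg 8) (.const 4))

/-- The equations of `gadget`, with registers in place of blocks. -/
def gadgetPattern : List (Kind × ℤ × ℤ) :=
  [(.fst, 4, 0), (.fst, 1, 5), (.diff, 0, 1), (.fst, 2, 6), (.snd, 0, 2), (.snd, 3, 1),
    (.diff, 3, 2)]

/-- Append a gadget to the output, for the blocks in registers 4 and 5 and the row in
register 7. -/
def emitGadget : Stmt := loadBlocks ;; emitAll gadgetPattern ;; storeBlocks

theorem emitGadget_loopFree : emitGadget.LoopFree := by
  simp [emitGadget, loadBlocks, storeBlocks, Stmt.LoopFree, emitAll_loopFree]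

/-- `σ'` agrees with `σ` outside of the state of the construction and the registers below 9. -/
structure SameOffWork (σ σ' : State) : Prop where
  int : ∀ a < 3, σ'.int a = σ.int a
  reg : ∀ x, 9 ≤ x → σ'.int 8 x = σ.int 8 x
  real : ∀ a ≠ 3, σ'.real a = σ.real a

/-- The blocks in the registers while a gadget with the blocks `T`, `a`, `b` is written. -/
def gadgetBlock (T a b nb : ℕ) (c : ℤ) : ℕ :=
  if c = 4 then a else if c = 5 then b else if c = 6 then T else nb + c.toNat

theorem map_gadgetPattern (T a b nb : ℕ) (mu : ℝ) (tag : ℕ) :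
    gadgetPattern.map (fun p =>
      (⟨p.1, gadgetBlock T a b nb p.2.1, gadgetBlock T a b nb p.2.2, mu, tag⟩ : Eqn)) =
      gadget T a b nb mu tag := rfl

theorem run_loadBlocks_reg {σ : State} {i T nb : ℕ} (hi : σ.int 8 7 = i) (hT : σ.int 9 i = T)
    (hnb : σ.int 8 8 = nb) (x : ℤ) :
    (loadBlocks.run σ).int 8 x = if x = 6 then (T : ℤ) else if x = 3 then nb + 3 else
      if x = 2 then nb + 2 else if x = 1 then nb + 1 else if x = 0 then nb else σ.int 8 x := by
  simp [loadBlocks, Stmt.run, IExpr.eval, reg, State.setInt_int, hi, hT, hnb]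

theorem run_loadBlocks_int (σ : State) {a : ℕ} (ha : a ≠ 8) :
    (loadBlocks.run σ).int a = σ.int a := by
  ext x
  simp [loadBlocks, Stmt.run, State.setInt_int, ha]

theorem run_storeBlocks_int (σ : State) {a : ℕ} (h₈ : a ≠ 8) (h₉ : a ≠ 9) :
    (storeBlocks.run σ).int a = σ.int a := by
  ext x
  simp [storeBlocks, Stmt.run, State.setInt_int, h₈, h₉]

theorem holdsWork_run_storeBlocks {σ : State} {m : ℕ} {S : Construction} {i a b : ℕ} {mu : ℝ}
    (hsys : HoldsSystem σ m (S.addGadget i a b mu).eqns) (hi : σ.int 8 7 = i)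
    (hreg : σ.int 8 3 = S.blocks + 3) (hblocks : σ.int 8 8 = S.blocks)
    (hacc : ∀ i < m, σ.int 9 (i : ℕ) = S.acc i) :
    HoldsWork (storeBlocks.run σ) m (S.addGadget i a b mu) where
  system := hsys.congr (fun _ _ _ => run_storeBlocks_int σ (by omega) (by omega)) rfl
  blocks := by
    simp [storeBlocks, Stmt.run, IExpr.eval, reg, State.setInt_int, hblocks, Construction.addGadget]
  acc i' hi' := by
    simp only [storeBlocks, Stmt.run, IExpr.eval, reg, State.setInt_int, hi, hreg,
      Construction.addGadget, Function.update_apply]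
    by_cases hii : i' = i
    · simp [hii]
    · simp [hii, hacc i' hi']

theorem run_emitGadget {σ : State} {m : ℕ} {S : Construction} (h : HoldsWork σ m S) {a b i : ℕ}
    {mu : ℝ} (ha : σ.int 8 4 = a) (hb : σ.int 8 5 = b) (hi : σ.int 8 7 = i) (him : i < m)
    (hmu : mult.eval σ = mu) :
    HoldsWork (emitGadget.run σ) m (S.addGadget i a b mu) ∧
      SameOffWork σ (emitGadget.run σ) := by
  simp only [emitGadget, Stmt.run]
  have hload := run_loadBlocks_reg hi (h.acc i him) h.blocks
  have hsys₀ : HoldsSystem (loadBlocks.run σ) m S.eqns :=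
    h.system.congr (fun _ _ _ => run_loadBlocks_int σ (by omega)) rfl
  have hregs : ∀ p ∈ gadgetPattern,
      (loadBlocks.run σ).int 8 p.2.1 = gadgetBlock (S.acc i) a b S.blocks p.2.1 ∧
      (loadBlocks.run σ).int 8 p.2.2 = gadgetBlock (S.acc i) a b S.blocks p.2.2 := by
    simp [gadgetPattern, gadgetBlock, hload, ha, hb]
  obtain ⟨hsys, hsame⟩ := run_emitAll hsys₀ hregs ((hload 7).trans (by simpa using hi)) hmu
  rw [map_gadgetPattern] at hsys
  set σ' := (emitAll gadgetPattern).run (loadBlocks.run σ)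
  have hreg (x : ℤ) : σ'.int 8 x = (loadBlocks.run σ).int 8 x :=
    congrFun (hsame.int 8 (by simp)) x
  refine ⟨holdsWork_run_storeBlocks hsys ?_ ?_ ?_ ?_, ?_, ?_, ?_⟩
  · simpa [hreg, hload] using hi
  · simp [hreg, hload]
  · simpa [hreg, hload] using h.blocks
  · intro i' hi'
    rw [hsame.int 9 (by simp), run_loadBlocks_int σ (by simp), h.acc i' hi']
  · intro a' ha'
    rw [run_storeBlocks_int σ' (by omega) (by omega), hsame.int a' (by omega),
      run_loadBlocks_int σ (by omega)]
  · intro x hx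
    have h₈ : x ≠ 8 := by omega
    simp only [storeBlocks, Stmt.run, IExpr.eval, State.setInt_int, h₈, and_false, if_false,
      Nat.reduceEqDiff, false_and]
    rw [hreg, hload]
    simp (disch := omega) only [if_neg]
  · exact fun a' ha' => hsame.real a' ha'

/-! ### The forward program -/

def tick : Stmt := .setInt 8 (.const 10) (.add (reg 10) (.const 1))

def reset : Stmt := .setInt 8 (.const 10) (.const 0)

/-- The loop counter is a row of the given matrix. -/
def rowTest : BExpr := .ilt (reg 10) (.get 0 (.const 0))

/-- The loop counter is an entry of the given matrix. -/
def entTest : BExpr := .ilt (reg 10) (.get 0 (.const 2))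

/-- The entry of the given matrix at the loop counter. -/
def curEnt : RExpr := .get 0 (reg 10)

/-- The part of the entry at the loop counter that has not been processed, in real array 7. -/
def curRem : RExpr := .get 7 (reg 10)

def initRegs : Stmt :=
  .setInt 3 (.const 0) (.const 0) ;;
  .setInt 3 (.const 2) (.const 0) ;;
  .setInt 8 (.const 8) (.get 0 (.const 1)) ;;
  .setInt 8 (.const 9) (.const 0) ;;
  .setReal 6 (.const 0) (.const 1) ;;
  reset

/-- Initialize the accumulator and the equation count of a row. -/
def initRow : Stmt :=
  .setInt 9 (reg 10) (.const 0) ;; .setInt 7 (reg 10) (.const 0) ;; tick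

def initRows : Stmt := initRegs ;; .loop rowTest initRow

def copyEntry : Stmt := .setReal 7 (reg 10) curEnt ;; tick

def copyEntries : Stmt := reset ;; .loop entTest copyEntry

/-- The multiplier exceeds the absolute value of the current entry. -/
def scaleTest : BExpr := .and (.rlt curEnt mult) (.rlt (.sub (.const 0) curEnt) mult)

def doubleMult : Stmt :=
  .setReal 6 (.const 0) (.add mult mult) ;; .setInt 8 (.const 9) (.add (reg 9) (.const 1))

def scaleStep : Stmt := .cond scaleTest tick doubleMult

/-- Double the multiplier until it exceeds the absolute values of all entries. -/
def scale : Stmt := reset ;; .loop entTest scaleStep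

/-- Go to the next binary digit. -/
def nextLevel : Stmt :=
  .setInt 8 (.const 9) (.sub (reg 9) (.const 1)) ;;
  .setReal 6 (.const 0) (.div mult (.const 2)) ;;
  reset

/-- Load the first block into register 4, an accumulator into register `x`, and its row into
register 7. -/
def loadRow (x : ℤ) : Stmt :=
  .setInt 8 (.const 4) (.const 0) ;; .setInt 8 (.const x) (.get 9 (reg 10)) ;;
    .setInt 8 (.const 7) (reg 10)

def doubleRow : Stmt := loadRow 5 ;; emitGadget ;; tick

/-- Double all accumulators after the change to the next binary digit. -/
def doubleRows : Stmt := nextLevel ;; .loop rowTest doubleRow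

/-- Choose the variables whose difference is added to an accumulator. -/
def chooseBit : Stmt :=
  .setInt 8 (.const 7) (.get 1 (reg 10)) ;;
  .setInt 8 (.const 4) (.const 0) ;;
  .setInt 8 (.const 5) (.const 0) ;;
  .cond (.rlt curRem mult)
    (.cond (.rlt (.sub (.const 0) curRem) mult)
      .skip
      (.setInt 8 (.const 5) (.get 2 (reg 10)) ;; .setReal 7 (reg 10) (.add curRem mult)))
    (.setInt 8 (.const 4) (.get 2 (reg 10)) ;; .setReal 7 (reg 10) (.sub curRem mult))

def addEntry : Stmt := chooseBit ;; emitGadget ;; tick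

def addEntries : Stmt := reset ;; .loop entTest addEntry

def level : Stmt := doubleRows ;; addEntries

def levelTest : BExpr := .ilt (.const 0) (reg 9)

def finalRow : Stmt := loadRow 6 ;; emit .fst 4 6 ;; tick

def weightEntry : Stmt :=
  .setReal 3 (reg 10)
    (.mul (.get 3 (reg 10)) (.sqrt (.ofInt (.get 7 (.get 6 (.get 4 (reg 10))))))) ;; tick

def writeRhs : Stmt :=
  .setReal 4 (reg 10) (.div (.get 1 (.get 6 (reg 10)))
    (.sqrt (.ofInt (.get 7 (.get 6 (reg 10)))))) ;; tick

/-- The loop counter is an entry of the output matrix. -/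
def outEntTest : BExpr := .ilt (reg 10) (.get 3 (.const 2))

/-- The loop counter is a row of the output matrix. -/
def outRowTest : BExpr := .ilt (reg 10) (.get 3 (.const 0))

def finalRows : Stmt := reset ;; .loop rowTest finalRow

def weightEntries : Stmt :=
  (.setInt 3 (.const 1) (.mul (.const 2) (reg 8)) ;; reset) ;; .loop outEntTest weightEntry

def writeRhsAll : Stmt :=
  (reset ;; .loop outRowTest writeRhs) ;; .setReal 5 (.const 0) (.get 2 (.const 0))

/-- The program that maps an instance to a 2-commodity instance. -/
def forward : Stmt :=
  (initRows ;; copyEntries ;; scale) ;; .loop levelTest level ;;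
    finalRows ;; weightEntries ;; writeRhsAll

/-! ### Correctness of the initialization -/

/-- The memory holds the given instance. -/
structure HoldsInput (σ : State) (d : SparseMatrix) (c : ℕ → ℝ) (ε : ℝ) : Prop where
  m : σ.int 0 0 = d.m
  n : σ.int 0 1 = d.n
  s : σ.int 0 2 = d.s
  row : ∀ k < d.s, σ.int 1 (k : ℕ) = d.row k
  col : ∀ k < d.s, σ.int 2 (k : ℕ) = d.col k
  ent : ∀ k < d.s, σ.real 0 (k : ℕ) = d.ent k
  rhs : ∀ i < d.m, σ.real 1 (i : ℕ) = c i
  eps : σ.real 2 0 = ε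

section Initialization

variable {d : SparseMatrix} {c : ℕ → ℝ} {ε : ℝ} {σ : State}

theorem HoldsInput.congr {σ' : State} (h : HoldsInput σ d c ε)
    (hint : ∀ a < 3, σ'.int a = σ.int a) (hreal : ∀ a < 3, σ'.real a = σ.real a) :
    HoldsInput σ' d c ε where
  m := by rw [hint 0 (by omega), h.m]
  n := by rw [hint 0 (by omega), h.n]
  s := by rw [hint 0 (by omega), h.s]
  row k hk := by rw [hint 1 (by omega), h.row k hk]
  col k hk := by rw [hint 2 (by omega), h.col k hk]
  ent k hk := by rw [hreal 0 (by omega), h.ent k hk]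
  rhs i hi := by rw [hreal 1 (by omega), h.rhs i hi]
  eps := by rw [hreal 2 (by omega), h.eps]

theorem HoldsInput.run (h : HoldsInput σ d c ε) {p : Stmt} (hint : ∀ a ∈ p.intWrites, 3 ≤ a)
    (hreal : ∀ a ∈ p.realWrites, 3 ≤ a) : HoldsInput (p.run σ) d c ε :=
  h.congr (fun a ha => Stmt.run_int_of_notMem (fun hp => by have := hint a hp; omega) σ)
    fun a ha => Stmt.run_real_of_notMem (fun hp => by have := hreal a hp; omega) σ

theorem HoldsWork.run {m : ℕ} {S : Construction} (h : HoldsWork σ m S) {p : Stmt}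
    (hint : ∀ a ∈ p.intWrites, a < 3 ∨ a = 8) (hreal : 3 ∉ p.realWrites)
    (hblocks : (p.run σ).int 8 8 = σ.int 8 8) : HoldsWork (p.run σ) m S :=
  h.congr (fun a h₃ h₈ => Stmt.run_int_of_notMem (fun hp => by have := hint a hp; omega) σ)
    hblocks (Stmt.run_real_of_notMem hreal σ)

theorem HoldsInput.setCounter (h : HoldsInput σ d c ε) (z : ℤ) :
    HoldsInput (σ.setInt 8 10 z) d c ε :=
  h.run (p := .setInt 8 (.const 10) (.const z)) (by simp [Stmt.intWrites])
    (by simp [Stmt.realWrites])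

theorem HoldsWork.setCounter {m : ℕ} {S : Construction} (h : HoldsWork σ m S) (z : ℤ) :
    HoldsWork (σ.setInt 8 10 z) m S :=
  h.run (p := .setInt 8 (.const 10) (.const z)) (by simp [Stmt.intWrites])
    (by simp [Stmt.realWrites]) (by simp [Stmt.run, IExpr.eval, State.setInt_int])

theorem runs_reset {Q : State → Prop} (h : Q (σ.setInt 8 10 0)) : Runs reset σ reset.maxCost Q :=
  Stmt.LoopFree.runs (p := reset) trivial h

theorem rowTest_eval_iff (h : HoldsInput σ d c ε) {k : ℕ} (hk : σ.int 8 10 = k) :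
    rowTest.eval σ ↔ k < d.m := by
  simp [rowTest, BExpr.eval, IExpr.eval, reg, hk, h.m]

theorem entTest_eval_iff (h : HoldsInput σ d c ε) {k : ℕ} (hk : σ.int 8 10 = k) :
    entTest.eval σ ↔ k < d.s := by
  simp [entTest, BExpr.eval, IExpr.eval, reg, hk, h.s]

/-- The memory of the forward program when its construction has reached the state `S` with
multiplier `p`, there are `L` binary digits left, and `r` lists the remaining parts of the
entries. -/
structure HoldsState (σ : State) (d : SparseMatrix) (c : ℕ → ℝ) (ε : ℝ) (S : Construction)
    (L : ℕ) (p : ℤ) (r : ℕ → ℤ) : Prop where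
  input : HoldsInput σ d c ε
  work : HoldsWork σ d.m S
  level : σ.int 8 9 = L
  mult : σ.real 6 0 = p
  rem : ∀ k < d.s, σ.real 7 (k : ℕ) = r k

theorem HoldsState.setCounter {S : Construction} {L : ℕ} {p : ℤ} {r : ℕ → ℤ}
    (h : HoldsState σ d c ε S L p r) (z : ℤ) : HoldsState (σ.setInt 8 10 z) d c ε S L p r where
  input := h.input.setCounter z
  work := h.work.setCounter z
  level := by simpa [State.setInt_int] using h.level
  mult := h.mult
  rem := h.rem

theorem holdsWork_initial_zero (hrows : σ.int 3 0 = 0) (hents : σ.int 3 2 = 0) {n : ℕ}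
    (hn : σ.int 8 8 = n) : HoldsWork σ 0 (.initial n) where
  system := ⟨hrows, ⟨hents, by simp [Construction.initial, entries]⟩,
    by simp [Construction.initial], by simp⟩
  blocks := hn
  acc := by simp

theorem holdsWork_run_initRow {k n : ℕ} (h : HoldsWork σ k (.initial n)) (hk : σ.int 8 10 = k) :
    HoldsWork (initRow.run σ) (k + 1) (.initial n) := by
  have hother {a : ℕ} (h₇ : a ≠ 7) (h₈ : a ≠ 8) (h₉ : a ≠ 9) :
      (initRow.run σ).int a = σ.int a := Stmt.run_int_of_notMem (by
    simp [initRow, tick, Stmt.intWrites, h₇, h₈, h₉]) σ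
  refine ⟨⟨?_, ⟨?_, ?_⟩, ?_, fun i hi => ?_⟩, ?_, fun i hi => ?_⟩
  · rw [hother (by simp) (by simp) (by simp), h.system.length]
  · rw [hother (by simp) (by simp) (by simp), h.system.entries.length]
  · simp [Construction.initial, entries]
  · simp [Construction.initial]
  · by_cases hik : i = k
    · simp [initRow, tick, Stmt.run, IExpr.eval, reg, State.setInt_int, hk, hik,
        Construction.initial]
    · simpa [initRow, tick, Stmt.run, IExpr.eval, reg, State.setInt_int, hk, hik] using
        h.system.count i (by omega)
  · simpa [initRow, tick, Stmt.run, IExpr.eval, State.setInt_int] using h.blocks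
  · by_cases hik : i = k
    · simp [initRow, tick, Stmt.run, IExpr.eval, reg, State.setInt_int, hk, hik,
        Construction.initial]
    · simpa [initRow, tick, Stmt.run, IExpr.eval, reg, State.setInt_int, hk, hik] using
        h.acc i (by omega)

theorem runs_initRows (h : HoldsInput σ d c ε) :
    Runs initRows σ (initRegs.maxCost + loopCost d.m rowTest initRow) fun τ =>
      HoldsInput τ d c ε ∧ HoldsWork τ d.m (.initial d.n) ∧ τ.int 8 9 = 0 ∧ τ.real 6 0 = 1 := by
  let I (k : ℕ) (τ : State) : Prop := HoldsInput τ d c ε ∧ HoldsWork τ k (.initial d.n) ∧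
    τ.int 8 9 = 0 ∧ τ.real 6 0 = 1 ∧ τ.int 8 10 = k
  have hinit : Runs initRegs σ initRegs.maxCost (I 0) := by
    refine Stmt.LoopFree.runs (by simp [initRegs, reset, Stmt.LoopFree])
      ⟨h.run (by decide) (by decide), holdsWork_initial_zero ?_ ?_ ?_, ?_, ?_, ?_⟩
    all_goals simp [initRegs, reset, Stmt.run, State.setInt_int, State.setReal_int,
      State.setInt_real, State.setReal_real, IExpr.eval, RExpr.eval, h.n]
  refine hinit.seq fun τ hτ => (Runs.loop_count I
    (fun k τ hτ => rowTest_eval_iff hτ.1 hτ.2.2.2.2) ?_ hτ).mono le_rfl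
      fun τ hτ => ⟨hτ.1, hτ.2.1, hτ.2.2.1, hτ.2.2.2.1⟩
  rintro k - τ ⟨hin, hwork, hlevel, hmult, hk⟩
  refine Stmt.LoopFree.runs (by simp [initRow, tick, Stmt.LoopFree])
    ⟨hin.run (by decide) (by decide), holdsWork_run_initRow hwork hk, ?_, hmult, ?_⟩
  all_goals simp [initRow, tick, Stmt.run, State.setInt_int, IExpr.eval, reg, hk, hlevel]

theorem runs_copyEntries (hin : HoldsInput σ d c ε) (hwork : HoldsWork σ d.m (.initial d.n))
    (hlevel : σ.int 8 9 = 0) (hmult : σ.real 6 0 = 1) :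
    Runs copyEntries σ (reset.maxCost + loopCost d.s entTest copyEntry) fun τ =>
      HoldsState τ d c ε (.initial d.n) 0 1 d.ent := by
  let I (k : ℕ) (τ : State) : Prop := HoldsInput τ d c ε ∧ HoldsWork τ d.m (.initial d.n) ∧
    τ.int 8 9 = 0 ∧ τ.real 6 0 = 1 ∧ (∀ i < k, τ.real 7 (i : ℕ) = d.ent i) ∧ τ.int 8 10 = k
  have hreset : Runs reset σ reset.maxCost (I 0) :=
    runs_reset ⟨hin.setCounter 0, hwork.setCounter 0, by simpa [State.setInt_int] using hlevel,
      hmult, by simp, by simp [State.setInt_int]⟩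
  refine hreset.seq fun τ hτ => (Runs.loop_count I
    (fun k τ hτ => entTest_eval_iff hτ.1 hτ.2.2.2.2.2) ?_ hτ).mono le_rfl ?_
  · rintro k hks τ ⟨hin, hwork, hlevel, hmult, hrem, hk⟩
    refine Stmt.LoopFree.runs (by simp [copyEntry, tick, Stmt.LoopFree])
      ⟨hin.run (by decide) (by decide), hwork.run (by decide) (by decide) ?_, ?_, ?_,
        fun i hi => ?_, ?_⟩
    case refine_4 =>
      simp only [copyEntry, tick, Stmt.run, State.setInt_real, State.setReal_real, IExpr.eval, reg,
        RExpr.eval, curEnt, hk, Nat.cast_inj, true_and]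
      split_ifs with hik
      · rw [hik, hin.ent k hks]
      · exact hrem i (by omega)
    all_goals simp [copyEntry, tick, Stmt.run, State.setInt_int, State.setReal_int,
      State.setInt_real, State.setReal_real, IExpr.eval, reg, hk, hlevel, hmult]
  · rintro τ ⟨hin, hwork, hlevel, hmult, hrem, -⟩
    exact ⟨hin, hwork, hlevel, by simpa using hmult, hrem⟩

theorem scaleTest_eval_iff {S : Construction} {L k : ℕ} {p : ℤ} {r : ℕ → ℤ}
    (h : HoldsState σ d c ε S L p r) (hk : σ.int 8 10 = k) (hks : k < d.s) :
    scaleTest.eval σ ↔ |d.ent k| < p := by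
  simp only [scaleTest, BExpr.eval, RExpr.eval, IExpr.eval, curEnt, mult, reg, hk, h.mult,
    h.input.ent k hks, Rat.cast_zero, zero_sub]
  rw [← Int.cast_neg, Int.cast_lt, Int.cast_lt, abs_lt, neg_lt, and_comm]

theorem HoldsState.run_doubleMult {S : Construction} {L : ℕ} {p : ℤ} {r : ℕ → ℤ}
    (h : HoldsState σ d c ε S L p r) :
    HoldsState (doubleMult.run σ) d c ε S (L + 1) (2 * p) r where
  input := h.input.run (by decide) (by decide)
  work := h.work.run (by decide) (by decide)
    (by simp [doubleMult, Stmt.run, State.setInt_int, State.setReal_int, IExpr.eval])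
  level := by
    simp [doubleMult, Stmt.run, State.setInt_int, State.setReal_int, IExpr.eval, reg, h.level]
  mult := by
    simp [doubleMult, Stmt.run, State.setInt_real, State.setReal_real, RExpr.eval, IExpr.eval,
      LinSys.mult, h.mult, two_mul]
  rem := by
    rw [Stmt.run_real_of_notMem (by decide) σ]
    exact h.rem

theorem runs_scale {N : ℕ} (hN : ∀ k < d.s, (d.ent k).natAbs ≤ N)
    (h : HoldsState σ d c ε (.initial d.n) 0 1 d.ent) :
    Runs scale σ (reset.maxCost + loopCost (d.s + (Nat.log 2 N + 1)) entTest scaleStep)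
      fun τ => ∃ L ≤ Nat.log 2 N + 1,
      HoldsState τ d c ε (.initial d.n) L (2 ^ L) d.ent ∧ ∀ k < d.s, |d.ent k| < 2 ^ L := by
  let I (fuel : ℕ) (τ : State) : Prop := ∃ L k : ℕ, fuel = (d.s - k) + (Nat.log 2 N + 1 - L) ∧
    L ≤ Nat.log 2 N + 1 ∧ k ≤ d.s ∧ HoldsState τ d c ε (.initial d.n) L (2 ^ L) d.ent ∧
    (∀ i < k, |d.ent i| < 2 ^ L) ∧ τ.int 8 10 = k
  have hreset : Runs reset σ reset.maxCost (I (d.s + (Nat.log 2 N + 1))) :=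
    runs_reset ⟨0, 0, by omega, by omega, by omega, h.setCounter 0, by simp,
      by simp [State.setInt_int]⟩
  refine hreset.seq fun τ hτ => (Runs.loop I ?_ hτ).mono le_rfl ?_
  · rintro fuel τ ⟨L, k, rfl, hL, -, hst, hlt, hk⟩ htest
    have hks : k < d.s := (entTest_eval_iff hst.input hk).1 htest
    refine Stmt.LoopFree.runs (by simp [scaleStep, tick, doubleMult, Stmt.LoopFree]) ?_
    rw [scaleStep, Stmt.run]
    split_ifs with hscale
    · refine ⟨_, by omega, L, k + 1, rfl, hL, hks, hst.setCounter _, fun i hi => ?_, ?_⟩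
      · rcases Nat.lt_succ_iff_lt_or_eq.1 hi with hi | rfl
        · exact hlt i hi
        · exact_mod_cast (scaleTest_eval_iff hst hk hks).1 hscale
      · simp [tick, Stmt.run, State.setInt_int, IExpr.eval, reg, hk]
    · have hle : 2 ^ L ≤ |d.ent k| := by
        simpa using mt (scaleTest_eval_iff hst hk hks).2 hscale
      have hpow : 2 ^ L ≤ N := le_trans (by zify; exact hle) (hN k hks)
      have hlog := Nat.le_log_of_pow_le one_lt_two hpow
      refine ⟨_, by omega, L + 1, k, rfl, by omega, hks.le, ?_, fun i hi => (hlt i hi).trans_le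
        (pow_le_pow_right₀ one_le_two L.le_succ), ?_⟩
      · simpa only [pow_succ'] using hst.run_doubleMult
      · simp [doubleMult, Stmt.run, State.setInt_int, State.setReal_int, IExpr.eval, hk]
  · rintro τ ⟨_, ⟨L, k, -, hL, hks, hst, hlt, hk⟩, htest⟩
    have hks' := mt (entTest_eval_iff hst.input hk).2 htest
    exact ⟨L, hL, hst, fun i hi => hlt i (by omega)⟩

end Initialization

/-! ### Correctness of the main loop -/

section MainLoop

variable {d : SparseMatrix} {c : ℕ → ℝ} {ε M : ℝ} {σ : State} {S : Construction} {L : ℕ} {p : ℤ}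
  {P r : ℕ → ℤ}

theorem HoldsState.run_emitGadget_tick (h : HoldsState σ d c ε S L p r) {a b i j : ℕ}
    (ha : σ.int 8 4 = a) (hb : σ.int 8 5 = b) (hi : σ.int 8 7 = i) (him : i < d.m)
    (hj : σ.int 8 10 = j) :
    HoldsState (tick.run (emitGadget.run σ)) d c ε (S.addGadget i a b p) L p r ∧
      (tick.run (emitGadget.run σ)).int 8 10 = (j + 1 : ℕ) := by
  obtain ⟨hwork, hsame⟩ := run_emitGadget h.work ha hb hi him h.mult
  refine ⟨HoldsState.setCounter ⟨?_, hwork, ?_, ?_, fun k hk => ?_⟩ _, ?_⟩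
  · exact h.input.congr hsame.int fun a ha => hsame.real a (by omega)
  · rw [hsame.reg 9 le_rfl, h.level]
  · rw [hsame.real 6 (by simp), h.mult]
  · rw [hsame.real 7 (by simp), h.rem k hk]
  · simp [tick, Stmt.run, State.setInt_int, IExpr.eval, reg, hsame.reg 10, hj]

theorem HoldsState.run_loadRow (h : HoldsState σ d c ε S L p r) {x i : ℕ} (hx₄ : 4 < x)
    (hx₇ : x < 7) (hi : σ.int 8 10 = i) (him : i < d.m) :
    HoldsState ((loadRow x).run σ) d c ε S L p r ∧ ((loadRow x).run σ).int 8 4 = 0 ∧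
      ((loadRow x).run σ).int 8 x = S.acc i ∧ ((loadRow x).run σ).int 8 7 = i ∧
      ((loadRow x).run σ).int 8 10 = i := by
  have hreg (y : ℤ) : ((loadRow x).run σ).int 8 y =
      if y = 7 then (i : ℤ) else if y = x then (S.acc i : ℤ) else if y = 4 then 0
      else σ.int 8 y := by
    have h₁₀ : (10 : ℤ) ≠ x := by omega
    simp [loadRow, Stmt.run, IExpr.eval, reg, State.setInt_int, hi, h₁₀, h.work.acc i him]
  refine ⟨⟨h.input.run (by simp [loadRow, Stmt.intWrites]) (by simp [loadRow, Stmt.realWrites]),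
    h.work.run (by simp [loadRow, Stmt.intWrites]) (by simp [loadRow, Stmt.realWrites]) ?_,
    ?_, h.mult, h.rem⟩, ?_, ?_, ?_, ?_⟩ <;> rw [hreg]
  · simp [show (8 : ℤ) ≠ x by omega]
  · simp [show (9 : ℤ) ≠ x by omega, h.level]
  · simp [show (4 : ℤ) ≠ x by omega]
  · simp [show (x : ℤ) ≠ 7 by omega]
  · simp
  · simp [show (10 : ℤ) ≠ x by omega, hi]

theorem HoldsState.run_doubleRow (h : HoldsState σ d c ε S L p r) {i : ℕ} (hi : σ.int 8 10 = i)
    (him : i < d.m) :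
    HoldsState (doubleRow.run σ) d c ε (S.addGadget i 0 (S.acc i) p) L p r ∧
      (doubleRow.run σ).int 8 10 = (i + 1 : ℕ) := by
  obtain ⟨hst, ha, hb, hrow, hi⟩ := h.run_loadRow (x := 5) (by omega) (by omega) hi him
  exact hst.run_emitGadget_tick (by simpa using ha) hb hrow him hi

/-- The digit of `r` at the power of two `p`, if `|r| < 2 * p`. -/
def digit (r p : ℤ) : ℤ := if r < p then if -r < p then 0 else -1 else 1

theorem abs_add_neg_digit_mul_lt {r p : ℤ} (hr : |r| < 2 * p) : |r + -digit r p * p| < p := by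
  rw [abs_lt] at hr ⊢
  unfold digit
  split_ifs <;> constructor <;> linarith

/-- The block `a` of the gadget for the digit `τ` of an entry in column `j`. -/
def digitFst (τ : ℤ) (j : ℕ) : ℕ := if τ = 1 then j else 0

/-- The block `b` of the gadget for the digit `τ` of an entry in column `j`. -/
def digitSnd (τ : ℤ) (j : ℕ) : ℕ := if τ = -1 then j else 0

theorem digit_cases (r p : ℤ) (j : ℕ) :
    (digit r p = 1 ∧ digitFst (digit r p) j = j ∧ digitSnd (digit r p) j = 0 ∧ p ≤ r) ∨
      (digit r p = -1 ∧ digitFst (digit r p) j = 0 ∧ digitSnd (digit r p) j = j ∧ p ≤ -r) ∨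
      (digit r p = 0 ∧ digitFst (digit r p) j = 0 ∧ digitSnd (digit r p) j = 0) := by
  unfold digit
  split_ifs <;> simp [digitFst, digitSnd] <;> omega

theorem run_chooseBit (h : HoldsState σ d c ε S L p r) {k : ℕ} (hk : σ.int 8 10 = k)
    (hks : k < d.s) :
    chooseBit.run σ =
      let σ' := ((σ.setInt 8 7 (d.row k)).setInt 8 4 0).setInt 8 5 0
      if r k < p then
        if -r k < p then σ' else (σ'.setInt 8 5 (d.col k)).setReal 7 k (r k + p)
      else (σ'.setInt 8 4 (d.col k)).setReal 7 k (r k - p) := by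
  have hneg : -(r k : ℝ) < p ↔ -r k < p := by norm_cast
  simp [chooseBit, Stmt.run, BExpr.eval, RExpr.eval, IExpr.eval, reg, curRem, mult,
    State.setInt_int, State.setInt_real, hk, h.rem k hks, h.mult, h.input.row k hks,
    h.input.col k hks, hneg]

theorem run_chooseBit_int (h : HoldsState σ d c ε S L p r) {k : ℕ} (hk : σ.int 8 10 = k)
    (hks : k < d.s) (y : ℤ) :
    (chooseBit.run σ).int 8 y =
      if y = 4 then (digitFst (digit (r k) p) (d.col k) : ℤ)
      else if y = 5 then (digitSnd (digit (r k) p) (d.col k) : ℤ)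
      else if y = 7 then (d.row k : ℤ) else σ.int 8 y := by
  rw [run_chooseBit h hk hks, digit]
  by_cases h₄ : y = 4 <;> by_cases h₅ : y = 5 <;>
    split_ifs <;> simp_all [digitFst, digitSnd, State.setInt_int, State.setReal_int]

theorem run_chooseBit_real (h : HoldsState σ d c ε S L p r) {k : ℕ} (hk : σ.int 8 10 = k)
    (hks : k < d.s) (y : ℕ) :
    (chooseBit.run σ).real 7 y =
      if y = k then ((r k + -digit (r k) p * p : ℤ) : ℝ) else σ.real 7 y := by
  have hrem := h.rem k hks
  rw [run_chooseBit h hk hks, digit]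
  split_ifs <;> simp_all [State.setInt_real, State.setReal_real, sub_eq_add_neg]

theorem HoldsState.run_chooseBit (h : HoldsState σ d c ε S L p r) {k : ℕ} (hk : σ.int 8 10 = k)
    (hks : k < d.s) :
    HoldsState (chooseBit.run σ) d c ε S L p
        (Function.update r k (r k + -digit (r k) p * p)) ∧
      (chooseBit.run σ).int 8 4 = digitFst (digit (r k) p) (d.col k) ∧
      (chooseBit.run σ).int 8 5 = digitSnd (digit (r k) p) (d.col k) ∧
      (chooseBit.run σ).int 8 7 = d.row k ∧ (chooseBit.run σ).int 8 10 = k := by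
  have hint := run_chooseBit_int h hk hks
  refine ⟨⟨h.input.run (by decide) (by decide), h.work.run (by decide) (by decide) ?_, ?_, ?_,
    fun k' hk' => ?_⟩, ?_, ?_, ?_, ?_⟩
  · simp [hint]
  · simp [hint, h.level]
  · rw [Stmt.run_real_of_notMem (by decide) σ, h.mult]
  · rw [run_chooseBit_real h hk hks, Function.update_apply]
    split_ifs
    · rfl
    · exact h.rem k' hk'
  all_goals simp [hint, hk]

/-- The state of the main loop after `q` gadgets. -/
structure Running (σ : State) (d : SparseMatrix) (c : ℕ → ℝ) (ε M : ℝ) (S : Construction)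
    (q L : ℕ) (p : ℤ) (P r : ℕ → ℤ) : Prop extends HoldsState σ d c ε S L p r where
  invariant : S.Invariant d M P r
  blocks : S.blocks = d.n + 4 * q
  length : S.eqns.length = 7 * q

variable {q : ℕ}

theorem Running.setCounter (h : Running σ d c ε M S q L p P r) (z : ℤ) :
    Running (σ.setInt 8 10 z) d c ε M S q L p P r :=
  { h with toHoldsState := h.toHoldsState.setCounter z }

theorem acc_addGadget_ne_zero {i i' : ℕ} (h : i' ≠ i → S.acc i' ≠ 0) (a b : ℕ) (mu : ℝ) :
    (S.addGadget i a b mu).acc i' ≠ 0 := by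
  rcases eq_or_ne i' i with rfl | hne
  · simp [Construction.addGadget]
  · simpa [Construction.addGadget, hne] using h hne

theorem Running.run_doubleRow (h : Running σ d c ε M S q L p P r) {i : ℕ} (hi : σ.int 8 10 = i)
    (him : i < d.m) (hp : 1 ≤ p) (hpM : (p : ℝ) ≤ M) (hP : P i = 2 * p) :
    Running (doubleRow.run σ) d c ε M (S.addGadget i 0 (S.acc i) p) (q + 1) L p
        (Function.update P i p) r ∧
      (doubleRow.run σ).int 8 10 = (i + 1 : ℕ) := by
  obtain ⟨hst, hi⟩ := h.toHoldsState.run_doubleRow hi him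
  refine ⟨⟨hst, h.invariant.double him hp hpM hP, ?_, ?_⟩, hi⟩
  · simp [Construction.addGadget, h.blocks, mul_add, add_assoc]
  · simp [Construction.addGadget, gadget, h.length, mul_add]

theorem Running.run_addEntry (h : Running σ d c ε M S q L p P r) {k : ℕ} (hk : σ.int 8 10 = k)
    (hks : k < d.s) (hpM : (p : ℝ) ≤ M) (hP : P (d.row k) = p) :
    ∃ a b : ℕ, Running (addEntry.run σ) d c ε M (S.addGadget (d.row k) a b p) (q + 1) L p P
        (Function.update r k (r k + -digit (r k) p * p)) ∧
      (addEntry.run σ).int 8 10 = (k + 1 : ℕ) := by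
  obtain ⟨hst, ha, hb, hrow, hk⟩ := h.toHoldsState.run_chooseBit hk hks
  obtain ⟨hst, hk⟩ := hst.run_emitGadget_tick ha hb hrow (d.row_lt k hks) hk
  have hinv := h.invariant.addEntry hks (hP ▸ hpM) (by rw [hP]; exact digit_cases (r k) p (d.col k))
  rw [hP] at hinv
  refine ⟨_, _, ⟨hst, hinv, ?_, ?_⟩, hk⟩
  · simp [Construction.addGadget, h.blocks, mul_add, add_assoc]
  · simp [Construction.addGadget, gadget, h.length, mul_add]

theorem Running.run_nextLevel (h : Running σ d c ε M S q (L + 1) (2 * p) P r) :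
    Running (nextLevel.run σ) d c ε M S q L p P r ∧ (nextLevel.run σ).int 8 10 = (0 : ℕ) := by
  refine ⟨{ h with
    input := h.input.run (by decide) (by decide)
    work := h.work.run (by decide) (by decide) ?_
    level := ?_
    mult := ?_ }, ?_⟩
  case refine_3 =>
    simp [nextLevel, reset, Stmt.run, State.setInt_real, State.setReal_real, IExpr.eval,
      RExpr.eval, mult, h.mult]
  all_goals simp [nextLevel, reset, Stmt.run, State.setInt_int, State.setReal_int, IExpr.eval,
    reg, h.level]

theorem runs_doubleRows (h : Running σ d c ε M S q (L + 1) (2 * p) P r) (hp : 1 ≤ p)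
    (hpM : (p : ℝ) ≤ M) (hP : ∀ i < d.m, P i = 2 * p) :
    Runs doubleRows σ (nextLevel.maxCost + loopCost d.m rowTest doubleRow) fun τ => ∃ S P,
      Running τ d c ε M S (q + d.m) L p P r ∧ ∀ i < d.m, P i = p ∧ S.acc i ≠ 0 := by
  let I (i : ℕ) (τ : State) : Prop := ∃ S P, Running τ d c ε M S (q + i) L p P r ∧
    (∀ i' < i, P i' = p ∧ S.acc i' ≠ 0) ∧ (∀ i' < d.m, i ≤ i' → P i' = 2 * p) ∧
    τ.int 8 10 = i
  have hnext : Runs nextLevel σ nextLevel.maxCost (I 0) :=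
    Stmt.LoopFree.runs (by simp [nextLevel, reset, Stmt.LoopFree])
      ⟨S, P, h.run_nextLevel.1, by simp, fun i hi _ => hP i hi, h.run_nextLevel.2⟩
  refine hnext.seq fun τ hτ => (Runs.loop_count I
    (fun k τ ⟨_, _, hτ, _, _, hk⟩ => rowTest_eval_iff hτ.input hk) ?_ hτ).mono le_rfl
      fun τ ⟨S, P, hτ, hdone, _, _⟩ => ⟨S, P, hτ, hdone⟩
  rintro i him τ ⟨S, P, hτ, hdone, htodo, hi⟩
  refine Stmt.LoopFree.runs (by simp [doubleRow, loadRow, tick, Stmt.LoopFree, emitGadget_loopFree])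
    ⟨_, _, (hτ.run_doubleRow hi him hp hpM (htodo i him le_rfl)).1, fun i' hi' =>
      ⟨?_, acc_addGadget_ne_zero (fun hne => (hdone i' (by omega)).2) _ _ _⟩,
      fun i' hi' hle => ?_, (hτ.run_doubleRow hi him hp hpM (htodo i him le_rfl)).2⟩
  · rcases eq_or_ne i' i with rfl | hne
    · exact Function.update_self ..
    · rw [Function.update_of_ne hne, (hdone i' (by omega)).1]
  · rw [Function.update_of_ne (by omega), htodo i' hi' (by omega)]

theorem runs_addEntries (h : Running σ d c ε M S q L p P r) (hpM : (p : ℝ) ≤ M)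
    (hP : ∀ i < d.m, P i = p) (hacc : ∀ i < d.m, S.acc i ≠ 0) (hr : ∀ k < d.s, |r k| < 2 * p) :
    Runs addEntries σ (reset.maxCost + loopCost d.s entTest addEntry) fun τ => ∃ S r,
      Running τ d c ε M S (q + d.s) L p P r ∧ (∀ i < d.m, S.acc i ≠ 0) ∧
      ∀ k < d.s, |r k| < p := by
  let I (k : ℕ) (τ : State) : Prop := ∃ S r, Running τ d c ε M S (q + k) L p P r ∧
    (∀ i < d.m, S.acc i ≠ 0) ∧ (∀ k' < k, |r k'| < p) ∧
    (∀ k' < d.s, k ≤ k' → |r k'| < 2 * p) ∧ τ.int 8 10 = k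
  have hreset : Runs reset σ reset.maxCost (I 0) := runs_reset
    ⟨S, r, h.setCounter 0, hacc, by simp, fun k hk _ => hr k hk, by simp [State.setInt_int]⟩
  refine hreset.seq fun τ hτ => (Runs.loop_count I
    (fun k τ ⟨_, _, hτ, _, _, _, hk⟩ => entTest_eval_iff hτ.input hk) ?_ hτ).mono le_rfl
      fun τ ⟨S, r, hτ, hacc, hdone, _, _⟩ => ⟨S, r, hτ, hacc, hdone⟩
  rintro k hks τ ⟨S, r, hτ, hacc, hdone, htodo, hk⟩
  obtain ⟨a, b, hτ, hk⟩ := hτ.run_addEntry hk hks hpM (hP _ (d.row_lt k hks))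
  refine Stmt.LoopFree.runs (by simp [addEntry, chooseBit, tick, Stmt.LoopFree,
    emitGadget_loopFree]) ⟨_, _, hτ, fun i hi => acc_addGadget_ne_zero (fun _ => hacc i hi) _ _ _,
      fun k' hk' => ?_, fun k' hk' hle => ?_, hk⟩
  · rcases eq_or_ne k' k with rfl | hne
    · rw [Function.update_self]
      exact abs_add_neg_digit_mul_lt (htodo k' hks le_rfl)
    · rw [Function.update_of_ne hne]
      exact hdone k' (by omega)
  · rw [Function.update_of_ne (by omega)]
    exact htodo k' hk' (by omega)

/-- A bound for the number of steps of one level. -/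
def levelCost (m s : ℕ) : ℕ :=
  nextLevel.maxCost + loopCost m rowTest doubleRow +
    (reset.maxCost + loopCost s entTest addEntry)

theorem runs_level (h : Running σ d c ε M S q (L + 1) (2 * p) P r) (hp : 1 ≤ p)
    (hpM : (p : ℝ) ≤ M) (hP : ∀ i < d.m, P i = 2 * p) (hr : ∀ k < d.s, |r k| < 2 * p) :
    Runs level σ (levelCost d.m d.s) fun τ => ∃ S P r,
      Running τ d c ε M S (q + d.m + d.s) L p P r ∧ (∀ i < d.m, P i = p ∧ S.acc i ≠ 0) ∧
      ∀ k < d.s, |r k| < p := by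
  refine (runs_doubleRows h hp hpM hP).seq fun τ ⟨S, P, hτ, hPS⟩ =>
    (runs_addEntries hτ hpM (fun i hi => (hPS i hi).1) (fun i hi => (hPS i hi).2) hr).mono le_rfl
      fun τ ⟨S, r, hτ, hacc, hr⟩ => ⟨S, P, r, hτ, fun i hi => ⟨(hPS i hi).1, hacc i hi⟩, hr⟩

theorem levelTest_eval_iff (h : HoldsState σ d c ε S L p r) : levelTest.eval σ ↔ 0 < L := by
  simp [levelTest, BExpr.eval, IExpr.eval, reg, h.level]

theorem runs_levels (hL : 0 < L) (h : HoldsState σ d c ε (.initial d.n) L (2 ^ L) d.ent)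
    (hM : (2 : ℝ) ^ (L - 1) ≤ M) (hlt : ∀ k < d.s, |d.ent k| < 2 ^ L) :
    Runs (.loop levelTest level) σ
      (L * (levelCost d.m d.s + levelTest.cost) + levelTest.cost) fun τ => ∃ S P r,
        Running τ d c ε M S (L * (d.m + d.s)) 0 1 P r ∧
        Construction.Represents d M (S.eqns ++ Construction.finalEqns S.acc d.m) S.blocks := by
  let I (j : ℕ) (τ : State) : Prop := j ≤ L ∧ ∃ S P r,
    Running τ d c ε M S (j * (d.m + d.s)) (L - j) (2 ^ (L - j)) P r ∧
    (∀ i < d.m, P i = 2 ^ (L - j) ∧ (0 < j → S.acc i ≠ 0)) ∧ ∀ k < d.s, |r k| < 2 ^ (L - j)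
  have hinit : I 0 σ := ⟨L.zero_le, .initial d.n, fun _ => 2 ^ L, d.ent,
    ⟨by simpa using h, .initial M fun _ _ => one_le_pow₀ one_le_two, by simp [Construction.initial],
      by simp [Construction.initial]⟩, by simp, by simpa using hlt⟩
  refine (Runs.loop_count I (n := L) ?_ ?_ hinit).mono le_rfl ?_
  · rintro j τ ⟨_, S, P, r, hτ, _⟩
    rw [levelTest_eval_iff hτ.toHoldsState, Nat.sub_pos_iff_lt]
  · rintro j hj τ ⟨-, S, P, r, hτ, hP, hr⟩
    obtain ⟨n, rfl⟩ : ∃ n, L = j + n + 1 := ⟨L - j - 1, by omega⟩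
    rw [show j + n + 1 - j = n + 1 by omega, pow_succ'] at hτ hP hr
    have hnM : ((2 ^ n : ℤ) : ℝ) ≤ M := by
      push_cast
      exact (pow_le_pow_right₀ one_le_two (by omega)).trans hM
    refine (runs_level hτ (one_le_pow₀ one_le_two) hnM (fun i hi => (hP i hi).1) hr).mono le_rfl ?_
    rintro τ ⟨S, P, r, hτ, hPS, hr⟩
    have hsub : j + n + 1 - (j + 1) = n := by omega
    simp only [I, hsub, Nat.succ_mul, ← add_assoc]
    exact ⟨hj, S, P, r, hτ, fun i hi => ⟨(hPS i hi).1, fun _ => (hPS i hi).2⟩, hr⟩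
  · rintro τ ⟨-, S, P, r, hτ, hP, hr⟩
    simp only [Nat.sub_self, pow_zero] at hτ hP hr
    exact ⟨S, P, r, hτ, hτ.invariant.represents (fun i hi => (hP i hi).1)
      (fun k hk => Int.abs_lt_one_iff.1 (hr k hk)) (fun i hi => (hP i hi).2 hL)
      ((one_le_pow₀ one_le_two).trans hM)⟩

end MainLoop

/-! ### The weighted system -/

/-- The number of equations with tag `i`. -/
def tagCount (l : List Eqn) (i : ℕ) : ℕ := l.countP fun e => e.tag = i

/-- The equation `e` multiplied by `w`. -/
def Eqn.scale (e : Eqn) (w : ℝ) : Eqn := { e with mu := e.mu * w }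

/-- The system in which each equation is multiplied by the square root of the number of equations
with the same tag. -/
noncomputable def weighted (l : List Eqn) : List Eqn :=
  l.map fun e => e.scale √(tagCount l e.tag)

theorem tagCount_weighted (l : List Eqn) (i : ℕ) : tagCount (weighted l) i = tagCount l i := by
  rw [weighted, tagCount, List.countP_map]
  rfl

theorem Eqn.cols_scale (e : Eqn) (w : ℝ) :
    (e.scale w).cols = e.cols.map fun p => (p.1, p.2 * w) := by
  rcases e with ⟨k, i, j, mu, tag⟩
  cases k <;> simp [Eqn.scale, Eqn.cols, Kind.cols]

theorem entries_map_scale {W : Eqn → ℝ} {w : ℕ → ℝ} {l : List Eqn}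
    (hw : ∀ (r : ℕ) (hr : r < l.length), w r = W l[r]) :
    entries (l.map fun e => e.scale (W e)) =
      (entries l).map fun x => (x.1, x.2.1, x.2.2 * w x.1) := by
  induction l using List.reverseRecOn with
  | nil => simp [entries]
  | append_singleton l e ih =>
    have hlast := hw l.length (by simp)
    rw [List.getElem_concat_length rfl] at hlast
    rw [List.map_append, List.map_singleton, entries_concat, entries_concat, List.map_append,
      ih fun r hr => by rw [hw r (by simp; omega), List.getElem_append_left hr], Eqn.cols_scale]
    simp [hlast]

/-! ### Correctness of the end of the forward program -/

section Completion

variable {d : SparseMatrix} {c : ℕ → ℝ} {ε : ℝ} {σ : State} {S : Construction} {L : ℕ}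
  {r : ℕ → ℤ}

theorem HoldsState.run_finalRow (h : HoldsState σ d c ε S L 1 r) {i : ℕ} (hi : σ.int 8 10 = i)
    (him : i < d.m) :
    HoldsState (finalRow.run σ) d c ε
        { S with eqns := S.eqns ++ [⟨.fst, 0, S.acc i, 1, i⟩] } L 1 r ∧
      (finalRow.run σ).int 8 10 = (i + 1 : ℕ) := by
  obtain ⟨hst, ha, hb, hrow, hi⟩ := h.run_loadRow (x := 6) (by omega) (by omega) hi him
  rw [Nat.cast_ofNat] at hst ha hb hrow hi
  obtain ⟨hsys, hsame⟩ := run_emit hst.work.system .fst ha hb hrow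
    (hst.mult.trans Int.cast_one)
  have hregs := hsame.int 8 (by omega)
  refine ⟨HoldsState.setCounter ⟨?_, ⟨hsys, ?_, fun i hi => ?_⟩, ?_, ?_, fun k hk => ?_⟩ _, ?_⟩
  · exact hst.input.congr (fun a ha => hsame.int a (.inl ha)) fun a ha => hsame.real a (by omega)
  · rw [hregs, hst.work.blocks]
  · rw [hsame.int 9 (by omega), hst.work.acc i hi]
  · rw [hregs, hst.level]
  · rw [hsame.real 6 (by omega), hst.mult]
  · rw [hsame.real 7 (by omega), hst.rem k hk]
  · simp [finalRow, tick, Stmt.run, State.setInt_int, IExpr.eval, reg, hregs, hi]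

theorem runs_finalRows (h : HoldsState σ d c ε S L 1 r) :
    Runs finalRows σ (reset.maxCost + loopCost d.m rowTest finalRow) fun τ =>
      HoldsState τ d c ε { S with eqns := S.eqns ++ Construction.finalEqns S.acc d.m } L 1 r := by
  let I (i : ℕ) (τ : State) : Prop := HoldsState τ d c ε
    { S with eqns := S.eqns ++ Construction.finalEqns S.acc i } L 1 r ∧ τ.int 8 10 = i
  have hreset : Runs reset σ reset.maxCost (I 0) :=
    runs_reset ⟨by simpa [Construction.finalEqns] using h.setCounter 0, by simp [State.setInt_int]⟩
  refine hreset.seq fun τ hτ => (Runs.loop_count I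
    (fun i τ hτ => rowTest_eval_iff hτ.1.input hτ.2) ?_ hτ).mono le_rfl fun τ hτ => hτ.1
  rintro i him τ ⟨hst, hi⟩
  obtain ⟨hst, hi⟩ := hst.run_finalRow hi him
  refine Stmt.LoopFree.runs (by simp [finalRow, loadRow, tick, Stmt.LoopFree, emit_loopFree])
    ⟨?_, hi⟩
  rwa [Construction.finalEqns_succ, ← List.append_assoc]

/-- The value by which `weightEntry` multiplies the entries in row `r` of the output. -/
noncomputable def rowWeight (σ : State) (r : ℕ) : ℝ := √(σ.int 7 (σ.int 6 r))

theorem HoldsEntries.runs_weightEntries {E : List (ℕ × ℕ × ℝ)} (h : HoldsEntries σ E)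
    (hk : σ.int 8 10 = 0) :
    Runs (.loop outEntTest weightEntry) σ (loopCost E.length outEntTest weightEntry) fun τ =>
      HoldsEntries τ (E.map fun x => (x.1, x.2.1, x.2.2 * rowWeight σ x.1)) ∧
      (∀ a ≠ 8, τ.int a = σ.int a) ∧ ∀ a ≠ 3, τ.real a = σ.real a := by
  let I (k : ℕ) (τ : State) : Prop := τ.int 8 10 = k ∧ (∀ a ≠ 8, τ.int a = σ.int a) ∧
    (∀ a ≠ 3, τ.real a = σ.real a) ∧ ∀ (t : ℕ) (ht : t < E.length),
      τ.real 3 t = if t < k then E[t].2.2 * rowWeight σ E[t].1 else E[t].2.2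
  have hinit : I 0 σ := ⟨hk, fun _ _ => rfl, fun _ _ => rfl, fun t ht => (h.get t ht).2.2⟩
  refine (Runs.loop_count I ?_ ?_ hinit).mono le_rfl ?_
  · rintro k τ ⟨hk, hint, -⟩
    simp [outEntTest, BExpr.eval, IExpr.eval, reg, hk, hint 3, h.length]
  · rintro k hkE τ ⟨hk, hint, hreal, hval⟩
    refine Stmt.LoopFree.runs (by simp [weightEntry, tick, Stmt.LoopFree])
      ⟨?_, fun a ha => ?_, fun a ha => ?_, fun t ht => ?_⟩
    · simp [weightEntry, tick, Stmt.run, State.setInt_int, State.setReal_int, IExpr.eval, reg, hk]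
    · rw [← hint a ha, Stmt.run_int_of_notMem (by simpa [weightEntry, tick, Stmt.intWrites])]
    · rw [← hreal a ha, Stmt.run_real_of_notMem (by simpa [weightEntry, tick, Stmt.realWrites])]
    · have hk' := hval k hkE
      rw [if_neg (lt_irrefl k)] at hk'
      simp only [weightEntry, tick, Stmt.run, State.setInt_real, State.setReal_real, IExpr.eval,
        RExpr.eval, reg, hk, hint 4 (by simp), hint 6 (by simp), hint 7 (by simp), hk',
        (h.get k hkE).1, Nat.cast_inj, true_and]
      rcases lt_trichotomy t k with htk | rfl | htk
      · simp [htk.ne, htk, Nat.lt_succ_of_lt htk, hval t ht]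
      · simp [rowWeight]
      · simp [htk.ne', htk.not_gt, show ¬ t < k + 1 by omega, hval t ht]
  · rintro τ ⟨-, hint, hreal, hval⟩
    refine ⟨⟨by rw [hint 3 (by simp), h.length, List.length_map], fun t ht => ?_⟩, hint, hreal⟩
    rw [List.length_map] at ht
    obtain ⟨hrow, hcol, -⟩ := h.get t ht
    rw [List.getElem_map, hint 4 (by simp), hint 5 (by simp), hval t ht, if_pos ht]
    exact ⟨hrow, hcol, rfl⟩

/-- The memory holds the instance whose matrix is the system `weighted l` in `nb` blocks. Spreading
`c` over the equations with equal tags is the isometric embedding `fiberEmbedding`. -/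
structure Finished (c : ℕ → ℝ) (ε : ℝ) (σ : State) (l : List Eqn) (nb : ℕ) : Prop where
  length : σ.int 3 0 = l.length
  cols : σ.int 3 1 = (2 * nb : ℕ)
  entries : HoldsEntries σ (entries (weighted l))
  rhs : ∀ (r : ℕ) (hr : r < l.length), σ.real 4 r = c l[r].tag / √(tagCount l l[r].tag)
  eps : σ.real 5 0 = ε

/-- The memory holds the given instance, the matrix of the system `weighted l` in `nb` blocks, the
tags of the equations and the number of equations with each tag. -/
structure HoldsWeighted (σ : State) (d : SparseMatrix) (c : ℕ → ℝ) (ε : ℝ) (l : List Eqn)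
    (nb : ℕ) : Prop where
  input : HoldsInput σ d c ε
  length : σ.int 3 0 = l.length
  cols : σ.int 3 1 = (2 * nb : ℕ)
  entries : HoldsEntries σ (entries (weighted l))
  tag : ∀ (r : ℕ) (hr : r < l.length), σ.int 6 r = l[r].tag
  count : ∀ i < d.m, σ.int 7 (i : ℕ) = tagCount l i

theorem runs_weightEntries {l : List Eqn} {nb : ℕ} (hin : HoldsInput σ d c ε)
    (hsys : HoldsSystem σ d.m l) (hnb : σ.int 8 8 = nb) (htag : ∀ e ∈ l, e.tag < d.m) :
    Runs weightEntries σ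
      ((Stmt.setInt 3 (.const 1) (.mul (.const 2) (reg 8)) ;; reset).maxCost +
        loopCost (entries l).length outEntTest weightEntry) fun τ =>
      HoldsWeighted τ d c ε l nb := by
  set σ' := (Stmt.setInt 3 (.const 1) (.mul (.const 2) (reg 8)) ;; reset).run σ with hσ'
  have hint {a : ℕ} {x : ℤ} (h₃ : a = 3 → x ≠ 1) (h₈ : a ≠ 8) : σ'.int a x = σ.int a x := by
    simpa [hσ', reset, Stmt.run, State.setInt_int, IExpr.eval, h₈] using
      fun h h' => (h₃ h h').elim
  have hE : HoldsEntries σ' (entries l) := by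
    refine ⟨by rw [hint (by simp) (by simp), hsys.entries.length], fun t ht => ?_⟩
    rw [hint (by simp) (by simp), hint (by simp) (by simp)]
    exact hsys.entries.get t ht
  have hweight (r : ℕ) (hr : r < l.length) : rowWeight σ' r = √(tagCount l l[r].tag) := by
    rw [rowWeight, hint (by simp) (by simp), hint (by simp) (by simp), hsys.tag r hr,
      hsys.count _ (htag _ (List.getElem_mem hr)), tagCount, Int.cast_natCast]
  refine Runs.seq (Stmt.LoopFree.runs (by simp [reset, Stmt.LoopFree]) (rfl : _ = σ')) ?_
  rintro _ rfl
  refine (hE.runs_weightEntries ?_).mono le_rfl ?_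
  · simp [hσ', reset, Stmt.run, State.setInt_int, IExpr.eval]
  rintro τ ⟨hτE, hτint, hτreal⟩
  refine ⟨?_, ?_, ?_, ?_, fun r hr => ?_, fun i hi => ?_⟩
  · refine hin.congr (fun a ha => ?_) fun a ha => hτreal a (by omega)
    rw [hτint a (by omega)]
    exact funext fun x => hint (by omega) (by omega)
  · rw [hτint 3 (by simp), hint (by simp) (by simp), hsys.length]
  · rw [hτint 3 (by simp)]
    simp [hσ', reset, Stmt.run, State.setInt_int, IExpr.eval, reg, hnb]
  · rwa [weighted, entries_map_scale (W := fun e => √(tagCount l e.tag)) hweight]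
  · rw [hτint 6 (by simp), hint (by simp) (by simp), hsys.tag r hr]
  · rw [hτint 7 (by simp), hint (by simp) (by simp), hsys.count i hi, tagCount]

theorem HoldsWeighted.runs_writeRhs {l : List Eqn} {nb : ℕ} (h : HoldsWeighted σ d c ε l nb)
    (htag : ∀ e ∈ l, e.tag < d.m) :
    Runs (reset ;; .loop outRowTest writeRhs) σ
      (reset.maxCost + loopCost l.length outRowTest writeRhs) fun τ =>
        (∀ a ≠ 8, τ.int a = σ.int a) ∧ (∀ a ≠ 4, τ.real a = σ.real a) ∧
        ∀ (r : ℕ) (hr : r < l.length), τ.real 4 r = c l[r].tag / √(tagCount l l[r].tag) := by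
  let I (k : ℕ) (τ : State) : Prop := τ.int 8 10 = k ∧ (∀ a ≠ 8, τ.int a = σ.int a) ∧
    (∀ a ≠ 4, τ.real a = σ.real a) ∧ ∀ (r : ℕ) (hr : r < l.length), r < k →
      τ.real 4 r = c l[r].tag / √(tagCount l l[r].tag)
  have hreset : Runs reset σ reset.maxCost (I 0) := runs_reset
    ⟨by simp [State.setInt_int], fun a ha => by ext; simp [State.setInt_int, ha],
      fun _ _ => rfl, by simp⟩
  refine hreset.seq fun τ hτ => (Runs.loop_count I ?_ ?_ hτ).mono le_rfl
    fun τ ⟨_, hint, hreal, hrhs⟩ => ⟨hint, hreal, fun r hr => hrhs r hr hr⟩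
  · rintro k τ ⟨hk, hint, -⟩
    simp [outRowTest, BExpr.eval, IExpr.eval, reg, hk, hint 3, h.length]
  · rintro k hkl τ ⟨hk, hint, hreal, hrhs⟩
    refine Stmt.LoopFree.runs (by simp [writeRhs, tick, Stmt.LoopFree])
      ⟨?_, fun a ha => ?_, fun a ha => ?_, fun r hr hrk => ?_⟩
    · simp [writeRhs, tick, Stmt.run, State.setInt_int, State.setReal_int, IExpr.eval, reg, hk]
    · rw [← hint a ha, Stmt.run_int_of_notMem (by simpa [writeRhs, tick, Stmt.intWrites])]
    · rw [← hreal a ha, Stmt.run_real_of_notMem (by simpa [writeRhs, tick, Stmt.realWrites])]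
    · have htag' := htag _ (List.getElem_mem hkl)
      simp only [writeRhs, tick, Stmt.run, State.setInt_real, State.setReal_real, IExpr.eval,
        RExpr.eval, reg, hk, hint 6 (by simp), hint 7 (by simp), hreal 1 (by simp), h.tag k hkl,
        h.count _ htag', h.input.rhs _ htag', Nat.cast_inj, true_and, Int.cast_natCast]
      rcases eq_or_ne r k with rfl | hrk'
      · simp
      · simpa [hrk'] using hrhs r hr (by omega)

theorem HoldsWeighted.runs_writeRhsAll {l : List Eqn} {nb : ℕ} (h : HoldsWeighted σ d c ε l nb)
    (htag : ∀ e ∈ l, e.tag < d.m) :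
    Runs writeRhsAll σ (reset.maxCost + loopCost l.length outRowTest writeRhs +
      (Stmt.setReal 5 (.const 0) (.get 2 (.const 0))).maxCost) fun τ => Finished c ε τ l nb := by
  refine (h.runs_writeRhs htag).seq fun τ ⟨hint, hreal, hrhs⟩ =>
    Stmt.LoopFree.runs (by simp [Stmt.LoopFree]) ⟨?_, ?_, ⟨?_, fun t ht => ?_⟩, fun r hr => ?_, ?_⟩
  · simpa [Stmt.run, State.setReal_int, hint 3] using h.length
  · simpa [Stmt.run, State.setReal_int, hint 3] using h.cols
  · simpa [Stmt.run, State.setReal_int, hint 3] using h.entries.length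
  · simpa [Stmt.run, State.setReal_int, State.setReal_real, hint 4, hint 5, hreal 3] using
      h.entries.get t ht
  · simpa [Stmt.run, State.setReal_real] using hrhs r hr
  · simpa [Stmt.run, State.setReal_real, IExpr.eval, RExpr.eval, hreal 2] using h.input.eps

end Completion

/-! ### Running time of the forward program -/

theorem length_cols (e : Eqn) : 2 ≤ e.cols.length ∧ e.cols.length ≤ 4 := by
  rcases e with ⟨k, i, j, mu, tag⟩
  cases k <;> simp [Eqn.cols, Kind.cols]

theorem length_entries (l : List Eqn) :
    2 * l.length ≤ (entries l).length ∧ (entries l).length ≤ 4 * l.length := by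
  induction l using List.reverseRecOn with
  | nil => simp [entries]
  | append_singleton l e ih =>
    have := length_cols e
    rw [entries_concat]
    simp only [List.length_append, List.length_map, List.length_singleton]
    omega

theorem mul_loopCost_le {k n a N : ℕ} (hn : k * n ≤ a * N) (hk : k ≤ N) (b : BExpr) (p : Stmt) :
    k * loopCost n b p ≤ loopCost a b p * N := by
  have h₁ := Nat.mul_le_mul_right (p.maxCost + b.cost) hn
  have h₂ := Nat.mul_le_mul_right b.cost hk
  unfold loopCost
  linarith

theorem loopCost_le_mul {n a N : ℕ} (hn : n ≤ a * N) (hN : 0 < N) (b : BExpr) (p : Stmt) :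
    loopCost n b p ≤ loopCost a b p * N := by
  simpa using mul_loopCost_le (k := 1) (by simpa using hn) hN b p

theorem exists_runs_prepare : ∃ K : ℕ, ∀ {d : SparseMatrix} {c : ℕ → ℝ} {ε : ℝ} {σ : State}
    {Z : ℕ}, HoldsInput σ d c ε → d.m ≤ d.s → 0 < d.s → (∀ k < d.s, (d.ent k).natAbs ≤ Z) →
    Runs (initRows ;; copyEntries ;; scale) σ (K * (d.s * (Nat.log 2 Z + 1))) fun τ =>
      ∃ L ≤ Nat.log 2 Z + 1, HoldsState τ d c ε (.initial d.n) L (2 ^ L) d.ent ∧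
        ∀ k < d.s, |d.ent k| < 2 ^ L := by
  refine ⟨initRegs.maxCost + loopCost 1 rowTest initRow + (reset.maxCost +
    loopCost 1 entTest copyEntry + (reset.maxCost + loopCost 2 entTest scaleStep)),
    fun {d c ε σ Z} hin hms hs hZ => ?_⟩
  set N := d.s * (Nat.log 2 Z + 1)
  have hsN : d.s ≤ N := Nat.le_mul_of_pos_right _ (by omega)
  have hlogN : Nat.log 2 Z + 1 ≤ N := Nat.le_mul_of_pos_left _ hs
  have hN : 0 < N := hs.trans_le hsN
  refine Runs.mono ((runs_initRows hin).seq fun τ ⟨hin, hwork, hlevel, hmult⟩ =>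
    (runs_copyEntries hin hwork hlevel hmult).seq fun τ hτ => runs_scale hZ hτ) ?_ fun _ hτ => hτ
  have h₁ := loopCost_le_mul (a := 1) (show d.m ≤ 1 * N by omega) hN rowTest initRow
  have h₂ := loopCost_le_mul (a := 1) (show d.s ≤ 1 * N by omega) hN entTest copyEntry
  have h₃ := loopCost_le_mul (a := 2) (show d.s + (Nat.log 2 Z + 1) ≤ 2 * N by omega) hN
    entTest scaleStep
  have h₄ := Nat.le_mul_of_pos_right initRegs.maxCost hN
  have h₅ := Nat.le_mul_of_pos_right reset.maxCost hN
  linarith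

theorem mul_levelCost_add_le {k m s N : ℕ} (hm : k * m ≤ N) (hs : k * s ≤ N) (hk : k ≤ N)
    (hN : 0 < N) : k * (levelCost m s + levelTest.cost) + levelTest.cost ≤
      (levelCost 1 1 + 2 * levelTest.cost) * N := by
  have h₁ := mul_loopCost_le (a := 1) (by simpa using hm) hk rowTest doubleRow
  have h₂ := mul_loopCost_le (a := 1) (by simpa using hs) hk entTest addEntry
  have h₃ := Nat.mul_le_mul_right nextLevel.maxCost hk
  have h₄ := Nat.mul_le_mul_right reset.maxCost hk
  have h₅ := Nat.mul_le_mul_right levelTest.cost hk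
  have h₆ := Nat.le_mul_of_pos_right levelTest.cost hN
  unfold levelCost
  linarith

theorem exists_runs_finish : ∃ K : ℕ, ∀ {d : SparseMatrix} {c : ℕ → ℝ} {ε : ℝ} {σ : State}
    {S : Construction} {r : ℕ → ℤ} {N : ℕ}, HoldsState σ d c ε S 0 1 r →
    (∀ e ∈ S.eqns ++ Construction.finalEqns S.acc d.m, e.tag < d.m) → 0 < N → d.m ≤ N →
    (S.eqns ++ Construction.finalEqns S.acc d.m).length ≤ 15 * N →
    Runs (finalRows ;; weightEntries ;; writeRhsAll) σ (K * N) fun τ =>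
      Finished c ε τ (S.eqns ++ Construction.finalEqns S.acc d.m) S.blocks := by
  refine ⟨reset.maxCost + loopCost 1 rowTest finalRow + ((Stmt.setInt 3 (.const 1) (.mul (.const 2)
    (reg 8)) ;; reset).maxCost + loopCost 60 outEntTest weightEntry + (reset.maxCost +
    loopCost 15 outRowTest writeRhs + (Stmt.setReal 5 (.const 0) (.get 2 (.const 0))).maxCost)),
    fun {d c ε σ S r N} h htag hN hmN hlen => ?_⟩
  set l := S.eqns ++ Construction.finalEqns S.acc d.m
  refine Runs.mono ((runs_finalRows h).seq fun τ hτ =>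
    (runs_weightEntries hτ.input hτ.work.system hτ.work.blocks htag).seq fun τ hτ =>
      hτ.runs_writeRhsAll htag) ?_ fun _ hτ => hτ
  have hent := (length_entries l).2
  have h₁ := loopCost_le_mul (a := 1) (show d.m ≤ 1 * N by omega) hN rowTest finalRow
  have h₂ := loopCost_le_mul (a := 60) (show (entries l).length ≤ 60 * N by omega) hN
    outEntTest weightEntry
  have h₃ := loopCost_le_mul hlen hN outRowTest writeRhs
  have h₄ := Nat.le_mul_of_pos_right reset.maxCost hN
  have h₅ := Nat.le_mul_of_pos_right (Stmt.setReal 5 (.const 0) (.get 2 (.const 0))).maxCost hN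
  have h₆ := Nat.le_mul_of_pos_right
    (Stmt.setInt 3 (.const 1) (.mul (.const 2) (reg 8)) ;; reset).maxCost hN
  linarith

theorem exists_runs_forward : ∃ K : ℕ, ∀ {d : SparseMatrix} {c : ℕ → ℝ} {ε : ℝ} {σ : State}
    {Z : ℕ}, HoldsInput σ d c ε → d.m ≤ d.s → d.n ≤ d.s → (∀ k < d.s, (d.ent k).natAbs ≤ Z) →
    (∃ k < d.s, d.ent k ≠ 0) →
    Runs forward σ (K * (d.s * (Nat.log 2 Z + 1))) fun τ => ∃ (l : List Eqn) (nb : ℕ),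
      Finished c ε τ l nb ∧ Construction.Represents d Z l nb ∧
      d.n ≤ nb ∧ nb ≤ l.length ∧ l.length ≤ 15 * (d.s * (Nat.log 2 Z + 1)) := by
  obtain ⟨K₁, hprepare⟩ := exists_runs_prepare
  obtain ⟨K₂, hfinish⟩ := exists_runs_finish
  refine ⟨K₁ + (levelCost 1 1 + 2 * levelTest.cost + K₂), fun {d c ε σ Z} hin hms hns hZ hne => ?_⟩
  obtain ⟨k₀, hk₀, hent⟩ := hne
  have hs : 0 < d.s := by omega
  have hZ₀ : Z ≠ 0 := by have := hZ k₀ hk₀; omega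
  set N := d.s * (Nat.log 2 Z + 1) with hN
  rw [add_mul, add_mul]
  refine (hprepare hin hms hs hZ).seq ?_
  rintro τ ⟨L, hL, hτ, hlt⟩
  have hL₀ : 0 < L := Nat.pos_of_ne_zero fun hL => hent <| by
    simpa [hL] using hlt k₀ hk₀
  have hpow : (2 : ℝ) ^ (L - 1) ≤ Z := by
    exact_mod_cast (Nat.pow_le_pow_right two_pos (show L - 1 ≤ Nat.log 2 Z by omega)).trans
      (Nat.pow_log_le_self 2 hZ₀)
  have hLs : L * d.s ≤ N := by rw [hN, mul_comm]; exact Nat.mul_le_mul_left _ hL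
  have hLm : L * d.m ≤ N := (Nat.mul_le_mul_left _ hms).trans hLs
  have hsL : d.s ≤ L * d.s := Nat.le_mul_of_pos_left _ hL₀
  have hLN : L ≤ N := (Nat.le_mul_of_pos_right _ hs).trans hLs
  refine ((runs_levels hL₀ hτ hpow hlt).mono (mul_levelCost_add_le hLm hLs hLN (by omega))
    fun _ hτ => hτ).seq ?_
  rintro τ ⟨S, P, r, hτ, hrep⟩
  set q := L * (d.m + d.s) with hq
  rw [mul_add] at hq
  have hlen : (S.eqns ++ Construction.finalEqns S.acc d.m).length = 7 * q + d.m := by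
    rw [List.length_append, hτ.length, Construction.length_finalEqns]
  refine (hfinish hτ.toHoldsState (fun e he => (hrep.wellFormed e he).tag_lt) (by omega) (by omega)
    (by omega)).mono le_rfl fun τ' hτ' => ⟨_, _, hτ', hrep, ?_⟩
  have hblocks := hτ.blocks
  omega

/-! ### The matrix of a system -/

/-- The coefficient of the variable `q` in an equation, without the multiplier. -/
noncomputable def Eqn.coef (e : Eqn) (q : ℕ) : ℝ :=
  (if q / 2 = e.i then ![e.kind.c₀, e.kind.c₁] (Fin.ofNat 2 q) else 0) -
    (if q / 2 = e.j then ![e.kind.c₀, e.kind.c₁] (Fin.ofNat 2 q) else 0)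

/-- The matrix of a system in `nb` blocks, multipliers included. -/
noncomputable def sysMatrix (l : List Eqn) (nb : ℕ) : Matrix (Fin l.length) (Fin (2 * nb)) ℝ :=
  fun r q => l[r].mu * l[r].coef q

namespace Eqn

variable {e : Eqn}

theorem coef_two_mul (e : Eqn) (b : ℕ) :
    e.coef (2 * b) = (if b = e.i then e.kind.c₀ else 0) - if b = e.j then e.kind.c₀ else 0 := by
  have hmod : Fin.ofNat 2 (2 * b) = 0 := Fin.ext (by simp)
  rw [coef, hmod, Nat.mul_div_cancel_left b two_pos]
  rfl

theorem coef_two_mul_add_one (e : Eqn) (b : ℕ) :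
    e.coef (2 * b + 1) = (if b = e.i then e.kind.c₁ else 0) - if b = e.j then e.kind.c₁ else 0 := by
  have hmod : Fin.ofNat 2 (2 * b + 1) = 1 := Fin.ext (by simp)
  rw [coef, hmod, show (2 * b + 1) / 2 = b by omega]
  rfl

theorem abs_coef_of_ne_zero (hij : e.i ≠ e.j) {q : ℕ} (hq : e.coef q ≠ 0) : |e.coef q| = 1 := by
  rcases e with ⟨k, i, j, mu, t⟩
  obtain ⟨b, rfl | rfl⟩ := Nat.even_or_odd' q
  all_goals
    simp only [coef_two_mul, coef_two_mul_add_one] at hq hij ⊢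
    cases k <;> simp only [Kind.c₀, Kind.c₁] at hq ⊢ <;> split_ifs at hq ⊢ <;> simp_all

theorem lt_of_coef_ne_zero {nb : ℕ} (hi : e.i < nb) (hj : e.j < nb) {q : ℕ} (hq : e.coef q ≠ 0) :
    q < 2 * nb := by
  by_contra! hlt
  refine hq ?_
  rw [coef, if_neg (by omega), if_neg (by omega), sub_zero]

theorem mem_cols_iff (hij : e.i ≠ e.j) (hmu : e.mu ≠ 0) {q : ℕ} {w : ℝ} :
    (q, w) ∈ e.cols ↔ e.mu * e.coef q = w ∧ w ≠ 0 := by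
  rcases e with ⟨k, i, j, mu, t⟩
  simp only at hij hmu
  obtain ⟨b, rfl | rfl⟩ := Nat.even_or_odd' q
  all_goals
    simp only [coef_two_mul, coef_two_mul_add_one]
    cases k <;> simp only [cols, Kind.cols, Kind.c₀, Kind.c₁] <;> split_ifs <;> simp <;> grind

theorem pairwise_cols (hij : e.i ≠ e.j) : e.cols.Pairwise (· ≠ ·) := by
  rcases e with ⟨k, i, j, mu, t⟩
  simp only at hij
  cases k <;> simp [cols, Kind.cols] <;> omega

end Eqn

theorem sum_range_two_mul {M : Type*} [AddCommMonoid M] (f : ℕ → M) (n : ℕ) :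
    ∑ q ∈ Finset.range (2 * n), f q = ∑ b ∈ Finset.range n, (f (2 * b) + f (2 * b + 1)) := by
  induction n with
  | zero => simp
  | succ n ih =>
    rw [mul_add, mul_one, Finset.sum_range_succ, Finset.sum_range_succ, ih, Finset.sum_range_succ,
      add_assoc]

theorem Eqn.sum_coef_mul {e : Eqn} {nb : ℕ} (hi : e.i < nb) (hj : e.j < nb) (z : ℕ → ℝ) :
    ∑ q : Fin (2 * nb), e.coef q * z q = e.resid z := by
  have hblock (b : ℕ) :
      e.coef (2 * b) * z (2 * b) + e.coef (2 * b + 1) * z (2 * b + 1) =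
        (if b = e.i then e.kind.c₀ * z (2 * b) + e.kind.c₁ * z (2 * b + 1) else 0) -
          if b = e.j then e.kind.c₀ * z (2 * b) + e.kind.c₁ * z (2 * b + 1) else 0 := by
    rw [coef_two_mul, coef_two_mul_add_one]
    split_ifs <;> ring
  rw [Fin.sum_univ_eq_sum_range (fun q => e.coef q * z q), sum_range_two_mul]
  simp only [hblock, Finset.sum_sub_distrib, Finset.sum_ite_eq', Finset.mem_range, hi, hj, if_true,
    Eqn.resid]
  ring

section System

variable {m nb : ℕ} {M : ℝ} {l : List Eqn}

theorem sysMatrix_mem_twoCommodity (hl : ∀ e ∈ l, e.WellFormed m nb M) :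
    sysMatrix l nb ∈ twoCommodity l.length (2 * nb) := by
  refine ⟨nb, rfl, fun r => ?_⟩
  have hr := hl _ (List.getElem_mem r.2)
  refine ⟨l[r].i, l[r].j, l[r].mu, l[r].mu • ![l[r].kind.c₀, l[r].kind.c₁], hr.i_lt, hr.j_lt,
    hr.ne, ?_, fun q => ?_⟩
  · cases l[r].kind
    exacts [.inl rfl, .inr (.inl rfl), .inr (.inr rfl)]
  · simp only [sysMatrix, Eqn.coef, Pi.smul_apply, smul_eq_mul, mul_sub, mul_ite, mul_zero]

theorem abs_sysMatrix_of_ne_zero (hl : ∀ e ∈ l, e.WellFormed m nb M) {r : Fin l.length}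
    {q : Fin (2 * nb)} (hrq : sysMatrix l nb r q ≠ 0) : |sysMatrix l nb r q| = l[r].mu := by
  have hr : l[r].WellFormed m nb M := hl _ (List.getElem_mem r.2)
  rw [sysMatrix, abs_mul, Eqn.abs_coef_of_ne_zero hr.ne (right_ne_zero_of_mul hrq), mul_one]
  exact abs_of_nonneg hr.mu_nonneg

theorem mem_entries_iff {r q : ℕ} {w : ℝ} :
    (r, q, w) ∈ entries l ↔ ∃ h : r < l.length, (q, w) ∈ l[r].cols := by
  simp only [entries, List.mem_flatMap, List.mem_map, Prod.exists, Prod.mk.injEq,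
    List.mk_mem_zipIdx_iff_getElem?]
  constructor
  · rintro ⟨e, r', he, q', w', hc, rfl, rfl, rfl⟩
    obtain ⟨h, rfl⟩ := List.getElem?_eq_some_iff.1 he
    exact ⟨h, hc⟩
  · rintro ⟨h, hc⟩
    exact ⟨l[r], r, List.getElem?_eq_getElem h, q, w, hc, rfl, rfl, rfl⟩

theorem pairwise_entries (hl : ∀ e ∈ l, e.WellFormed m nb M) :
    (entries l).Pairwise fun x y => x.1 ≤ y.1 ∧ x ≠ y := by
  induction l using List.reverseRecOn with
  | nil => simp [entries]
  | append_singleton l e ih =>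
    have he := hl e (by simp)
    rw [entries_concat, List.pairwise_append, List.pairwise_map]
    refine ⟨ih fun e he => hl e (by simp [he]), ?_, ?_⟩
    · exact (Eqn.pairwise_cols he.ne).imp fun hxy => ⟨le_rfl, fun h => hxy (Prod.mk.inj h).2⟩
    · rintro ⟨r, q, w⟩ hx y hy
      obtain ⟨hr, -⟩ := mem_entries_iff.1 hx
      obtain ⟨p, -, rfl⟩ := List.mem_map.1 hy
      exact ⟨hr.le, fun h => hr.ne (Prod.mk.inj h).1⟩

/-- The list `E` of triples (row, column, value) enumerates the non-zero entries of `A`, without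
repetition and sorted by rows. -/
structure Enumerates (E : List (ℕ × ℕ × ℝ)) {m n : ℕ} (A : Matrix (Fin m) (Fin n) ℝ) : Prop where
  pairwise : E.Pairwise fun x y => x.1 ≤ y.1 ∧ x ≠ y
  mem_iff : ∀ r q w, (r, q, w) ∈ E ↔
    ∃ (hr : r < m) (hq : q < n), A ⟨r, hr⟩ ⟨q, hq⟩ = w ∧ w ≠ 0

namespace Enumerates

variable {E : List (ℕ × ℕ × ℝ)} {m n : ℕ} {A : Matrix (Fin m) (Fin n) ℝ}

theorem exists_equiv (h : Enumerates E A) :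
    ∃ e : Fin E.length ≃ {p : Fin m × Fin n // A p.1 p.2 ≠ 0},
      ∀ k : Fin E.length, E[k] = (((e k).1.1 : ℕ), ((e k).1.2 : ℕ), A (e k).1.1 (e k).1.2) := by
  classical
  let triple (p : {p : Fin m × Fin n // A p.1 p.2 ≠ 0}) : {x // x ∈ E} :=
    ⟨((p.1.1 : ℕ), (p.1.2 : ℕ), A p.1.1 p.1.2), (h.mem_iff _ _ _).2 ⟨p.1.1.2, p.1.2.2, rfl, p.2⟩⟩
  have hbij : Function.Bijective triple := by
    constructor
    · intro p p' hp
      simp only [triple, Subtype.mk.injEq, Prod.mk.injEq] at hp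
      exact Subtype.ext (Prod.ext (Fin.ext hp.1) (Fin.ext hp.2.1))
    · rintro ⟨⟨r, q, w⟩, hx⟩
      obtain ⟨hr, hq, rfl, hw⟩ := (h.mem_iff r q w).1 hx
      exact ⟨⟨(⟨r, hr⟩, ⟨q, hq⟩), hw⟩, rfl⟩
  let f := List.Nodup.getEquiv E (h.pairwise.imp And.right)
  refine ⟨f.trans (Equiv.ofBijective triple hbij).symm, fun k => ?_⟩
  exact (congrArg Subtype.val ((Equiv.ofBijective triple hbij).apply_symm_apply (f k))).symm

theorem nnz_eq (h : Enumerates E A) : nnz A = E.length := by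
  obtain ⟨e, -⟩ := h.exists_equiv
  rw [nnz, ← Nat.card_congr e, Nat.card_fin]

theorem encodesMatrix (h : Enumerates E A) {σ : State} (hσ : HoldsEntries σ E)
    (hm : σ.int 3 0 = m) (hn : σ.int 3 1 = n) : EncodesMatrix σ 3 A := by
  obtain ⟨e, he⟩ := h.exists_equiv
  refine ⟨hm, hn, by rw [hσ.length, h.nnz_eq], (finCongr h.nnz_eq).trans e, ?_, fun k => ?_⟩
  · intro a b hab
    rcases hab.eq_or_lt with rfl | hlt
    · exact le_rfl
    · have hle := (List.pairwise_iff_get.1 h.pairwise (finCongr h.nnz_eq a)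
        (finCongr h.nnz_eq b) hlt).1
      simp only [List.get_eq_getElem, ← Fin.getElem_fin, he] at hle
      exact hle
  · have hk := k.2.trans_eq h.nnz_eq
    have hget := hσ.get k hk
    rwa [show E[(k : ℕ)] = _ from he (finCongr h.nnz_eq k)] at hget

end Enumerates

theorem enumerates_entries (hl : ∀ e ∈ l, e.WellFormed m nb M) :
    Enumerates (entries l) (sysMatrix l nb) where
  pairwise := pairwise_entries hl
  mem_iff r q w := by
    rw [mem_entries_iff]
    refine exists_congr fun hr => ?_
    have he := hl _ (List.getElem_mem hr)
    rw [Eqn.mem_cols_iff he.ne (by linarith [he.one_le_mu])]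
    refine ⟨fun h => ⟨?_, h⟩, fun ⟨_, h⟩ => h⟩
    exact Eqn.lt_of_coef_ne_zero he.i_lt he.j_lt (right_ne_zero_of_mul (h.1 ▸ h.2))

theorem length_weighted (l : List Eqn) : (weighted l).length = l.length := List.length_map _

/-- The equation of `l` from which equation `r` of `weighted l` arises. -/
noncomputable def baseEqn (l : List Eqn) (r : Fin (weighted l).length) : Eqn :=
  l[r]'(length_weighted l ▸ r.2)

theorem baseEqn_mem (r : Fin (weighted l).length) : baseEqn l r ∈ l := List.getElem_mem _

theorem getElem_weighted (r : Fin (weighted l).length) :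
    (weighted l)[r] = (baseEqn l r).scale √(tagCount l (baseEqn l r).tag) :=
  List.getElem_map _

theorem resid_getElem_weighted (r : Fin (weighted l).length) (z : ℕ → ℝ) :
    (weighted l)[r].resid z = (baseEqn l r).resid z := by
  rw [getElem_weighted]
  rfl

theorem tagCount_pos {e : Eqn} (he : e ∈ l) : 0 < tagCount l e.tag :=
  List.countP_pos_iff.2 ⟨e, he, by simp⟩

theorem wellFormed_of_mem_weighted (hl : ∀ e ∈ l, e.WellFormed m nb M) {e : Eqn}
    (he : e ∈ weighted l) : e.WellFormed m nb (M * √l.length) := by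
  obtain ⟨e, hel, rfl⟩ := List.mem_map.1 he
  have h := hl e hel
  have hcount : (1 : ℝ) ≤ tagCount l e.tag := by exact_mod_cast tagCount_pos hel
  have hlength : (tagCount l e.tag : ℝ) ≤ l.length := by exact_mod_cast List.countP_le_length
  refine ⟨h.ne, h.i_lt, h.j_lt, ?_, ?_, h.tag_lt⟩
  · exact one_le_mul_of_one_le_of_one_le h.one_le_mu (Real.one_le_sqrt.2 hcount)
  · exact mul_le_mul h.mu_le (Real.sqrt_le_sqrt hlength) (by positivity)
      (h.mu_nonneg.trans h.mu_le)

/-! ### The lift of a system -/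

/-- The vector `x`, followed by zeros. -/
noncomputable def zeroExtend {n : ℕ} (x : EuclideanSpace ℝ (Fin n)) : ℕ → ℝ :=
  Function.extend Fin.val x.ofLp 0

theorem zeroExtend_apply {n : ℕ} (x : EuclideanSpace ℝ (Fin n)) (q : Fin n) :
    zeroExtend x q = x q :=
  Fin.val_injective.extend_apply _ _ q

theorem norm_le_of_abs_le {n : ℕ} {x : EuclideanSpace ℝ (Fin n)} {G : ℝ} (hG : 0 ≤ G)
    (h : ∀ i, |x i| ≤ G) : ‖x‖ ≤ √n * G := by
  rw [EuclideanSpace.norm_eq]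
  refine Real.sqrt_le_iff.2 ⟨by positivity, ?_⟩
  calc ∑ i, ‖x i‖ ^ 2 ≤ ∑ _i : Fin n, G ^ 2 :=
        Finset.sum_le_sum fun i _ => pow_le_pow_left₀ (norm_nonneg _) (h i) 2
    _ = (√n * G) ^ 2 := by simp [mul_pow]

/-- The first variables of the first `n` blocks. -/
noncomputable def restrictVars {N : ℕ} (n : ℕ) (z : EuclideanSpace ℝ (Fin N)) :
    EuclideanSpace ℝ (Fin n) :=
  WithLp.toLp 2 fun j => firstVars (zeroExtend z) j

theorem toEuclideanLin_sysMatrix_apply (hl : ∀ e ∈ l, e.WellFormed m nb M)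
    (z : EuclideanSpace ℝ (Fin (2 * nb))) (r : Fin l.length) :
    Matrix.toEuclideanLin (sysMatrix l nb) z r = l[r].mu * l[r].resid (zeroExtend z) := by
  have hr : l[r].WellFormed m nb M := hl _ (List.getElem_mem r.2)
  rw [toEuclideanLin_apply_coord, ← Eqn.sum_coef_mul hr.i_lt hr.j_lt, Finset.mul_sum]
  refine Finset.sum_congr rfl fun q _ => ?_
  rw [zeroExtend_apply, sysMatrix, mul_assoc]

/-- The map from the equations of a system to their tags, which are below `m`. -/
def tagMap (h : ∀ e ∈ l, e.tag < m) (r : Fin l.length) : Fin m :=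
  ⟨l[r].tag, h _ (List.getElem_mem r.2)⟩

theorem tagMap_surjective (h : ∀ e ∈ l, e.tag < m) (hex : ∀ i < m, ∃ e ∈ l, e.tag = i) :
    Function.Surjective (tagMap h) := fun i => by
  obtain ⟨e, he, hei⟩ := hex i i.2
  obtain ⟨r, hr, rfl⟩ := List.getElem_of_mem he
  exact ⟨⟨r, hr⟩, Fin.ext hei⟩

theorem card_tagMap_fiber (h : ∀ e ∈ l, e.tag < m) (i : Fin m) :
    Finset.card {r | tagMap h r = i} = tagCount l i := by
  have hsum : (l.map fun e => if e.tag = (i : ℕ) then 1 else 0).sum = tagCount l i := by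
    clear h
    unfold tagCount
    induction l with
    | nil => rfl
    | cons e l ih => simp [ih, List.countP_cons, add_comm]
  rw [Finset.card_filter, ← hsum, ← Fin.sum_univ_fun_getElem]
  simp [tagMap, Fin.ext_iff]

/-- The equations of `l`, with the residuals for which the left-hand sides of `weighted l` are
`b`. -/
noncomputable def prescribed (l : List Eqn) (b : EuclideanSpace ℝ (Fin (weighted l).length)) :
    List (Eqn × ℝ) :=
  List.ofFn fun r => (baseEqn l r, b r / (weighted l)[r].mu)

section Prescribed

variable {b : EuclideanSpace ℝ (Fin (weighted l).length)}

theorem prescribed_map_fst : (prescribed l b).map Prod.fst = l := by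
  refine List.ext_getElem (by simp [prescribed, length_weighted]) fun r _ _ => ?_
  simp [prescribed, baseEqn]

theorem prescribed_abs (hl : ∀ e ∈ l, e.WellFormed m nb M) :
    (prescribed l b).map (fun p => (p.1, |p.2|)) = prescribed l (WithLp.toLp 2 fun r => |b r|) := by
  rw [prescribed, List.map_ofFn]
  refine congrArg List.ofFn (funext fun r => ?_)
  have hr := wellFormed_of_mem_weighted hl (List.getElem_mem r.2)
  simp [abs_div, abs_of_nonneg hr.mu_nonneg]

theorem withResid_eq_prescribed (hl : ∀ e ∈ l, e.WellFormed m nb M)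
    (z : EuclideanSpace ℝ (Fin (2 * nb))) :
    withResid l (zeroExtend z) =
      prescribed l (Matrix.toEuclideanLin (sysMatrix (weighted l) nb) z) := by
  refine List.ext_getElem (by simp [prescribed, withResid, length_weighted]) fun r h₁ h₂ => ?_
  have hr : r < (weighted l).length := by simpa [prescribed] using h₂
  have hpos : 1 ≤ (weighted l)[(⟨r, hr⟩ : Fin _)].mu :=
    (wellFormed_of_mem_weighted hl (List.getElem_mem hr)).one_le_mu
  have hbase : l[r]'(length_weighted l ▸ hr) = baseEqn l ⟨r, hr⟩ := rfl
  simp only [withResid, prescribed, List.getElem_map, List.getElem_ofFn, hbase]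
  rw [toEuclideanLin_sysMatrix_apply fun _ => wellFormed_of_mem_weighted hl,
    mul_div_cancel_left₀ _ (by positivity), resid_getElem_weighted]

theorem tagSum_prescribed (hl : ∀ e ∈ l, e.WellFormed m nb M)
    (htag : ∀ e ∈ weighted l, e.tag < m) (hsurj : Function.Surjective (tagMap htag)) (i : Fin m) :
    tagSum (prescribed l b) i = ContinuousLinearMap.adjoint
      (fiberEmbedding (tagMap htag) hsurj).toContinuousLinearMap b i := by
  rw [adjoint_fiberEmbedding_apply, card_tagMap_fiber, tagCount_weighted, tagSum, prescribed,
    List.map_ofFn, List.sum_ofFn, Finset.sum_filter]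
  refine Finset.sum_congr rfl fun r _ => ?_
  simp only [Function.comp_apply, tagMap, Fin.ext_iff, getElem_weighted, Eqn.scale]
  refine if_ctx_congr Iff.rfl (fun hi => ?_) fun _ => rfl
  have hmu := (hl _ (baseEqn_mem r)).one_le_mu
  rw [← mul_div_assoc, mul_div_mul_left _ _ (by positivity), hi]

end Prescribed

variable {d : SparseMatrix}

namespace Construction.Represents

theorem tag_lt (h : Construction.Represents d M l nb) : ∀ e ∈ weighted l, e.tag < d.m :=
  fun _ he => (wellFormed_of_mem_weighted h.wellFormed he).tag_lt

theorem surjective_tagMap (h : Construction.Represents d M l nb) :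
    Function.Surjective (tagMap h.tag_lt) :=
  tagMap_surjective h.tag_lt fun i hi => by
    obtain ⟨e, he, hei⟩ := h.exists_tag i hi
    exact ⟨_, List.mem_map_of_mem he, hei⟩

/-- The passage from right-hand sides of the given system to right-hand sides of `weighted l`. -/
noncomputable def embedding (h : Construction.Represents d M l nb) :
    EuclideanSpace ℝ (Fin d.m) →ₗᵢ[ℝ] EuclideanSpace ℝ (Fin (weighted l).length) :=
  fiberEmbedding (tagMap h.tag_lt) h.surjective_tagMap

theorem adjoint_embedding_apply (h : Construction.Represents d M l nb)
    (b : EuclideanSpace ℝ (Fin (weighted l).length)) (i : Fin d.m) :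
    ContinuousLinearMap.adjoint h.embedding.toContinuousLinearMap b i =
      tagSum (prescribed l b) i :=
  (tagSum_prescribed h.wellFormed h.tag_lt h.surjective_tagMap i).symm

theorem bounded_prescribed (h : Construction.Represents d M l nb)
    (x : EuclideanSpace ℝ (Fin d.n))
    (b : EuclideanSpace ℝ (Fin (weighted l).length)) :
    d.Bounded (zeroExtend x) (prescribed l b) ‖x‖ ‖b‖ := by
  refine ⟨fun j hj => ?_, fun i hi => ?_, norm_nonneg b⟩
  · rw [zeroExtend_apply x ⟨j, hj⟩]
    exact PiLp.norm_apply_le x _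
  · let b' : EuclideanSpace ℝ (Fin (weighted l).length) := WithLp.toLp 2 fun r => |b r|
    calc tagNorm (prescribed l b) i
        = ContinuousLinearMap.adjoint h.embedding.toContinuousLinearMap b' ⟨i, hi⟩ := by
          rw [tagNorm, prescribed_abs h.wellFormed, h.adjoint_embedding_apply]
      _ ≤ ‖ContinuousLinearMap.adjoint h.embedding.toContinuousLinearMap b'‖ :=
          (Real.le_norm_self _).trans (PiLp.norm_apply_le _ _)
      _ ≤ ‖b'‖ := norm_adjoint_linearIsometry_le h.embedding b'
      _ = ‖b‖ := by simp [b', EuclideanSpace.norm_eq]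

theorem isLift (h : Construction.Represents d M l nb)
    {A : Matrix (Fin d.m) (Fin d.n) ℝ}
    (hA : ∀ (z : ℕ → ℝ) (i : Fin d.m), d.rowSum d.ent i z = ∑ j, A i j * z j) :
    IsLift A (sysMatrix (weighted l) nb) h.embedding
      (restrictVars d.n) (√(2 * nb : ℕ) * (10 * (1 + 2 * d.total))) (√(2 * nb : ℕ) * 10) where
  adjoint_apply z := by
    ext i
    rw [h.adjoint_embedding_apply, ← withResid_eq_prescribed h.wellFormed,
      h.tagSum_eq _ i i.2, hA, toEuclideanLin_apply_coord]
    rfl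
  exists_preimage x b hxb := by
    have hsum : ∀ i < d.m, tagSum (prescribed l b) i = d.rowSum d.ent i (zeroExtend x) := by
      intro i hi
      rw [← h.adjoint_embedding_apply b ⟨i, hi⟩, hxb,
        hA _ ⟨i, hi⟩, toEuclideanLin_apply_coord]
      simp only [zeroExtend_apply]
    obtain ⟨z, hz⟩ := h.exists_extension _ _ _ _ prescribed_map_fst
      (h.bounded_prescribed x b) hsum
    let z' : EuclideanSpace ℝ (Fin (2 * nb)) := WithLp.toLp 2 fun q => z q
    have hz' : ∀ q < 2 * nb, zeroExtend z' q = z q := fun q hq => zeroExtend_apply z' ⟨q, hq⟩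
    refine ⟨z', ?_, ?_⟩
    · ext r
      have hr := wellFormed_of_mem_weighted h.wellFormed (List.getElem_mem r.2)
      have hpos : 1 ≤ (weighted l)[r].mu := hr.one_le_mu
      have hres : (baseEqn l r).resid z = b r / (weighted l)[r].mu :=
        hz.resid_eq _ (List.mem_ofFn.2 ⟨r, rfl⟩)
      rw [toEuclideanLin_sysMatrix_apply fun _ => wellFormed_of_mem_weighted h.wellFormed,
        resid_getElem_weighted, (h.wellFormed _ (baseEqn_mem r)).resid_congr hz', hres,
        mul_div_cancel₀ _ (by positivity)]
    · have := d.total_nonneg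
      have hbound : 0 ≤ 10 * d.accBound ‖x‖ ‖b‖ := by
        unfold SparseMatrix.accBound
        positivity
      refine (norm_le_of_abs_le hbound fun q => hz.abs_le q q.2).trans_eq ?_
      unfold SparseMatrix.accBound
      ring

end Construction.Represents

end System

/-! ### Reading the given matrix -/

/-- The integer matrices in which every row sums to zero. -/
def zeroSumInteger : MatrixClass := fun m n =>
  {A | ∃ Z : Matrix (Fin m) (Fin n) ℤ, A = Z.map (fun z : ℤ => (z : ℝ)) ∧ ∀ i, ∑ j, Z i j = 0}

theorem zeroSumPowerTwo_subset (m n : ℕ) : zeroSumPowerTwo m n ⊆ zeroSumInteger m n :=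
  fun _ ⟨Z, hZ, _, _, hsum, _⟩ => ⟨Z, hZ, hsum⟩

theorem EfficientlyReducible.mono_left {M₁ M₁' M₂ : MatrixClass} {f : Params → Params}
    {T : Params → ℝ} (h : EfficientlyReducible M₁' M₂ f T) (hM : ∀ m n, M₁ m n ⊆ M₁' m n) :
    EfficientlyReducible M₁ M₂ f T := by
  obtain ⟨hpos, hmono, P, Q, C, hPQ⟩ := h
  exact ⟨hpos, hmono, P, Q, C, fun m n A c ε hA => hPQ m n A c ε (hM m n hA)⟩

/-- `d` lists the non-zero entries of the integer matrix `A`, whose rows sum to zero. -/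
structure SparseMatrix.Lists (d : SparseMatrix) {m n : ℕ} (A : Matrix (Fin m) (Fin n) ℝ) :
    Prop where
  m_eq : d.m = m
  n_eq : d.n = n
  s_eq : d.s = nnz A
  rowSum_eq : ∀ (z : ℕ → ℝ) (i : Fin m), d.rowSum d.ent i z = ∑ j, A i j * z j
  exists_entry : ∀ k < d.s, ∃ i j, (d.ent k : ℝ) = A i j ∧ A i j ≠ 0

section OfEquiv

variable {m n s : ℕ} {A : Matrix (Fin m) (Fin n) ℝ}

/-- The non-zero entries of `A` in the order given by `e`, with values from the integer matrix `Z`.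
Outside the range of `e`, rows, columns and values are `0`. -/
noncomputable def SparseMatrix.ofEquiv (Z : Matrix (Fin m) (Fin n) ℤ)
    (e : Fin s ≃ {p : Fin m × Fin n // A p.1 p.2 ≠ 0}) (hn : 0 < n) : SparseMatrix where
  m := m
  n := n
  s := s
  row := Function.extend Fin.val (fun k => (e k).1.1.val) 0
  col := Function.extend Fin.val (fun k => (e k).1.2.val) 0
  ent := Function.extend Fin.val (fun k => Z (e k).1.1 (e k).1.2) 0
  n_pos := hn
  row_lt k hk := by
    rw [Fin.val_injective.extend_apply _ _ (⟨k, hk⟩ : Fin s)]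
    exact Fin.is_lt _
  col_lt k hk := by
    rw [Fin.val_injective.extend_apply _ _ (⟨k, hk⟩ : Fin s)]
    exact Fin.is_lt _

variable {Z : Matrix (Fin m) (Fin n) ℤ} {e : Fin s ≃ {p : Fin m × Fin n // A p.1 p.2 ≠ 0}}
  {hn : 0 < n}

theorem SparseMatrix.ofEquiv_row {k : ℕ} (hk : k < s) :
    (ofEquiv Z e hn).row k = (e ⟨k, hk⟩).1.1 :=
  Fin.val_injective.extend_apply (fun k => ((e k).1.1 : ℕ)) _ ⟨k, hk⟩

theorem SparseMatrix.ofEquiv_col {k : ℕ} (hk : k < s) :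
    (ofEquiv Z e hn).col k = (e ⟨k, hk⟩).1.2 :=
  Fin.val_injective.extend_apply (fun k => ((e k).1.2 : ℕ)) _ ⟨k, hk⟩

theorem SparseMatrix.ofEquiv_ent {k : ℕ} (hk : k < s) :
    (ofEquiv Z e hn).ent k = Z (e ⟨k, hk⟩).1.1 (e ⟨k, hk⟩).1.2 :=
  Fin.val_injective.extend_apply (fun k => Z (e k).1.1 (e k).1.2) _ ⟨k, hk⟩

theorem SparseMatrix.rowSum_ofEquiv (hZ : A = Z.map (fun z : ℤ => (z : ℝ))) (z : ℕ → ℝ)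
    (i : Fin m) : (ofEquiv Z e hn).rowSum (ofEquiv Z e hn).ent i z = ∑ j, A i j * (z j - z 0) := by
  classical
  let g (p : Fin m × Fin n) : ℝ := if p.1 = i then A p.1 p.2 * (z p.2 - z 0) else 0
  calc (ofEquiv Z e hn).rowSum (ofEquiv Z e hn).ent i z
      = ∑ k : Fin s, if (ofEquiv Z e hn).row k = i then
          (ofEquiv Z e hn).ent k * (z ((ofEquiv Z e hn).col k) - z 0) else 0 :=
        Finset.sum_range _
    _ = ∑ k, g (e k).1 := by
        refine Finset.sum_congr rfl fun k _ => ?_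
        simp only [g, ofEquiv_row k.2, ofEquiv_col k.2, ofEquiv_ent k.2, Fin.val_inj, hZ,
          Matrix.map_apply]
    _ = ∑ p : {p : Fin m × Fin n // A p.1 p.2 ≠ 0}, g p := e.sum_comp fun p => g p.1
    _ = ∑ p, g p := by
        rw [← Finset.sum_filter_of_ne (p := fun p : Fin m × Fin n => A p.1 p.2 ≠ 0),
          ← Finset.sum_subtype_eq_sum_filter, Finset.subtype_univ]
        intro p _ hp hp0
        simp [g, hp0] at hp
    _ = ∑ j, A i j * (z j - z 0) := by
        simp only [g, Fintype.sum_prod_type]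
        rw [Finset.sum_eq_single i (fun i' _ hi' => by simp [hi']) (by simp)]
        simp

end OfEquiv

section Input

variable {m n : ℕ} {A : Matrix (Fin m) (Fin n) ℝ} {c : EuclideanSpace ℝ (Fin m)} {ε : ℝ}

theorem exists_sparseMatrix_lists (hA : A ∈ zeroSumInteger m n) (hA0 : A ≠ 0) {σ : State}
    (hσ : EncodesInstance σ 0 A c ε) :
    ∃ d : SparseMatrix, d.Lists A ∧ HoldsInput σ d (zeroExtend c) ε := by
  obtain ⟨Z, hZ, hsum⟩ := hA
  obtain ⟨⟨hm, hn, hs, e, -, he⟩, hc, hε⟩ := hσ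
  have hAZ (i : Fin m) (j : Fin n) : A i j = Z i j := by rw [hZ, Matrix.map_apply]
  have hn0 : 0 < n := Nat.pos_of_ne_zero fun h => hA0 <| by
    subst h
    exact Matrix.ext fun _ j => j.elim0
  refine ⟨.ofEquiv Z e hn0, ⟨rfl, rfl, rfl, fun z i => ?_, fun k (hk : k < nnz A) => ?_⟩,
    hm, hn, hs, fun k (hk : k < nnz A) => ?_, fun k (hk : k < nnz A) => ?_,
    fun k (hk : k < nnz A) => ?_, fun i hi => ?_, hε⟩
  · have hrow : ∑ j, A i j = 0 := by
      simp only [hAZ]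
      exact_mod_cast hsum i
    simp only [SparseMatrix.rowSum_ofEquiv hZ, mul_sub, Finset.sum_sub_distrib, ← Finset.sum_mul,
      hrow, zero_mul, sub_zero]
  · refine ⟨(e ⟨k, hk⟩).1.1, (e ⟨k, hk⟩).1.2, ?_, (e ⟨k, hk⟩).2⟩
    rw [SparseMatrix.ofEquiv_ent hk, hAZ]
  · rw [SparseMatrix.ofEquiv_row hk]
    exact (he ⟨k, hk⟩).1
  · rw [SparseMatrix.ofEquiv_col hk]
    exact (he ⟨k, hk⟩).2.1
  · rw [SparseMatrix.ofEquiv_ent hk, show σ.real 0 k = _ from (he ⟨k, hk⟩).2.2, hAZ]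
  · rw [zeroExtend_apply c ⟨i, hi⟩]
    exact hc ⟨i, hi⟩

theorem exists_one_le_abs (hA : A ∈ zeroSumInteger m n) (hA0 : A ≠ 0) : ∃ i j, 1 ≤ |A i j| := by
  obtain ⟨Z, rfl, -⟩ := hA
  obtain ⟨i, j, hij⟩ : ∃ i j, Z i j ≠ 0 := by
    by_contra! h
    exact hA0 (Matrix.ext fun i j => by simp [h i j])
  exact ⟨i, j, by simpa using mod_cast Int.one_le_abs hij⟩

theorem two_le_nnz (hA : A ∈ zeroSumInteger m n) (hA0 : A ≠ 0) : 2 ≤ nnz A := by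
  obtain ⟨Z, rfl, hsum⟩ := hA
  obtain ⟨i, j, hij⟩ : ∃ i j, Z i j ≠ 0 := by
    by_contra! h
    exact hA0 (Matrix.ext fun i j => by simp [h i j])
  obtain ⟨j', hj', hne⟩ : ∃ j' ≠ j, Z i j' ≠ 0 := by
    by_contra! h
    exact hij ((Finset.sum_eq_single j (fun j' _ => h j') (by simp)).symm.trans (hsum i))
  have : Nontrivial {p : Fin m × Fin n // Z.map (fun z : ℤ => (z : ℝ)) p.1 p.2 ≠ 0} :=
    ⟨⟨(i, j'), by simpa using hne⟩, ⟨(i, j), by simpa using hij⟩,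
      fun h => hj' (Prod.mk.inj (Subtype.mk.inj h)).2⟩
  exact Finite.one_lt_card

end Input

/-! ### The way back -/

def copyVar : Stmt := .setReal 7 (reg 10) (.get 6 (.mul (.const 2) (reg 10))) ;; tick

/-- The loop counter is a column of the given matrix. -/
def colTest : BExpr := .ilt (reg 10) (.get 0 (.const 1))

/-- The program that maps a solution of the new instance to one of the given instance. -/
def backward : Stmt := reset ;; .loop colTest copyVar

theorem runs_backward {n N : ℕ} (hnN : 2 * n ≤ N) {z : EuclideanSpace ℝ (Fin N)} {τ : State}
    (hn : τ.int 0 1 = n) (hz : EncodesVector τ 6 z) :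
    Runs backward τ (reset.maxCost + loopCost n colTest copyVar)
      fun τ' => EncodesVector τ' 7 (restrictVars n z) := by
  let I (k : ℕ) (τ : State) : Prop := τ.int 0 1 = n ∧ τ.int 8 10 = k ∧ EncodesVector τ 6 z ∧
    ∀ j < k, τ.real 7 (j : ℕ) = zeroExtend z (2 * j)
  have hreset : Runs reset τ reset.maxCost (I 0) :=
    Stmt.LoopFree.runs (by simp [reset, Stmt.LoopFree])
      ⟨by simp [reset, Stmt.run, State.setInt_int, hn],
        by simp [reset, Stmt.run, State.setInt_int, IExpr.eval], hz, by simp⟩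
  refine hreset.seq fun τ hτ => (Runs.loop_count I ?_ ?_ hτ).mono le_rfl
    fun τ hτ j => hτ.2.2.2 j j.2
  · rintro k τ ⟨hn, hk, -⟩
    simp [colTest, BExpr.eval, IExpr.eval, reg, hk, hn]
  · rintro k hkn τ ⟨hn, hk, hz, hcopied⟩
    refine Stmt.LoopFree.runs (by simp [copyVar, tick, Stmt.LoopFree])
      ⟨?_, ?_, fun i => ?_, fun j hjk => ?_⟩
    · simp [copyVar, tick, Stmt.run, State.setInt_int, State.setReal_int, hn]
    · simp [copyVar, tick, Stmt.run, State.setInt_int, State.setReal_int, IExpr.eval, reg, hk]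
    · rw [← hz i, Stmt.run_real_of_notMem (by simp [copyVar, tick, Stmt.realWrites])]
    · have hread := hz ⟨2 * k, by omega⟩
      rw [← zeroExtend_apply] at hread
      simp only [copyVar, tick, Stmt.run, State.setInt_real, State.setReal_real, IExpr.eval,
        RExpr.eval, reg, hk, Nat.cast_inj, true_and]
      rcases eq_or_ne j k with rfl | hne
      · simpa using hread
      · rw [if_neg hne]
        exact hcopied j (by omega)

theorem exists_runs_backward : ∃ K : ℕ, ∀ {n N s : ℕ} {z : EuclideanSpace ℝ (Fin N)} {τ : State},
    2 * n ≤ N → n ≤ s → 0 < s → τ.int 0 1 = n → EncodesVector τ 6 z →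
    Runs backward τ (K * s) fun τ' => EncodesVector τ' 7 (restrictVars n z) := by
  refine ⟨reset.maxCost + loopCost 1 colTest copyVar,
    fun {n N s z τ} hnN hns hs hn hz => (runs_backward hnN hn hz).mono ?_ fun _ h => h⟩
  rw [add_mul]
  exact add_le_add (Nat.le_mul_of_pos_right _ hs)
    (loopCost_le_mul (by rwa [one_mul]) hs colTest copyVar)

/-! ### Parameters of an instance -/

section Families

variable {ι : Type} [Finite ι] {a : ι → ℝ} {W : ℝ}

theorem maxAbs_le_iff (hW : 0 ≤ W) : maxAbs a ≤ W ↔ ∀ i, |a i| ≤ W :=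
  ⟨fun h i => (le_ciSup (f := fun i => |a i|) (Set.finite_range _).bddAbove i).trans h,
    fun h => Real.iSup_le h hW⟩

theorem one_div_minNonzero_le_iff (hW : 0 ≤ W) : 1 / minNonzero a ≤ W ↔ ∀ i, |a i|⁻¹ ≤ W := by
  have hfin : {r | ∃ i, a i ≠ 0 ∧ r = |a i|}.Finite :=
    (Set.finite_range fun i => |a i|).subset (by rintro r ⟨i, -, rfl⟩; exact ⟨i, rfl⟩)
  rcases Set.eq_empty_or_nonempty {r | ∃ i, a i ≠ 0 ∧ r = |a i|} with hempty | hne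
  · have hzero (i : ι) : a i = 0 := by
      by_contra hi
      exact hempty.le ⟨i, hi, rfl⟩
    simp [minNonzero, hzero, hW]
  · obtain ⟨i₀, hi₀, hmin⟩ := hne.csInf_mem hfin
    change minNonzero a = |a i₀| at hmin
    rw [one_div, hmin]
    refine ⟨fun h i => ?_, fun h => h i₀⟩
    rcases eq_or_ne (a i) 0 with hi | hi
    · simp [hi, hW]
    · refine le_trans (inv_anti₀ (abs_pos.2 hi₀) ?_) h
      rw [← hmin]
      exact csInf_le hfin.bddBelow ⟨i, hi, rfl⟩

end Families

section Magnitude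

variable {m n : ℕ} {A : Matrix (Fin m) (Fin n) ℝ} {c : EuclideanSpace ℝ (Fin m)} {ε W : ℝ}

/-- The second of the parameters of an instance, the one that measures the size of the numbers in
it. -/
noncomputable def magnitude (A : Matrix (Fin m) (Fin n) ℝ) (c : EuclideanSpace ℝ (Fin m)) : ℝ :=
  max (max (maxAbs fun p : Fin m × Fin n => A p.1 p.2) (maxAbs fun i => c i))
    (max (1 / minNonzero fun p : Fin m × Fin n => A p.1 p.2) (1 / minNonzero fun i => c i))

theorem sparseComplexity_eq :
    sparseComplexity A c ε = ((nnz A : ℝ), magnitude A c, condNumber A, ε⁻¹) := rfl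

theorem magnitude_nonneg : 0 ≤ magnitude A c :=
  (Real.iSup_nonneg fun _ => abs_nonneg _).trans ((le_max_left _ _).trans (le_max_left _ _))

theorem magnitude_le_iff (hW : 0 ≤ W) : magnitude A c ≤ W ↔
    (∀ i j, |A i j| ≤ W ∧ |A i j|⁻¹ ≤ W) ∧ ∀ i, |c i| ≤ W ∧ |c i|⁻¹ ≤ W := by
  simp only [magnitude, max_le_iff, maxAbs_le_iff hW, one_div_minNonzero_le_iff hW, Prod.forall,
    forall_and]
  tauto

theorem abs_apply_le_magnitude (i : Fin m) (j : Fin n) : |A i j| ≤ magnitude A c :=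
  (((magnitude_le_iff magnitude_nonneg).1 le_rfl).1 i j).1

theorem one_le_magnitude (h : ∃ i j, 1 ≤ |A i j|) : 1 ≤ magnitude A c :=
  let ⟨i, j, hij⟩ := h
  hij.trans (abs_apply_le_magnitude i j)

end Magnitude

section CondNumber

variable {m n : ℕ} {A : Matrix (Fin m) (Fin n) ℝ}

theorem one_le_condNumber (hA : A ≠ 0) : 1 ≤ condNumber A :=
  (one_le_div (sigmaMin_pos hA)).2 (sigmaMin_le_sigmaMax hA)

theorem inv_sigmaMin_le_condNumber (hA : A ≠ 0) (h : ∃ i j, 1 ≤ |A i j|) :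
    (sigmaMin A)⁻¹ ≤ condNumber A := by
  obtain ⟨i, j, hij⟩ := h
  rw [condNumber, inv_eq_one_div]
  have := sigmaMin_pos hA
  gcongr
  exact hij.trans (abs_apply_le_sigmaMax A i j)

theorem sigmaMax_le_sqrt_nnz_mul {W : ℝ} (hW : 0 ≤ W) (h : ∀ i j, |A i j| ≤ W) :
    sigmaMax A ≤ √(nnz A) * W := by
  classical
  refine sigmaMax_le_of_sum_sq_le A (by positivity) ?_
  rw [mul_pow, Real.sq_sqrt (by positivity), ← Fintype.sum_prod_type']
  calc ∑ p : Fin m × Fin n, A p.1 p.2 ^ 2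
      ≤ ∑ p : Fin m × Fin n, if A p.1 p.2 ≠ 0 then W ^ 2 else 0 := by
        refine Finset.sum_le_sum fun p _ => ?_
        split_ifs with hp
        · exact sq_le_sq' (neg_le_of_abs_le (h _ _)) (le_of_abs_le (h _ _))
        · simp [not_not.1 hp]
    _ = nnz A * W ^ 2 := by
        rw [← Finset.sum_filter, Finset.sum_const, nsmul_eq_mul, nnz, Nat.card_eq_fintype_card,
          Fintype.card_subtype]

end CondNumber

/-! ### Growth of the parameters -/

/-- The number `s * log (s * U)`, to which the size of the new system is proportional, with the
argument of the logarithm cut off at `2` to make it positive and increasing for all `s, U > 0`. -/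
noncomputable def work (s U : ℝ) : ℝ := s * Real.log (max (s * U) 2)

section Work

variable {s U : ℝ}

theorem work_pos (hs : 0 < s) : 0 < work s U :=
  mul_pos hs (Real.log_pos (one_lt_two.trans_le (le_max_right _ _)))

theorem work_mono {s' U' : ℝ} (hs : 0 ≤ s) (hU : 0 ≤ U) (hss' : s ≤ s') (hUU' : U ≤ U') :
    work s U ≤ work s' U' := by
  have : 0 ≤ s' := hs.trans hss'
  have hlog : 0 ≤ Real.log (max (s * U) 2) :=
    Real.log_nonneg (one_le_two.trans (le_max_right _ _))
  unfold work
  gcongr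

theorem work_eq (hs : 2 ≤ s) (hU : 1 ≤ U) : work s U = s * Real.log (s * U) := by
  rw [work, max_eq_left (by nlinarith)]

theorem one_le_work (hs : 2 ≤ s) : 1 ≤ work s U := by
  have hlog : Real.log 2 ≤ Real.log (max (s * U) 2) :=
    Real.log_le_log two_pos (le_max_right _ _)
  have := Real.log_two_gt_d9
  unfold work
  nlinarith

theorem mul_natLog_floor_add_one_le_work (hs : 2 ≤ s) (hU : 1 ≤ U) :
    s * (Nat.log 2 ⌊U⌋₊ + 1) ≤ 2 * work s U := by
  have hlog₂ := Real.log_two_gt_d9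
  have hlogs : Real.log 2 ≤ Real.log s := Real.log_le_log two_pos hs
  have hlogU : 0 ≤ Real.log U := Real.log_nonneg hU
  have hdigits : (Nat.log 2 ⌊U⌋₊ : ℝ) ≤ Real.log U / Real.log 2 := by
    refine (Real.natLog_le_logb _ _).trans ?_
    rw [Real.logb, Nat.cast_ofNat]
    gcongr
    · exact_mod_cast Nat.floor_pos.2 hU
    · exact Nat.floor_le (by linarith)
  have hhalf : Real.log U / Real.log 2 ≤ 2 * Real.log U := by
    rw [div_le_iff₀ (by linarith)]
    nlinarith
  rw [work_eq hs hU, Real.log_mul (by positivity) (by positivity), mul_left_comm]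
  gcongr
  linarith

theorem natCast_le_work {s t k : ℕ} (hs : 2 ≤ s) (hU : 1 ≤ U)
    (h : t ≤ k * (s * (Nat.log 2 ⌊U⌋₊ + 1))) : (t : ℝ) ≤ 2 * k * work s U :=
  calc (t : ℝ) ≤ k * (s * (Nat.log 2 ⌊U⌋₊ + 1)) := by exact_mod_cast h
    _ ≤ k * (2 * work s U) := mul_le_mul_of_nonneg_left
        (mul_natLog_floor_add_one_le_work (Nat.ofNat_le_cast.2 hs) hU) k.cast_nonneg
    _ = 2 * k * work s U := by ring

end Work

/-- The function `f` of the reduction.  In its third component `√(work s U) ^ 3` is the product of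
the number of equations, which bounds `σ_max`, and the square root of the number of variables, which
enters the bound of `σ_min`. -/
noncomputable def growth (p : Params) : Params :=
  (120 * work p.1 p.2.1, 6 * √(work p.1 p.2.1) * p.2.1,
    14400 * p.2.2.1 * p.1 * p.2.1 ^ 2 * √(work p.1 p.2.1) ^ 3, p.2.2.2)

theorem growth_mapsTo : Set.MapsTo growth posParams posParams := by
  rintro ⟨s, U, K, E⟩ ⟨hs, hU, hK, hE⟩
  have := work_pos (U := U) hs
  dsimp only at hs hU hK
  exact ⟨by dsimp only [growth]; positivity, by dsimp only [growth]; positivity,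
    by dsimp only [growth]; positivity, hE⟩

theorem growth_monotoneOn : MonotoneOn growth posParams := by
  rintro ⟨s, U, K, E⟩ ⟨hs, hU, hK, -⟩ ⟨s', U', K', E'⟩ ⟨hs', hU', hK', -⟩ ⟨hss', hUU', hKK', hEE'⟩
  dsimp only at hs hU hK hs' hU' hK' hss' hUU' hKK'
  have := work_mono hs.le hU.le hss' hUU'
  refine ⟨?_, ?_, ?_, hEE'⟩ <;> dsimp only [growth] <;> gcongr

theorem growth_le {s U K E : ℝ} (hs : 2 ≤ s) (hU : 1 ≤ U) (hK : 0 ≤ K) (hE : 0 ≤ E) :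
    growth (s, U, K, E) ≤
      (14400 * (s * Real.log (s * U)),
        14400 * (s ^ (3 / 2 : ℝ) * U * Real.log (s * U) ^ (1 / 2 : ℝ)),
        14400 * (K * s ^ 4 * U ^ 2 * Real.log (s * U) ^ 2),
        14400 * (s * U ^ 2 * E)) := by
  have hwork : 1 ≤ work s U := one_le_work hs
  have hlog : 0 ≤ Real.log (s * U) := Real.log_nonneg (by nlinarith)
  refine ⟨?_, ?_, ?_, ?_⟩ <;> dsimp only [growth]
  · rw [← work_eq hs hU]
    gcongr
    norm_num
  · have hsqrt : √(work s U) ≤ s ^ (3 / 2 : ℝ) * Real.log (s * U) ^ (1 / 2 : ℝ) := by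
      rw [work_eq hs hU, Real.sqrt_eq_rpow, Real.mul_rpow (by positivity) hlog]
      gcongr
      · linarith
      · norm_num
    calc 6 * √(work s U) * U
        ≤ 14400 * (s ^ (3 / 2 : ℝ) * Real.log (s * U) ^ (1 / 2 : ℝ)) * U := by
          gcongr
          norm_num
      _ = _ := by ring
  · calc 14400 * K * s * U ^ 2 * √(work s U) ^ 3
        ≤ 14400 * K * s * U ^ 2 * √(work s U) ^ 4 := by
          gcongr
          · exact Real.one_le_sqrt.2 hwork
          · norm_num
      _ = 14400 * (K * s ^ 3 * U ^ 2 * Real.log (s * U) ^ 2) := by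
          rw [show √(work s U) ^ 4 = (√(work s U) ^ 2) ^ 2 by ring,
            Real.sq_sqrt (by positivity), work_eq hs hU]
          ring
      _ ≤ 14400 * (K * s ^ 4 * U ^ 2 * Real.log (s * U) ^ 2) := by
          gcongr
          · linarith
          · norm_num
  · have : 1 ≤ s * U ^ 2 := by nlinarith
    nlinarith

/-! ### Parameters of the new instance -/

theorem tagMap_weighted {l : List Eqn} {m : ℕ} (h : ∀ e ∈ weighted l, e.tag < m)
    (r : Fin (weighted l).length) : (tagMap h r : ℕ) = (baseEqn l r).tag := by
  have := congrArg Eqn.tag (getElem_weighted r)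
  exact this

namespace Construction.Represents

variable {d : SparseMatrix} {l : List Eqn} {nb : ℕ} {M : ℝ} {c : EuclideanSpace ℝ (Fin d.m)}

theorem embedding_apply (h : Construction.Represents d M l nb) (r : Fin (weighted l).length) :
    h.embedding c r = c (tagMap h.tag_lt r) / √(tagCount l (baseEqn l r).tag) := by
  rw [embedding, fiberEmbedding_apply, card_tagMap_fiber, tagCount_weighted, tagMap_weighted]

theorem nnz_sysMatrix_bounds (h : Construction.Represents d M l nb) :
    2 * l.length ≤ nnz (sysMatrix (weighted l) nb) ∧
      nnz (sysMatrix (weighted l) nb) ≤ 4 * l.length := by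
  rw [(enumerates_entries fun _ => wellFormed_of_mem_weighted h.wellFormed).nnz_eq,
    ← length_weighted]
  exact length_entries _

theorem abs_sysMatrix_bounds (h : Construction.Represents d M l nb) {r : Fin (weighted l).length}
    {q : Fin (2 * nb)} (hrq : sysMatrix (weighted l) nb r q ≠ 0) :
    1 ≤ |sysMatrix (weighted l) nb r q| ∧ |sysMatrix (weighted l) nb r q| ≤ M * √l.length := by
  have hr := wellFormed_of_mem_weighted h.wellFormed (List.getElem_mem r.2)
  rw [abs_sysMatrix_of_ne_zero (fun _ => wellFormed_of_mem_weighted h.wellFormed) hrq]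
  exact ⟨hr.one_le_mu, hr.mu_le⟩

theorem magnitude_le (h : Construction.Represents d M l nb) {W : ℝ} (hW : 1 ≤ W) (hMW : M ≤ W)
    (hc : ∀ i, |c i| ≤ W ∧ |c i|⁻¹ ≤ W) (hl : 0 < l.length) :
    magnitude (sysMatrix (weighted l) nb) (h.embedding c) ≤ W * √l.length := by
  have hlength : 1 ≤ √(l.length : ℝ) := Real.one_le_sqrt.2 (by exact_mod_cast hl)
  have hbound : 1 ≤ W * √l.length := one_le_mul_of_one_le_of_one_le hW hlength
  refine (magnitude_le_iff (by positivity)).2 ⟨fun r q => ?_, fun r => ?_⟩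
  · by_cases hrq : sysMatrix (weighted l) nb r q = 0
    · simp [hrq, zero_le_one.trans hbound]
    · obtain ⟨hone, hle⟩ := h.abs_sysMatrix_bounds hrq
      exact ⟨hle.trans (by gcongr), (inv_le_one_of_one_le₀ hone).trans hbound⟩
  · obtain ⟨hle, hinv⟩ := hc (tagMap h.tag_lt r)
    have hcount : (1 : ℝ) ≤ tagCount l (baseEqn l r).tag := by
      exact_mod_cast tagCount_pos (baseEqn_mem r)
    have hcount' : (tagCount l (baseEqn l r).tag : ℝ) ≤ l.length := by
      exact_mod_cast List.countP_le_length
    rw [h.embedding_apply, abs_div, abs_of_nonneg (Real.sqrt_nonneg _), inv_div]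
    constructor
    · refine (div_le_self (abs_nonneg _) (Real.one_le_sqrt.2 hcount)).trans (hle.trans ?_)
      exact le_mul_of_one_le_right (by linarith) hlength
    · rw [div_eq_mul_inv, mul_comm]
      gcongr

theorem sigmaMax_le (h : Construction.Represents d M l nb) (hM : 0 ≤ M) :
    sigmaMax (sysMatrix (weighted l) nb) ≤ 2 * M * l.length := by
  have hentry (r : Fin (weighted l).length) (q : Fin (2 * nb)) :
      |sysMatrix (weighted l) nb r q| ≤ M * √l.length := by
    by_cases hrq : sysMatrix (weighted l) nb r q = 0
    · rw [hrq, abs_zero]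
      positivity
    · exact (h.abs_sysMatrix_bounds hrq).2
  have hnnz : (nnz (sysMatrix (weighted l) nb) : ℝ) ≤ 2 ^ 2 * l.length := by
    norm_num
    exact_mod_cast h.nnz_sysMatrix_bounds.2
  calc sigmaMax (sysMatrix (weighted l) nb)
      ≤ √(nnz (sysMatrix (weighted l) nb)) * (M * √l.length) :=
        sigmaMax_le_sqrt_nnz_mul (by positivity) hentry
    _ ≤ √(2 ^ 2 * l.length) * (M * √l.length) := by gcongr
    _ = 2 * M * (√l.length * √l.length) := by
        rw [Real.sqrt_mul (by norm_num), Real.sqrt_sq two_pos.le]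
        ring
    _ = 2 * M * l.length := by rw [Real.mul_self_sqrt (by positivity)]

theorem condNumber_le (h : Construction.Represents d M l nb) {A : Matrix (Fin d.m) (Fin d.n) ℝ}
    (hA : ∀ (z : ℕ → ℝ) (i : Fin d.m), d.rowSum d.ent i z = ∑ j, A i j * z j) (hA0 : A ≠ 0)
    (hone : ∃ i j, 1 ≤ |A i j|) (hM : 0 ≤ M) (hB0 : sysMatrix (weighted l) nb ≠ 0) {T : ℝ}
    (hT : 2 ≤ T) (htotal : d.total ≤ T) :
    condNumber (sysMatrix (weighted l) nb) ≤
      60 * condNumber A * M * T * (l.length * √(2 * nb : ℕ)) := by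
  have hone' := one_le_condNumber hA0
  have htotal₀ := d.total_nonneg
  have hmin : (sigmaMin (sysMatrix (weighted l) nb))⁻¹ ≤
      √(2 * nb : ℕ) * (30 * T * condNumber A) :=
    calc (sigmaMin (sysMatrix (weighted l) nb))⁻¹
        ≤ √(2 * nb : ℕ) * (10 * (1 + 2 * d.total)) * (sigmaMin A)⁻¹ + √(2 * nb : ℕ) * 10 :=
          (h.isLift hA).inv_sigmaMin_le hA0 hB0 (by positivity)
      _ ≤ √(2 * nb : ℕ) * (10 * (1 + 2 * T)) * condNumber A +
          √(2 * nb : ℕ) * (10 * condNumber A) := by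
          gcongr
          · exact (inv_pos.2 (sigmaMin_pos hA0)).le
          · exact inv_sigmaMin_le_condNumber hA0 hone
          · linarith
      _ = √(2 * nb : ℕ) * ((20 + 20 * T) * condNumber A) := by ring
      _ ≤ √(2 * nb : ℕ) * (30 * T * condNumber A) := by
          gcongr
          linarith
  calc condNumber (sysMatrix (weighted l) nb)
      = sigmaMax (sysMatrix (weighted l) nb) * (sigmaMin (sysMatrix (weighted l) nb))⁻¹ :=
        div_eq_mul_inv _ _
    _ ≤ 2 * M * l.length * (√(2 * nb : ℕ) * (30 * T * condNumber A)) :=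
        mul_le_mul (h.sigmaMax_le hM) hmin (inv_nonneg.2 (sigmaMin_pos hB0).le) (by positivity)
    _ = 60 * condNumber A * M * T * (l.length * √(2 * nb : ℕ)) := by ring

end Construction.Represents

namespace SparseMatrix.Lists

variable {d : SparseMatrix} {m n : ℕ} {A : Matrix (Fin m) (Fin n) ℝ}
  {c : EuclideanSpace ℝ (Fin m)}

theorem abs_ent_le (h : d.Lists A) {k : ℕ} (hk : k < d.s) : |(d.ent k : ℝ)| ≤ magnitude A c := by
  obtain ⟨i, j, hij, -⟩ := h.exists_entry k hk
  rw [hij]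
  exact abs_apply_le_magnitude i j

theorem natAbs_ent_le (h : d.Lists A) {k : ℕ} (hk : k < d.s) :
    (d.ent k).natAbs ≤ ⌊magnitude A c⌋₊ := by
  refine Nat.le_floor ?_
  rw [Nat.cast_natAbs, Int.cast_abs]
  exact h.abs_ent_le hk

theorem ent_ne_zero (h : d.Lists A) {k : ℕ} (hk : k < d.s) : d.ent k ≠ 0 := by
  obtain ⟨i, j, hij, hne⟩ := h.exists_entry k hk
  exact_mod_cast hij ▸ hne

theorem total_le (h : d.Lists A) : d.total ≤ d.s * magnitude A c :=
  calc d.total ≤ ∑ _k ∈ Finset.range d.s, magnitude A c :=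
        Finset.sum_le_sum fun _ hk => h.abs_ent_le (Finset.mem_range.1 hk)
    _ = d.s * magnitude A c := by rw [Finset.sum_const, Finset.card_range, nsmul_eq_mul]

end SparseMatrix.Lists

theorem ne_zero_of_nnz_pos {m n : ℕ} {A : Matrix (Fin m) (Fin n) ℝ} (h : 0 < nnz A) : A ≠ 0 := by
  rintro rfl
  simp [nnz] at h

section Output

variable {d : SparseMatrix} {l : List Eqn} {nb : ℕ} {M ε : ℝ} {A : Matrix (Fin d.m) (Fin d.n) ℝ}
  {c : EuclideanSpace ℝ (Fin d.m)}

theorem Finished.encodesInstance {σ : State} (hσ : Finished (zeroExtend c) ε σ l nb)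
    (h : Construction.Represents d M l nb) :
    EncodesInstance σ 3 (sysMatrix (weighted l) nb) (h.embedding c) ε := by
  have hE := enumerates_entries fun _ => wellFormed_of_mem_weighted h.wellFormed
  refine ⟨hE.encodesMatrix hσ.entries (by rw [hσ.length, length_weighted]) hσ.cols,
    fun r => ?_, hσ.eps⟩
  rw [hσ.rhs r (length_weighted l ▸ r.2), h.embedding_apply, ← zeroExtend_apply,
    tagMap_weighted]
  rfl

theorem Construction.Represents.admissible (h : Construction.Represents d M l nb) (hnb : 0 < nb)
    (hnbl : nb ≤ l.length) (hε : 0 < ε) (hε1 : ε ≤ 1) :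
    Admissible (sysMatrix (weighted l) nb) ε := by
  have := h.nnz_sysMatrix_bounds.1
  have := length_weighted l
  exact ⟨ne_zero_of_nnz_pos (by omega), max_le (by omega) (by omega), hε, hε1⟩

theorem sparseComplexity_sysMatrix_le (h : Construction.Represents d M l nb) (hd : d.Lists A)
    (hA0 : A ≠ 0) (hone : ∃ i j, 1 ≤ |A i j|) (hs : 2 ≤ d.s) (hM : 0 ≤ M)
    (hMA : M ≤ magnitude A c) (hnb : 0 < nb) (hnbl : nb ≤ l.length)
    (hl : (l.length : ℝ) ≤ 30 * work d.s (magnitude A c)) :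
    sparseComplexity (sysMatrix (weighted l) nb) (h.embedding c) ε ≤
      growth (sparseComplexity A c ε) := by
  set U := magnitude A c with hU
  have hU1 : 1 ≤ U := one_le_magnitude hone
  have hs' : (2 : ℝ) ≤ d.s := by exact_mod_cast hs
  set X := √(work d.s U)
  have hX2 : work d.s U = X ^ 2 := (Real.sq_sqrt (work_pos (by linarith)).le).symm
  rw [hX2] at hl
  have hsqrt : √(l.length : ℝ) ≤ 6 * X := Real.sqrt_le_iff.2 ⟨by positivity, by nlinarith⟩
  have hcols : ((2 * nb : ℕ) : ℝ) ≤ 2 * l.length := by exact_mod_cast Nat.mul_le_mul_left 2 hnbl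
  have hsqrt' : √((2 * nb : ℕ) : ℝ) ≤ 8 * X :=
    Real.sqrt_le_iff.2 ⟨by positivity, by nlinarith⟩
  have hB0 : sysMatrix (weighted l) nb ≠ 0 :=
    ne_zero_of_nnz_pos (by have := h.nnz_sysMatrix_bounds.1; omega)
  rw [sparseComplexity_eq, sparseComplexity_eq, ← hd.s_eq]
  refine ⟨?_, ?_, ?_, le_rfl⟩ <;> dsimp only [growth] <;> rw [← hU]
  · have : (nnz (sysMatrix (weighted l) nb) : ℝ) ≤ 4 * l.length := by
      exact_mod_cast h.nnz_sysMatrix_bounds.2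
    linarith
  · calc magnitude (sysMatrix (weighted l) nb) (h.embedding c) ≤ U * √l.length :=
        h.magnitude_le hU1 hMA ((magnitude_le_iff (by positivity)).1 le_rfl).2 (by omega)
      _ ≤ U * (6 * X) := by gcongr
      _ = 6 * X * U := mul_comm _ _
  · have := one_le_condNumber hA0
    calc condNumber (sysMatrix (weighted l) nb)
        ≤ 60 * condNumber A * M * (d.s * U) * (l.length * √(2 * nb : ℕ)) :=
          h.condNumber_le hd.rowSum_eq hA0 hone hM hB0 (by nlinarith) hd.total_le
      _ ≤ 60 * condNumber A * U * (d.s * U) * (30 * X ^ 2 * (8 * X)) := by gcongr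
      _ = 14400 * condNumber A * d.s * U ^ 2 * X ^ 3 := by ring

end Output

theorem exists_exec_forward : ∃ K : ℕ, ∀ {m n : ℕ} {A : Matrix (Fin m) (Fin n) ℝ}
    {c : EuclideanSpace ℝ (Fin m)} {ε : ℝ} {σ : State}, A ∈ zeroSumInteger m n → Admissible A ε →
      EncodesInstance σ 0 A c ε →
      ∃ σ' t, Exec forward σ t σ' ∧ (t : ℝ) ≤ K * work (nnz A) (magnitude A c) ∧
        ∃ (m' N : ℕ) (B : Matrix (Fin m') (Fin N) ℝ) (c' : EuclideanSpace ℝ (Fin m')),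
          EncodesInstance σ' 3 B c' ε ∧ B ∈ twoCommodity m' N ∧ Admissible B ε ∧
          sparseComplexity B c' ε ≤ growth (sparseComplexity A c ε) ∧ 2 * n ≤ N ∧
          ∀ x, IsLSASolution B c' ε x → IsLSASolution A c ε (restrictVars n x) := by
  obtain ⟨K, hforward⟩ := exists_runs_forward
  refine ⟨2 * K, fun {m n A c ε σ} hA ⟨hA0, hmn, hε, hε1⟩ hσ => ?_⟩
  obtain ⟨d, hd, hin⟩ := exists_sparseMatrix_lists hA hA0 hσ
  obtain rfl := hd.m_eq
  obtain rfl := hd.n_eq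
  rw [← hd.s_eq] at hmn ⊢
  obtain ⟨hms, hns⟩ := max_le_iff.1 hmn
  have hs : 2 ≤ d.s := hd.s_eq ▸ two_le_nnz hA hA0
  have hone := exists_one_le_abs hA hA0
  have hn := d.n_pos
  obtain ⟨σ', t, hexec, ht, l, nb, hσ', h, hnnb, hnbl, hl⟩ :=
    hforward hin hms hns (fun k hk => hd.natAbs_ent_le (c := c) hk)
      ⟨0, by omega, hd.ent_ne_zero (by omega)⟩
  have htwo := sysMatrix_mem_twoCommodity fun _ => wellFormed_of_mem_weighted h.wellFormed
  have hlength : (l.length : ℝ) ≤ 30 * work d.s (magnitude A c) :=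
    (natCast_le_work hs (one_le_magnitude hone) hl).trans_eq (by norm_num)
  have hgrowth := sparseComplexity_sysMatrix_le (ε := ε) h hd hA0 hone hs (by positivity)
    (Nat.floor_le magnitude_nonneg) (by omega) hnbl hlength
  refine ⟨σ', t, hexec, ?_, _, _, _, _, hσ'.encodesInstance h, htwo,
    h.admissible (by omega) hnbl hε hε1, hgrowth, by omega,
    fun x hx => (h.isLift hd.rowSum_eq).isLSASolution hx⟩
  exact_mod_cast natCast_le_work hs (one_le_magnitude hone) ht

theorem mainTheorem3_general :
    ∃ f : Params → Params,
      (∃ C : ℝ, ∀ s U K E : ℝ, 2 ≤ s → 1 ≤ U → 1 ≤ K → 1 ≤ E →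
        f (s, U, K, E) ≤
          (C * (s * Real.log (s * U)),
            C * (s ^ (3 / 2 : ℝ) * U * Real.log (s * U) ^ (1 / 2 : ℝ)),
            C * (K * s ^ 4 * U ^ 2 * Real.log (s * U) ^ 2),
            C * (s * U ^ 2 * E))) ∧
      EfficientlyReducible zeroSumInteger twoCommodity f
        (fun p => p.1 * Real.log (p.1 * p.2.1)) := by
  obtain ⟨K, hforward⟩ := exists_exec_forward
  obtain ⟨K', hbackward⟩ := exists_runs_backward
  refine ⟨growth, ⟨14400, fun s U K E hs hU hK hE => growth_le hs hU (by linarith) (by linarith)⟩,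
    growth_mapsTo, growth_monotoneOn, forward, backward, K + K', fun m n A c ε hA hadm σ hσ => ?_⟩
  have hs : 2 ≤ nnz A := two_le_nnz hA hadm.1
  have hwork := work_eq (Nat.ofNat_le_cast.2 hs)
    (one_le_magnitude (c := c) (exists_one_le_abs hA hadm.1))
  obtain ⟨σ', t, hexec, ht, m', N, B, c', hσ', hB, hBadm, hgrowth, hN, hsol⟩ :=
    hforward hA hadm hσ
  refine ⟨σ', t, hexec, ?_, m', N, B, c', ε, hσ', hB, hBadm, hgrowth, fun x hx τ hτ _ hτx => ?_⟩
  · have := work_pos (U := magnitude A c) (s := nnz A) (by positivity)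
    rw [sparseComplexity_eq]
    dsimp only
    rw [← hwork]
    exact ht.trans (by gcongr; linarith)
  · obtain ⟨τ', u, hexec', hu, hτ'⟩ :=
      hbackward hN ((le_max_right _ _).trans hadm.2.1) (by omega) hτ.2.1 hτx
    refine ⟨τ', u, _, hexec', ?_, hτ', hsol x hx⟩
    have : (u : ℝ) ≤ K' * nnz A := by exact_mod_cast hu
    exact this.trans (by gcongr; linarith)

end LinSys

open LinSys in
theorem mainTheorem3 :
    ∃ f : Params → Params,
      (∃ C : ℝ, ∀ s U K E : ℝ, 2 ≤ s → 1 ≤ U → 1 ≤ K → 1 ≤ E →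
        f (s, U, K, E) ≤
          (C * (s * Real.log (s * U)),
            C * (s ^ (3 / 2 : ℝ) * U * Real.log (s * U) ^ (1 / 2 : ℝ)),
            C * (K * s ^ 4 * U ^ 2 * Real.log (s * U) ^ 2),
            C * (s * U ^ 2 * E))) ∧
      EfficientlyReducible zeroSumPowerTwo twoCommodity f
        (fun p => p.1 * Real.log (p.1 * p.2.1)) := by
  obtain ⟨f, hf, h⟩ := mainTheorem3_general
  exact ⟨f, hf, h.mono_left zeroSumPowerTwo_subset⟩
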